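/- Theorem 2. Let $d\ge 1$, let $X$ be a random vector in $\mathbb R^{d}$ with support $\mathbb X$ and Lebesgue density $f_X$, and let $Y(0),Y(1)$ be integrable potential outcomes. Let $\Omega\subset\mathbb R^d$ (the treated region) be closed and bounded with piecewise smooth boundary: $\Omega$ is the closure of its interior, and $\partial\Omega$ is a finite union of sets $\psi_i(K_i)$, where $K_i\subset\mathbb R^{d-1}$ is compact with $\partial K_i$ of measure zero, $\psi_i$ is a $C^2$ map that is an injective immersion on the interior of $K_i$, and the sets $\psi_i(\operatorname{int}K_i)$ are disjoint from each other and from all $\psi_j(\partial K_j)$. Put $Y=Y(1)$ if $X\in\Omega$ and $Y=Y(0)$ otherwise. Let $g(x)=\operatorname{dist}(x,\partial\Omega)$ for $x\in\Omega$ and $g(x)=-\operatorname{dist}(x,\partial\Omega)$ for $x\notin\Omega$; write $g=g(X)$ and let $f_g$ be its density. Assume: * $X$ and $Y$ are almost surely bounded; * $f_g$ is (a.e.) bounded away from zero in a neighborhood of $0$; * for $t\in\{0,1\}$, $m_t(x)=\mathbb E[Y(t)\mid X=x]$ is twice continuously differentiable and bounded on $\mathbb X$; * $f_X$ is bounded in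 a neighborhood of $\partial\Omega$ and continuous at almost every point of $\partial\Omega$. Let $S$ be the $(d-1)$-dimensional (normalized) Hausdorff measure, $\tau(x)=m_1(x)-m_0(x)$ (where $m_t$ is extended measurably, but otherwise arbitrarily, outside $\mathbb X$), $\gamma(x)$ a (measurably chosen) point of $\partial\Omega$ closest to $x$, $\Gamma(x)=1$ if $\tau(\gamma(x))\ge 0$ and $\Gamma(x)=0$ otherwise, and $\Gamma=\Gamma(X)$. Densities and conditional expectations are determined only up to null sets of values of the conditioning variable; limits in $\epsilon$ are understood after removal of such a null set, and $f_g(0)$ and $\mathbb E[\Gamma\mid g=0]$ denote the limits at $0$ of $f_g$ and $\mathbb E[\Gamma\mid g=\cdot\,]$ in this sense. These two limits exist, and $f_g(0)>0$. The limits below exist too, except that a bracket whose weight, $\mathbb E[\Gamma\mid g=0]$ or $1-\mathbb E[\Gamma\mid g=0]$, is zero may be undefined, and its term then counts as $0$: $$\tau_\Gamma:=\Big(\lim_{\epsilon\to0^+}\mathbb E[Y\mid g=\epsilon,\Gamma=1]-\lim_{\epsilon\to0^-}\mathbb E[Y\mid g=\epsilon,\Gamma=1]\Big)\mathbb E[\Gamma\mid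 g=0]-\Big(\lim_{\epsilon\to0^+}\mathbb E[Y\mid g=\epsilon,\Gamma=0]-\lim_{\epsilon\to0^-}\mathbb E[Y\mid g=\epsilon,\Gamma=0]\Big)\big(1-\mathbb E[\Gamma\mid g=0]\big).$$ Then $|\tau|f_X$ is integrable on $\partial\Omega$, and $$\tau_\Gamma=\frac1{f_g(0)}\int_{\partial\Omega}|\tau(x)|f_X(x)\,dS=\frac1{f_g(0)}\int_{\partial\Omega}(2\Gamma(x)-1)\tau(x)f_X(x)\,dS,$$ $$\tau_\Gamma=\lim_{\epsilon\to0^+}\mathbb E[(2\Gamma-1)Y\mid g=\epsilon]-\lim_{\epsilon\to0^-}\mathbb E[(2\Gamma-1)Y\mid g=\epsilon].$$ Moreover $\tau_\Gamma=0$ if and only if $\tau(x)=0$ for $S$-almost every $x\in\partial\Omega$ with $f_X(x)>0$ (hence, if $f_X>0$ almost everywhere on $\partial\Omega$, if and only if $\tau=0$ almost everywhere on $\partial\Omega$). -/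

import Mathlib

open MeasureTheory Set Filter Topology

noncomputable section

/-- The signed Euclidean distance to `∂Ω`, nonnegative on `Ω` and nonpositive off `Ω`. -/
def signedBoundaryDist {n : ℕ} (Ω : Set (EuclideanSpace ℝ (Fin n)))
    (x : EuclideanSpace ℝ (Fin n)) : ℝ :=
  open Classical in
  if x ∈ Ω then Metric.infDist x (frontier Ω) else - Metric.infDist x (frontier Ω)

/-- `Ω ⊆ ℝⁿ⁺¹` has a piecewise smooth boundary: `Ω` is the closure of its interior (it lies
locally on one side of the smooth part of its boundary, without slits or hairs), and `∂Ω` is a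
finite union of patches `ψ i (K i)`. Here `K i ⊆ ℝⁿ` is compact with an edge `∂(K i)` of measure
zero, `ψ i` is a `C²` map which is an injective immersion on the interior of `K i`, and the
interiors of the patches meet neither each other nor the edges of the patches.
(`C²` is all the smoothness that is asked for; edges, corners and conical points may occur.) -/
def HasPiecewiseSmoothBoundary {n : ℕ} (Ω : Set (EuclideanSpace ℝ (Fin (n + 1)))) : Prop :=
  closure (interior Ω) = Ω ∧
  ∃ (N : ℕ) (K : Fin N → Set (EuclideanSpace ℝ (Fin n)))
    (ψ : Fin N → EuclideanSpace ℝ (Fin n) → EuclideanSpace ℝ (Fin (n + 1))),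
    (∀ i, IsCompact (K i) ∧ volume (frontier (K i)) = 0) ∧
    (∀ i, ContDiff ℝ 2 (ψ i) ∧ InjOn (ψ i) (interior (K i)) ∧
      ∀ u ∈ interior (K i), Function.Injective (fderiv ℝ (ψ i) u)) ∧
    (∀ i j, i ≠ j → Disjoint (ψ i '' interior (K i)) (ψ j '' interior (K j))) ∧
    (∀ i j, Disjoint (ψ i '' interior (K i)) (ψ j '' frontier (K j))) ∧
    frontier Ω = ⋃ i, ψ i '' K i

/-- `γ` maps every point to a point of `∂Ω` closest to it (ties are broken arbitrarily). -/
def IsNearestBoundaryPoint {n : ℕ} (Ω : Set (EuclideanSpace ℝ (Fin n)))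
    (γ : EuclideanSpace ℝ (Fin n) → EuclideanSpace ℝ (Fin n)) : Prop :=
  ∀ x, γ x ∈ frontier Ω ∧ dist x (γ x) = Metric.infDist x (frontier Ω)

/-- `Γ(x) = 1` if `τ(γ(x)) ≥ 0`, and `Γ(x) = 0` otherwise. -/
def signIndicator {E : Type*} (τ : E → ℝ) (γ : E → E) (x : E) : ℝ :=
  open Classical in if 0 ≤ τ (γ x) then 1 else 0

/-- The observed outcome: `Y(1)` for treated units (`X ∈ Ω`), `Y(0)` for the others. -/
def observedOutcome {S E : Type*} (Ω : Set E) (X : S → E) (Y₀ Y₁ : S → ℝ) (ω : S) : ℝ :=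
  open Classical in if X ω ∈ Ω then Y₁ ω else Y₀ ω

/-- `f` is a (finite, everywhere nonnegative) Lebesgue density of the random element `Z`. -/
structure IsDensity {S F : Type*} [MeasurableSpace S] [MeasureSpace F] (μ : Measure S)
    (Z : S → F) (f : F → ℝ) : Prop where
  measurable : Measurable f
  nonneg : ∀ z, 0 ≤ f z
  map_eq : μ.map Z = (volume : Measure F).withDensity (fun z => ENNReal.ofReal (f z))

/-- `h` is a version of the regression function `z ↦ E[W | Z = z]`. -/
structure IsRegression {S F : Type*} [MeasurableSpace S] [mF : MeasurableSpace F]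
    (μ : Measure S) (W : S → ℝ) (Z : S → F) (h : F → ℝ) : Prop where
  integrable : Integrable W μ
  measurable : Measurable h
  ae_eq : (fun ω => h (Z ω)) =ᵐ[μ] μ[W | MeasurableSpace.comap Z mF]

/-- `h` tends to `a` along `l` after removal of a `ν`-null set: the notion of limit for a function
which, like a density or a regression function, is determined only up to `ν`-null sets. The filter
is required to be proper, so that `a` is unique. -/
def HasEssLimit {F : Type*} [MeasurableSpace F] (ν : Measure F) (h : F → ℝ) (l : Filter F)
    (a : ℝ) : Prop :=
  (l ⊓ ae ν).NeBot ∧ Tendsto h (l ⊓ ae ν) (𝓝 a)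

end

noncomputable section

open scoped RealInnerProductSpace ENNReal NNReal

local notation "𝔼" n:max => EuclideanSpace ℝ (Fin n)

/-! ### Normal vectors of hyperplanes -/

/-! Every limit in the theorem is a quotient of surface integrals. Put `σ = 1` where `τ ≥ 0` and `σ
= 0` elsewhere, so that `Γ = σ ∘ γ`, and let `L s` and `I m s` be the integrals of `fX` and of `fX *
m` over the part of `∂Ω` where `σ = s`. Then `f_g(0) = L 1 + L 0`, `E[Γ | g = 0] = L 1 / (L 1 + L
0)`, and the limit of `E[Y | g, Γ = s]` is `I m₁ s / L s` from inside and `I m₀ s / L s` from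
outside. The weights cancel the denominators `L s`, and `(2σ - 1)τ = |τ|` gives the formulas. The
last claim says that a nonnegative function has integral zero exactly when it vanishes almost
everywhere.

These limits ignore null sets of values of `g`, so tubes `{0 < g < ε}` do not suffice: one needs,
for all measurable `A` in a small one-sided neighbourhood of `0`, that the integral of `f * (G ∘ γ)`
over `{g ∈ A}` is `|A|` times the integral of `f * G` over `∂Ω`, up to `ε|A|` (`HasDensityAlong`).
Testing this on the set where a regression function is off its expected limit by `η` shows that this
set is null near `0` (`hasEssLimit_of_hasDensityAlong`).

The tube asymptotics (`IsPatchDecomposition.exists_tube_estimate`) treat two kinds of points. Points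
whose nearest boundary point lies in a compact core of the smooth part of a patch are written as `ψ
u + t ν(u)`. On the coordinates whose foot is the chosen nearest point this map is injective, and
its Jacobian at `t = 0` is the density of the surface measure (`area_formula`). For each `u`, once
`s > 0` is small, exactly one of `t = s` and `t = -s` lies on the given side, because `Ω` is the
closure of its interior. Dominated convergence in `u` gives the limit. No continuity of `G` is
needed, since `γ` is constant on short normals. The other points have their nearest point in `ψ ''
Q` with `Q` of small volume, near the edges. A Lipschitz covering argument bounds the neighbourhoods
of `ψ '' Q` (`exists_volume_infDist_image_le`). Contraction towards nearest points upgrades this to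
a bound for `{dist ∈ A}` with arbitrary measurable `A` (`volume_shell_le`).

A regression function is continuous only on the support of `X`. Its product with `fX`, cut off
outside the support, is still continuous wherever `fX` is
(`ContinuousAt.mul_indicator_of_ae_eq_zero`). -/

/-- The splitting of `ℝⁿ⁺¹` into the last `n` coordinates and the first one. -/
def consEquiv (n : ℕ) : (𝔼 n × ℝ) ≃L[ℝ] 𝔼 (n + 1) :=
  LinearEquiv.toContinuousLinearEquiv
    { toFun := fun p => WithLp.toLp 2 (Fin.cons p.2 p.1 : Fin (n + 1) → ℝ)
      map_add' := by
        intro p q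
        ext i
        refine Fin.cases ?_ (fun j => ?_) i <;> simp
      map_smul' := by
        intro c p
        ext i
        refine Fin.cases ?_ (fun j => ?_) i <;> simp
      invFun := fun z => (WithLp.toLp 2 (fun j : Fin n => z j.succ), z 0)
      left_inv := by
        intro p
        ext <;> simp
      right_inv := by
        intro z
        ext i
        refine Fin.cases ?_ (fun j => ?_) i <;> simp }

theorem consEquiv_apply_zero {n : ℕ} (p : 𝔼 n × ℝ) : consEquiv n p 0 = p.2 := rfl

theorem consEquiv_apply_succ {n : ℕ} (p : 𝔼 n × ℝ) (j : Fin n) :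
    consEquiv n p j.succ = p.1 j := rfl

/-- The product carries the sup norm, so this is no isometry. The volumes agree because both are
product measures in the coordinates. -/
theorem measurePreserving_consEquiv (n : ℕ) :
    MeasurePreserving (consEquiv n) volume volume := by
  have h1 := PiLp.volume_preserving_ofLp (Fin n)
  have h2 := (volume_preserving_piFinSuccAbove (fun _ : Fin (n + 1) => ℝ) 0).symm
  have h3 := PiLp.volume_preserving_toLp (Fin (n + 1))
  have h4 : MeasurePreserving (Prod.swap : 𝔼 n × ℝ → ℝ × 𝔼 n) volume volume :=
    Measure.measurePreserving_swap
  have h5 := (MeasurePreserving.id (volume : Measure ℝ)).prod h1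
  have := h3.comp (h2.comp (h5.comp h4))
  have heq : (consEquiv n : 𝔼 n × ℝ → 𝔼 (n + 1)) = WithLp.toLp 2 ∘
      (MeasurableEquiv.piFinSuccAbove (fun _ : Fin (n + 1) => ℝ) 0).symm ∘
        Prod.map id WithLp.ofLp ∘ Prod.swap := by
    ext p i
    refine Fin.cases ?_ (fun j => ?_) i
    · simp [consEquiv_apply_zero, MeasurableEquiv.piFinSuccAbove]
    · simp [consEquiv_apply_succ, MeasurableEquiv.piFinSuccAbove]
  rw [heq]
  exact this

/-- The generalized cross product of the columns of `A`. -/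
def normalVector {n : ℕ} (A : 𝔼 n →L[ℝ] 𝔼 (n + 1)) : 𝔼 (n + 1) :=
  WithLp.toLp 2 fun i => (-1) ^ (i : ℕ) *
    (Matrix.of fun j k : Fin n => A (EuclideanSpace.single k 1) (i.succAbove j)).det

/-- The map `(u, t) ↦ A u + t w`. -/
def adjoinColumn {n : ℕ} (A : 𝔼 n →L[ℝ] 𝔼 (n + 1)) (w : 𝔼 (n + 1)) :
    𝔼 n × ℝ →L[ℝ] 𝔼 (n + 1) :=
  A.coprod (ContinuousLinearMap.toSpanSingleton ℝ w)

theorem adjoinColumn_apply {n : ℕ} (A : 𝔼 n →L[ℝ] 𝔼 (n + 1)) (w : 𝔼 (n + 1)) (p : 𝔼 n × ℝ) :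
    adjoinColumn A w p = A p.1 + p.2 • w := by
  simp [adjoinColumn]

/-- Laplace expansion along column `0`, where `consEquiv` puts the real coordinate: the minors left
over are the entries of `normalVector A`. Orthogonality, non-vanishing and the Jacobian of normal
coordinates are all read off from this. -/
theorem det_adjoinColumn {n : ℕ} (A : 𝔼 n →L[ℝ] 𝔼 (n + 1)) (w : 𝔼 (n + 1)) :
    ((adjoinColumn A w).comp ((consEquiv n).symm : 𝔼 (n + 1) →L[ℝ] 𝔼 n × ℝ)).det =
      ⟪normalVector A, w⟫ := by
  rw [ContinuousLinearMap.det, ← LinearMap.det_toMatrix (EuclideanSpace.basisFun (Fin (n + 1)) ℝ).toBasis,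
    Matrix.det_succ_column_zero, PiLp.inner_apply]
  refine Finset.sum_congr rfl fun i _ => ?_
  have h0 : (consEquiv n).symm (EuclideanSpace.single 0 1) = (0, 1) := by
    rw [ContinuousLinearEquiv.symm_apply_eq]
    ext i
    refine Fin.cases ?_ (fun j => ?_) i
    · simp [consEquiv_apply_zero]
    · simp [consEquiv_apply_succ]
  have hs (k : Fin n) : (consEquiv n).symm (EuclideanSpace.single k.succ 1) =
      (EuclideanSpace.single k 1, 0) := by
    rw [ContinuousLinearEquiv.symm_apply_eq]
    ext i
    refine Fin.cases ?_ (fun j => ?_) i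
    · simp [consEquiv_apply_zero]
    · simp [consEquiv_apply_succ]
  have hm : (((LinearMap.toMatrix (EuclideanSpace.basisFun (Fin (n + 1)) ℝ).toBasis
      (EuclideanSpace.basisFun (Fin (n + 1)) ℝ).toBasis)
      ((adjoinColumn A w).comp ((consEquiv n).symm : 𝔼 (n + 1) →L[ℝ] 𝔼 n × ℝ)).toLinearMap).submatrix
        i.succAbove Fin.succ) =
      (Matrix.of fun j k : Fin n => A (EuclideanSpace.single k 1) (i.succAbove j)) := by
    ext j k
    simp [LinearMap.toMatrix_apply, hs, adjoinColumn_apply]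
  rw [hm]
  simp [LinearMap.toMatrix_apply, h0, adjoinColumn_apply, normalVector]
  ring

theorem contDiff_normalVector {n : ℕ} {k : WithTop ℕ∞} :
    ContDiff ℝ k (normalVector : (𝔼 n →L[ℝ] 𝔼 (n + 1)) → 𝔼 (n + 1)) := by
  rw [contDiff_euclidean]
  intro i
  simp only [normalVector, Matrix.det_apply, Matrix.of_apply]
  refine contDiff_const.mul (ContDiff.sum fun σ _ => ContDiff.const_smul _ ?_)
  refine contDiff_prod fun j _ => ?_
  have : (fun A : 𝔼 n →L[ℝ] 𝔼 (n + 1) =>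
      A (EuclideanSpace.single j 1) (i.succAbove (σ j))) =
      ((EuclideanSpace.proj (i.succAbove (σ j)) : 𝔼 (n + 1) →L[ℝ] ℝ).comp
        (ContinuousLinearMap.apply ℝ (𝔼 (n + 1)) (EuclideanSpace.single j (1 : ℝ)))) := by
    ext A; simp
  rw [this]
  exact ContinuousLinearMap.contDiff _

theorem inner_normalVector_apply {n : ℕ} (A : 𝔼 n →L[ℝ] 𝔼 (n + 1)) (v : 𝔼 n) :
    ⟪normalVector A, A v⟫ = 0 := by
  rw [← det_adjoinColumn, ContinuousLinearMap.det, LinearMap.det_eq_zero_iff_ker_ne_bot,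
    Submodule.ne_bot_iff]
  -- The adjoined column `A v` is a combination of the columns of `A`, and `(v, -1)` is the
  -- relation.
  refine ⟨consEquiv n (v, -1), ?_, ?_⟩
  · simp [adjoinColumn_apply]
  · simp

theorem adjoinColumn_injective {n : ℕ} {A : 𝔼 n →L[ℝ] 𝔼 (n + 1)} (hA : Function.Injective A)
    {w : 𝔼 (n + 1)} (hw : w ∉ LinearMap.range A.toLinearMap) :
    Function.Injective (adjoinColumn A w) := by
  rw [injective_iff_map_eq_zero]
  rintro ⟨u, t⟩ h
  rw [adjoinColumn_apply] at h
  have ht : t = 0 := by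
    by_contra ht
    refine hw ⟨-t⁻¹ • u, ?_⟩
    have h' : A u = -(t • w) := eq_neg_of_add_eq_zero_left h
    simp [h', smul_smul, ht]
  subst ht
  simp only [zero_smul, add_zero] at h
  rw [← map_zero A] at h
  rw [hA h]
  rfl

/-- A hyperplane misses some `w`. Adjoining this `w` gives an injective square matrix, whose nonzero
determinant is an inner product with the normal vector. -/
theorem normalVector_ne_zero {n : ℕ} {A : 𝔼 n →L[ℝ] 𝔼 (n + 1)} (hA : Function.Injective A) :
    normalVector A ≠ 0 := by
  intro h0
  have hlt : LinearMap.range A.toLinearMap ≠ ⊤ := by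
    intro h
    have h1 := LinearMap.finrank_range_of_inj (f := A.toLinearMap) hA
    rw [h, finrank_top] at h1
    simp at h1
  obtain ⟨w, hw⟩ : ∃ w, w ∉ LinearMap.range A.toLinearMap := by
    by_contra! hc
    exact hlt (eq_top_iff.2 fun x _ => hc x)
  have h1 := det_adjoinColumn A w
  rw [h0, inner_zero_left, ContinuousLinearMap.det, LinearMap.det_eq_zero_iff_ker_ne_bot] at h1
  refine h1 (LinearMap.ker_eq_bot.2 ?_)
  exact (adjoinColumn_injective hA hw).comp (consEquiv n).symm.injective

/-- The unit normal vector of the range of `A`. -/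
def unitNormal {n : ℕ} (A : 𝔼 n →L[ℝ] 𝔼 (n + 1)) : 𝔼 (n + 1) :=
  ‖normalVector A‖⁻¹ • normalVector A

theorem norm_unitNormal {n : ℕ} {A : 𝔼 n →L[ℝ] 𝔼 (n + 1)} (hA : Function.Injective A) :
    ‖unitNormal A‖ = 1 := by
  have := norm_ne_zero_iff.2 (normalVector_ne_zero hA)
  simp [unitNormal, norm_smul, this]

theorem inner_unitNormal_apply {n : ℕ} (A : 𝔼 n →L[ℝ] 𝔼 (n + 1)) (v : 𝔼 n) :
    ⟪unitNormal A, A v⟫ = 0 := by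
  simp [unitNormal, inner_smul_left, inner_normalVector_apply]

theorem det_adjoinColumn_unitNormal {n : ℕ} (A : 𝔼 n →L[ℝ] 𝔼 (n + 1)) :
    ((adjoinColumn A (unitNormal A)).comp
      ((consEquiv n).symm : 𝔼 (n + 1) →L[ℝ] 𝔼 n × ℝ)).det = ‖normalVector A‖ := by
  rw [det_adjoinColumn, unitNormal, inner_smul_right, real_inner_self_eq_norm_sq]
  by_cases h : ‖normalVector A‖ = 0
  · simp [h]
  · field_simp

/-- The orthogonal complement of the range of `A` is spanned by the unit normal. -/
theorem exists_eq_smul_unitNormal {n : ℕ} {A : 𝔼 n →L[ℝ] 𝔼 (n + 1)} (hA : Function.Injective A)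
    {w : 𝔼 (n + 1)} (hw : ∀ v, ⟪w, A v⟫ = 0) : ∃ t : ℝ, w = t • unitNormal A := by
  have hν : unitNormal A ∉ LinearMap.range A.toLinearMap := by
    rintro ⟨v, hv⟩
    have h1 := inner_unitNormal_apply A v
    have h2 : A v = unitNormal A := hv
    rw [h2, real_inner_self_eq_norm_sq, norm_unitNormal hA] at h1
    norm_num at h1
  have hsurj : Function.Surjective
      ((adjoinColumn A (unitNormal A)).comp
        ((consEquiv n).symm : 𝔼 (n + 1) →L[ℝ] 𝔼 n × ℝ)).toLinearMap :=
    LinearMap.surjective_of_injective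
      ((adjoinColumn_injective hA hν).comp (consEquiv n).symm.injective)
  obtain ⟨z, hz⟩ := hsurj w
  obtain ⟨⟨v, t⟩, rfl⟩ := (consEquiv n).surjective z
  have hz' : A v + t • unitNormal A = w := by simpa [adjoinColumn_apply] using hz
  have hAv : A v = 0 := by
    have h1 := hw v
    rw [← hz', inner_add_left, inner_smul_left, inner_unitNormal_apply, mul_zero, add_zero] at h1
    exact inner_self_eq_zero.1 h1
  exact ⟨t, by rw [← hz', hAv, zero_add]⟩

theorem norm_consEquiv_sq {n : ℕ} (p : 𝔼 n × ℝ) : ‖consEquiv n p‖ ^ 2 = ‖p.1‖ ^ 2 + p.2 ^ 2 := by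
  rw [EuclideanSpace.norm_sq_eq, EuclideanSpace.norm_sq_eq, Fin.sum_univ_succ]
  simp [consEquiv_apply_zero, consEquiv_apply_succ, add_comm]

/-- The unit ball is its own image, so its volume is scaled by `1`. -/
theorem LinearIsometry.abs_det_eq_one {V : Type*} [NormedAddCommGroup V] [InnerProductSpace ℝ V]
    [FiniteDimensional ℝ V] (f : V →ₗᵢ[ℝ] V) : |LinearMap.det f.toLinearMap| = 1 := by
  borelize V
  let e := f.toLinearIsometryEquiv rfl
  have h1 := Measure.addHaar_image_linearMap (volume : Measure V) f.toLinearMap (Metric.ball 0 1)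
  have h2 : f.toLinearMap '' (Metric.ball 0 1) = Metric.ball 0 1 := by
    have := e.image_ball 0 1
    simpa [e] using this
  rw [h2] at h1
  have h3 : volume (Metric.ball (0 : V) 1) ≠ 0 := (Metric.measure_ball_pos _ _ one_pos).ne'
  have h4 : volume (Metric.ball (0 : V) 1) ≠ ∞ := measure_ball_lt_top.ne
  have h5 : ENNReal.ofReal |LinearMap.det f.toLinearMap| = 1 := by
    rw [← ENNReal.mul_left_inj h3 h4, ← h1, one_mul]
  simpa using h5

/-- A linear hyperplane parametrization scales surface measure by the norm of the normal vector. -/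
theorem euclideanHausdorffMeasure_image_linear {n : ℕ} {A : 𝔼 n →L[ℝ] 𝔼 (n + 1)}
    (hA : Function.Injective A) (B : Set (𝔼 n)) :
    μHE[n] (A '' B) = ENNReal.ofReal ‖normalVector A‖ * volume B := by
  set R := LinearMap.range A.toLinearMap with hR
  have hfin : Module.finrank ℝ R = n := by
    rw [hR, LinearMap.finrank_range_of_inj (f := A.toLinearMap) hA]; simp
  -- Factor `A = ι ∘ A'` through an orthonormal frame of its range. The isometry `ι` preserves
  -- surface measure and `A'` scales volume by `|det A'|`.
  let b : OrthonormalBasis (Fin n) ℝ R := (stdOrthonormalBasis ℝ R).reindex (finCongr hfin)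
  let ι : 𝔼 n →ₗᵢ[ℝ] 𝔼 (n + 1) := R.subtypeₗᵢ.comp b.repr.symm.toLinearIsometry
  let A' : 𝔼 n →ₗ[ℝ] 𝔼 n := b.repr.toLinearEquiv.toLinearMap ∘ₗ A.toLinearMap.rangeRestrict
  have hιA (v) : ι (A' v) = A v := by
    simp [ι, A']
  have hιν (v) : ⟪unitNormal A, ι v⟫ = 0 := by
    obtain ⟨u, hu⟩ : ι v ∈ R := by simp [ι]
    rw [← hu]
    exact inner_unitNormal_apply A u
  -- Completing the frame `ι` by the unit normal gives an isometry of the whole space. Then `A` with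
  -- its unit normal adjoined is `Q ∘ (A' × id)`, and taking determinants identifies `|det A'|`.
  let Q : 𝔼 (n + 1) →ₗᵢ[ℝ] 𝔼 (n + 1) :=
    { toLinearMap := ((adjoinColumn ι.toContinuousLinearMap (unitNormal A)).comp
        ((consEquiv n).symm : 𝔼 (n + 1) →L[ℝ] 𝔼 n × ℝ)).toLinearMap
      norm_map' := by
        intro z
        obtain ⟨p, rfl⟩ := (consEquiv n).surjective z
        rw [← sq_eq_sq₀ (norm_nonneg _) (norm_nonneg _), norm_consEquiv_sq]
        simp only [ContinuousLinearMap.coe_coe, ContinuousLinearMap.comp_apply,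
          ContinuousLinearEquiv.coe_coe, ContinuousLinearEquiv.symm_apply_apply,
          adjoinColumn_apply, LinearIsometry.coe_toContinuousLinearMap]
        rw [norm_add_sq_real, inner_smul_right, real_inner_comm, hιν, norm_smul,
          norm_unitNormal hA, LinearIsometry.norm_map]
        simp }
  have hdet : ‖normalVector A‖ = |LinearMap.det A'| := by
    have h1 : ((adjoinColumn A (unitNormal A)).comp
        ((consEquiv n).symm : 𝔼 (n + 1) →L[ℝ] 𝔼 n × ℝ)).toLinearMap = Q.toLinearMap ∘ₗ
        ((consEquiv n).toLinearEquiv.toLinearMap ∘ₗ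
          (A'.prodMap LinearMap.id) ∘ₗ (consEquiv n).symm.toLinearEquiv.toLinearMap) := by
      ext1 z
      simp [Q, adjoinColumn_apply, hιA]
    have h2 := det_adjoinColumn_unitNormal A
    rw [ContinuousLinearMap.det, h1, LinearMap.det_comp] at h2
    have h3 := LinearMap.det_conj (A'.prodMap (LinearMap.id : ℝ →ₗ[ℝ] ℝ))
      (consEquiv n).toLinearEquiv
    have h4 := LinearIsometry.abs_det_eq_one Q
    rw [← abs_of_nonneg (norm_nonneg (normalVector A)), ← h2, abs_mul, h4, one_mul]
    congr 1
    refine h3.trans ?_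
    rw [LinearMap.det_prodMap]; simp
  have himg : A '' B = ι '' (A' '' B) := by
    rw [image_image]; simp only [hιA]
  rw [himg, ι.isometry.euclideanHausdorffMeasure_image,
    EuclideanSpace.euclideanHausdorffMeasure_eq_volume, Measure.addHaar_image_linearMap, hdet]

/-! ### The area formula for hypersurface patches -/

theorem euclideanHausdorffMeasure_image_le_of_lipschitzOnWith {X Z : Type*} [MetricSpace X]
    [MeasurableSpace X] [BorelSpace X] [MetricSpace Z] [MeasurableSpace Z] [BorelSpace Z]
    {f : Z → X} {B : Set Z} {c : ℝ≥0} (h : LipschitzOnWith c f B) (n : ℕ) :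
    μHE[n] (f '' B) ≤ (c : ℝ≥0∞) ^ n * μHE[n] B := by
  have h1 := h.hausdorffMeasure_image_le (d := n) (Nat.cast_nonneg n)
  rw [ENNReal.rpow_natCast] at h1
  simp only [Measure.euclideanHausdorffMeasure_def, Measure.smul_apply, ENNReal.smul_def,
    smul_eq_mul]
  rw [mul_left_comm]
  gcongr

/-- If distances between the values of `f` are at most `c` times those between the values
of `g`, then the surface measure of the images compares accordingly. -/
theorem euclideanHausdorffMeasure_image_le_of_dist_le {ι X Z : Type*} [MetricSpace X]
    [MeasurableSpace X] [BorelSpace X] [MetricSpace Z] [MeasurableSpace Z] [BorelSpace Z]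
    {f : ι → X} {g : ι → Z} {B : Set ι} {c : ℝ≥0} (n : ℕ)
    (h : ∀ x ∈ B, ∀ y ∈ B, dist (f x) (f y) ≤ c * dist (g x) (g y)) :
    μHE[n] (f '' B) ≤ (c : ℝ≥0∞) ^ n * μHE[n] (g '' B) := by
  rcases B.eq_empty_or_nonempty with rfl | ⟨b, hb⟩
  · simp
  have : Nonempty ι := ⟨b⟩
  have hmem (x) (hx : x ∈ B) : Function.invFunOn g B (g x) ∈ B :=
    Function.invFunOn_mem ⟨x, hx, rfl⟩
  have heq (x) (hx : x ∈ B) : g (Function.invFunOn g B (g x)) = g x :=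
    Function.invFunOn_eq ⟨x, hx, rfl⟩
  have hlip : LipschitzOnWith c (f ∘ Function.invFunOn g B) (g '' B) := by
    refine LipschitzOnWith.of_dist_le_mul ?_
    rintro _ ⟨x, hx, rfl⟩ _ ⟨y, hy, rfl⟩
    have := h _ (hmem x hx) _ (hmem y hy)
    rwa [heq x hx, heq y hy] at this
  -- The chosen preimage may differ from `x`, but points with equal `g`-value have equal `f`-value
  -- by the hypothesis.
  have himg : (f ∘ Function.invFunOn g B) '' (g '' B) = f '' B := by
    rw [image_image]
    refine image_congr fun x hx => ?_
    have := h _ (hmem x hx) _ hx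
    rw [heq x hx, dist_self, mul_zero] at this
    exact dist_le_zero.1 this
  rw [← himg]
  exact euclideanHausdorffMeasure_image_le_of_lipschitzOnWith hlip n

/-- The area factor of `ψ` at `u`. -/
def areaFactor {n : ℕ} (ψ : 𝔼 n → 𝔼 (n + 1)) (u : 𝔼 n) : ℝ := ‖normalVector (fderiv ℝ ψ u)‖

theorem continuous_areaFactor {n : ℕ} {ψ : 𝔼 n → 𝔼 (n + 1)} (hψ : ContDiff ℝ 1 ψ) :
    Continuous (areaFactor ψ) :=
  ((contDiff_normalVector (k := 0)).continuous.comp (hψ.continuous_fderiv one_ne_zero)).norm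

theorem areaFactor_pos {n : ℕ} {ψ : 𝔼 n → 𝔼 (n + 1)} {u : 𝔼 n}
    (h : Function.Injective (fderiv ℝ ψ u)) : 0 < areaFactor ψ u :=
  norm_pos_iff.2 (normalVector_ne_zero h)

/-- Near `u`, distances between values of `ψ` and of its derivative `A` agree up to a factor `a`. So
the surface measures of `ψ '' B` and `A '' B` agree up to `a ^ n`, and the latter is known exactly.
Replacing the area factor at `u` by the one at `v` costs another `a`. -/
theorem area_formula_local {n : ℕ} {ψ : 𝔼 n → 𝔼 (n + 1)} (hψ : ContDiff ℝ 1 ψ) {u : 𝔼 n}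
    (hu : Function.Injective (fderiv ℝ ψ u)) {c : ℝ≥0} (hc : 1 < c) :
    ∃ V ∈ 𝓝 u, ∀ B ⊆ V, MeasurableSet B →
      μHE[n] (ψ '' B) ≤ c * ∫⁻ v in B, ENNReal.ofReal (areaFactor ψ v) ∧
      ∫⁻ v in B, ENNReal.ofReal (areaFactor ψ v) ≤ c * μHE[n] (ψ '' B) := by
  set A := fderiv ℝ ψ u with hA
  obtain ⟨a, ha1, hac⟩ : ∃ a : ℝ≥0, 1 < a ∧ a ^ (n + 1) ≤ c := by
    have h1 : Tendsto (fun a : ℝ≥0 => a ^ (n + 1)) (𝓝[>] 1) (𝓝 (1 ^ (n + 1))) :=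
      ((continuous_pow (n + 1)).tendsto 1).mono_left nhdsWithin_le_nhds
    rw [one_pow] at h1
    obtain ⟨a, ha, ha'⟩ := ((h1.eventually (eventually_lt_nhds hc)).and self_mem_nhdsWithin).exists
    exact ⟨a, ha', ha.le⟩
  have ha0 : (0 : ℝ) < a := by exact_mod_cast (zero_lt_one.trans ha1)
  have ha1' : (1 : ℝ) < a := by exact_mod_cast ha1
  obtain ⟨K, hK0, hK⟩ := A.toLinearMap.exists_antilipschitzWith (LinearMap.ker_eq_bot.2 hu)
  have hKA (v w : 𝔼 n) : ‖v - w‖ ≤ K * ‖A v - A w‖ := by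
    simpa [dist_eq_norm] using hK.le_mul_dist v w
  -- With this choice `1 - δ = a⁻¹` exactly, and `1 + δ ≤ a` because `a + a⁻¹ ≥ 2`. One error bound
  -- thus serves both directions.
  set δ : ℝ := 1 - (a : ℝ)⁻¹ with hδ
  have hainv : (a : ℝ)⁻¹ < 1 := inv_lt_one_of_one_lt₀ ha1'
  have hδ0 : 0 < δ := by linarith
  have hδa : 1 + δ ≤ a := by
    have : (a : ℝ)⁻¹ + a ≥ 2 := by
      have h2 : (a : ℝ)⁻¹ * a = 1 := inv_mul_cancel₀ ha0.ne'
      nlinarith [inv_pos.2 ha0, sq_nonneg ((a : ℝ)⁻¹ - a)]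
    linarith
  have hstrict : HasStrictFDerivAt ψ A u := hψ.contDiffAt.hasStrictFDerivAt one_ne_zero
  have hη : 0 < δ / K := div_pos hδ0 (by exact_mod_cast hK0)
  -- The antilipschitz constant `K` of `A` turns an error `δ / K * ‖x - y‖` into the relative error
  -- `δ * ‖A x - A y‖`.
  obtain ⟨s, hs, hsl⟩ := hstrict.approximates_deriv_on_nhds (c := ⟨δ / K, hη.le⟩) (Or.inr (by
    exact_mod_cast hη))
  have happ (x) (hx : x ∈ s) (y) (hy : y ∈ s) :
      ‖ψ x - ψ y - A (x - y)‖ ≤ δ * ‖A x - A y‖ := by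
    refine (hsl x hx y hy).trans ?_
    have h1 := hKA x y
    have h2 : δ / K * ‖x - y‖ ≤ δ / K * (K * ‖A x - A y‖) := by gcongr
    have hK0' : (K : ℝ) ≠ 0 := by exact_mod_cast hK0.ne'
    calc δ / K * ‖x - y‖ ≤ δ / K * (K * ‖A x - A y‖) := h2
      _ = δ * ‖A x - A y‖ := by field_simp
  have hup (x) (hx : x ∈ s) (y) (hy : y ∈ s) : dist (ψ x) (ψ y) ≤ a * dist (A x) (A y) := by
    rw [dist_eq_norm, dist_eq_norm]
    have h1 := happ x hx y hy
    rw [map_sub] at h1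
    have h2 := norm_le_norm_add_norm_sub (A x - A y) (ψ x - ψ y)
    rw [norm_sub_rev (A x - A y) (ψ x - ψ y)] at h2
    have h3 : ‖ψ x - ψ y‖ ≤ (1 + δ) * ‖A x - A y‖ := by linarith
    exact h3.trans (by gcongr)
  have hlow (x) (hx : x ∈ s) (y) (hy : y ∈ s) : dist (A x) (A y) ≤ a * dist (ψ x) (ψ y) := by
    rw [dist_eq_norm, dist_eq_norm]
    have h1 := happ x hx y hy
    rw [map_sub] at h1
    have h2 := norm_le_norm_add_norm_sub (ψ x - ψ y) (A x - A y)
    have h3 : (a : ℝ)⁻¹ * ‖A x - A y‖ ≤ ‖ψ x - ψ y‖ := by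
      have : (a : ℝ)⁻¹ = 1 - δ := by rw [hδ]; ring
      rw [this]; linarith
    rwa [inv_mul_le_iff₀ ha0] at h3
  have hJ : Continuous (areaFactor ψ) := continuous_areaFactor hψ
  have hJ0 : 0 < areaFactor ψ u := areaFactor_pos hu
  have hJ1 : ∀ᶠ v in 𝓝 u, areaFactor ψ v < a * areaFactor ψ u :=
    hJ.continuousAt.eventually (eventually_lt_nhds (by nlinarith))
  have hJ2 : ∀ᶠ v in 𝓝 u, areaFactor ψ u < a * areaFactor ψ v :=
    (continuous_const.mul hJ).continuousAt.eventually
      (eventually_gt_nhds (show areaFactor ψ u < a * areaFactor ψ u by nlinarith))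
  refine ⟨s ∩ {v | areaFactor ψ v < a * areaFactor ψ u ∧ areaFactor ψ u < a * areaFactor ψ v},
    inter_mem hs (hJ1.and hJ2), fun B hB hBm => ?_⟩
  have haR : (a : ℝ≥0∞) = ENNReal.ofReal a := by simp
  have hI1 : ∫⁻ v in B, ENNReal.ofReal (areaFactor ψ v) ≤
      a * (ENNReal.ofReal (areaFactor ψ u) * volume B) := by
    rw [← mul_assoc, ← setLIntegral_const]
    refine setLIntegral_mono' hBm fun v hv => ?_
    rw [haR, ← ENNReal.ofReal_mul ha0.le]
    exact ENNReal.ofReal_le_ofReal (hB hv).2.1.le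
  have hI2 : ENNReal.ofReal (areaFactor ψ u) * volume B ≤
      a * ∫⁻ v in B, ENNReal.ofReal (areaFactor ψ v) := by
    rw [← setLIntegral_const, ← lintegral_const_mul' _ _ (by simp)]
    refine setLIntegral_mono' hBm fun v hv => ?_
    rw [haR, ← ENNReal.ofReal_mul ha0.le]
    exact ENNReal.ofReal_le_ofReal (hB hv).2.2.le
  have hlin := euclideanHausdorffMeasure_image_linear hu B
  have hac' : (a : ℝ≥0∞) ^ (n + 1) ≤ c := by exact_mod_cast hac
  constructor
  · have h1 := euclideanHausdorffMeasure_image_le_of_dist_le (f := ψ) (g := A) (B := B) (c := a) n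
      fun x hx y hy => hup x (hB hx).1 y (hB hy).1
    calc μHE[n] (ψ '' B) ≤ (a : ℝ≥0∞) ^ n * μHE[n] (A '' B) := h1
      _ ≤ (a : ℝ≥0∞) ^ n * (a * ∫⁻ v in B, ENNReal.ofReal (areaFactor ψ v)) := by
          rw [hlin]; exact mul_le_mul_right hI2 _
      _ = (a : ℝ≥0∞) ^ (n + 1) * ∫⁻ v in B, ENNReal.ofReal (areaFactor ψ v) := by
          rw [pow_succ, mul_assoc]
      _ ≤ _ := by gcongr
  · have h1 := euclideanHausdorffMeasure_image_le_of_dist_le (f := A) (g := ψ) (B := B) (c := a) n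
      fun x hx y hy => hlow x (hB hx).1 y (hB hy).1
    calc ∫⁻ v in B, ENNReal.ofReal (areaFactor ψ v)
        ≤ a * (ENNReal.ofReal (areaFactor ψ u) * volume B) := hI1
      _ = a * μHE[n] (A '' B) := by rw [hlin]; rfl
      _ ≤ a * ((a : ℝ≥0∞) ^ n * μHE[n] (ψ '' B)) := by gcongr
      _ = (a : ℝ≥0∞) ^ (n + 1) * μHE[n] (ψ '' B) := by rw [pow_succ', mul_assoc]
      _ ≤ _ := by gcongr

/-- Countably many of the local neighbourhoods cover `B`. After making them disjoint, both sides are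
countably additive: injectivity keeps the images of the pieces disjoint, and injective continuous
images of Borel sets are measurable. -/
theorem area_formula_aux {n : ℕ} {ψ : 𝔼 n → 𝔼 (n + 1)} (hψ : ContDiff ℝ 1 ψ) {U : Set (𝔼 n)}
    (hinj : InjOn ψ U) (himm : ∀ u ∈ U, Function.Injective (fderiv ℝ ψ u))
    {B : Set (𝔼 n)} (hBU : B ⊆ U) (hB : MeasurableSet B) {c : ℝ≥0} (hc : 1 < c) :
    μHE[n] (ψ '' B) ≤ c * ∫⁻ v in B, ENNReal.ofReal (areaFactor ψ v) ∧
      ∫⁻ v in B, ENNReal.ofReal (areaFactor ψ v) ≤ c * μHE[n] (ψ '' B) := by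
  choose! V hV hVB using fun u (hu : u ∈ U) => area_formula_local hψ (himm u hu) hc
  obtain ⟨t, htU, htc, hcov⟩ := TopologicalSpace.countable_cover_nhdsWithin
    (f := fun u => interior (V u)) (s := B) fun x hx =>
      mem_nhdsWithin_of_mem_nhds (interior_mem_nhds.2 (hV x (hBU hx)))
  rcases t.eq_empty_or_nonempty with rfl | htne
  · have : B = ∅ := by simpa [subset_empty_iff] using hcov
    simp [this]
  obtain ⟨e, rfl⟩ := htc.exists_eq_range htne
  set D : ℕ → Set (𝔼 n) := disjointed fun k => interior (V (e k)) with hD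
  have hDm (k) : MeasurableSet (D k) :=
    MeasurableSet.disjointed (fun k => isOpen_interior.measurableSet) k
  have hDd : Pairwise (Function.onFun Disjoint D) := disjoint_disjointed _
  have hBD : B = ⋃ k, B ∩ D k := by
    rw [← inter_iUnion, hD, iUnion_disjointed, eq_comm, inter_eq_left]
    simpa [biUnion_range] using hcov
  have hpd : Pairwise (Function.onFun Disjoint fun k => B ∩ D k) := fun i j hij =>
    (hDd hij).mono inter_subset_right inter_subset_right
  have hsub (k) : B ∩ D k ⊆ V (e k) := fun x hx =>
    interior_subset (disjointed_subset (fun k => interior (V (e k))) k hx.2)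
  have hk (k) := hVB (e k) (hBU (htU ⟨k, rfl⟩)) (B ∩ D k) (hsub k) (hB.inter (hDm k))
  have h1 : ∫⁻ v in B, ENNReal.ofReal (areaFactor ψ v) =
      ∑' k, ∫⁻ v in B ∩ D k, ENNReal.ofReal (areaFactor ψ v) := by
    conv_lhs => rw [hBD]
    exact lintegral_iUnion (fun k => hB.inter (hDm k)) hpd _
  have h2 : μHE[n] (ψ '' B) = ∑' k, μHE[n] (ψ '' (B ∩ D k)) := by
    conv_lhs => rw [hBD, image_iUnion]
    refine measure_iUnion (fun i j hij => ?_) fun k => ?_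
    · rw [Function.onFun, disjoint_iff_inter_eq_empty, ← (hinj.mono hBU).image_inter
        inter_subset_left inter_subset_left, (hpd hij).inter_eq, image_empty]
    · exact (hB.inter (hDm k)).image_of_continuousOn_injOn hψ.continuous.continuousOn
        (hinj.mono (inter_subset_left.trans hBU))
  rw [h1, h2, ← ENNReal.tsum_mul_left, ← ENNReal.tsum_mul_left]
  exact ⟨ENNReal.tsum_le_tsum fun k => (hk k).1, ENNReal.tsum_le_tsum fun k => (hk k).2⟩

theorem ENNReal.le_of_forall_one_lt_coe_mul {x y : ℝ≥0∞}
    (h : ∀ c : ℝ≥0, 1 < c → x ≤ c * y) : x ≤ y := by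
  have h1 : Tendsto (fun c : ℝ≥0 => (c : ℝ≥0∞) * y) (𝓝[>] 1) (𝓝 (((1 : ℝ≥0) : ℝ≥0∞) * y)) :=
    (ENNReal.Tendsto.mul_const (ENNReal.tendsto_coe.2 tendsto_id)
      (Or.inl (by simp))).mono_left nhdsWithin_le_nhds
  rw [ENNReal.coe_one, one_mul] at h1
  exact ge_of_tendsto h1 (by filter_upwards [self_mem_nhdsWithin] with c hc using h c hc)

/-- The area formula for an injectively immersed hypersurface patch. -/
theorem area_formula {n : ℕ} {ψ : 𝔼 n → 𝔼 (n + 1)} (hψ : ContDiff ℝ 1 ψ) {U : Set (𝔼 n)}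
    (hinj : InjOn ψ U) (himm : ∀ u ∈ U, Function.Injective (fderiv ℝ ψ u))
    {B : Set (𝔼 n)} (hBU : B ⊆ U) (hB : MeasurableSet B) :
    μHE[n] (ψ '' B) = ∫⁻ v in B, ENNReal.ofReal (areaFactor ψ v) :=
  le_antisymm
    (ENNReal.le_of_forall_one_lt_coe_mul fun _ hc => (area_formula_aux hψ hinj himm hBU hB hc).1)
    (ENNReal.le_of_forall_one_lt_coe_mul fun _ hc => (area_formula_aux hψ hinj himm hBU hB hc).2)

theorem euclideanHausdorffMeasure_restrict_image {n : ℕ} {ψ : 𝔼 n → 𝔼 (n + 1)}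
    (hψ : ContDiff ℝ 1 ψ) {U : Set (𝔼 n)} (hU : MeasurableSet U)
    (hinj : InjOn ψ U) (himm : ∀ u ∈ U, Function.Injective (fderiv ℝ ψ u)) :
    (μHE[n] : Measure (𝔼 (n + 1))).restrict (ψ '' U) = (((volume : Measure (𝔼 n)).restrict U).withDensity
      fun v => ENNReal.ofReal (areaFactor ψ v)).map ψ := by
  ext s hs
  have hs' : MeasurableSet (ψ ⁻¹' s) := hψ.continuous.measurable hs
  rw [Measure.restrict_apply hs, Measure.map_apply hψ.continuous.measurable hs,
    withDensity_apply _ hs', Measure.restrict_restrict hs', ← area_formula hψ hinj himm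
    inter_subset_right (hs'.inter hU), image_preimage_inter]

theorem ContDiff.exists_lipschitzOnWith_closedBall {n m : ℕ} {ψ : 𝔼 n → 𝔼 m}
    (hψ : ContDiff ℝ 1 ψ) (R : ℝ) : ∃ L, LipschitzOnWith L ψ (Metric.closedBall 0 R) :=
  hψ.contDiffOn.exists_lipschitzOnWith one_ne_zero (convex_closedBall 0 R) (isCompact_closedBall 0 R)

theorem euclideanHausdorffMeasure_image_null {n m : ℕ} {ψ : 𝔼 n → 𝔼 m} (hψ : ContDiff ℝ 1 ψ)
    {Q : Set (𝔼 n)} (hQ : Bornology.IsBounded Q) (h0 : volume Q = 0) : μHE[n] (ψ '' Q) = 0 := by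
  obtain ⟨R, hR⟩ := hQ.subset_closedBall 0
  obtain ⟨L, hL⟩ := hψ.exists_lipschitzOnWith_closedBall R
  have := euclideanHausdorffMeasure_image_le_of_lipschitzOnWith (hL.mono hR) n
  rwa [EuclideanSpace.euclideanHausdorffMeasure_eq_volume, h0, mul_zero, nonpos_iff_eq_zero] at this

/-! ### Shells around compact sets -/

/-- Contracting two points towards their nearest points in a set by the factor `1 / l`
shrinks their distance by at most this factor. -/
theorem norm_sub_le_mul_norm_contract {V : Type*} [NormedAddCommGroup V] [InnerProductSpace ℝ V]
    {x x' y y' : V} {l : ℝ} (hl : 1 ≤ l) (h : dist x y ≤ dist x y') (h' : dist x' y' ≤ dist x' y) :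
    ‖x - x'‖ ≤ l * ‖(y + l⁻¹ • (x - y)) - (y' + l⁻¹ • (x' - y'))‖ := by
  have hl0 : 0 < l := by linarith
  have e1 : l * ‖(y + l⁻¹ • (x - y)) - (y' + l⁻¹ • (x' - y'))‖ =
      ‖l • (y - y') + ((x - y) - (x' - y'))‖ := by
    rw [← abs_of_pos hl0, ← Real.norm_eq_abs, ← norm_smul, Real.norm_eq_abs, abs_of_pos hl0]
    congr 1
    simp only [smul_sub, smul_add, smul_smul, mul_inv_cancel₀ hl0.ne', one_smul]
    abel
  have e2 : x - x' = (y - y') + ((x - y) - (x' - y')) := by abel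
  rw [e1, e2, ← sq_le_sq₀ (norm_nonneg _) (norm_nonneg _), norm_add_sq_real, norm_add_sq_real,
    norm_smul, inner_smul_left, mul_pow, Real.norm_eq_abs, sq_abs]
  have h1 : ‖x - y‖ ^ 2 ≤ ‖(x - y) + (y - y')‖ ^ 2 := by
    rw [sq_le_sq₀ (norm_nonneg _) (norm_nonneg _)]
    simpa [dist_eq_norm] using h
  have h2 : ‖x' - y'‖ ^ 2 ≤ ‖(x' - y') - (y - y')‖ ^ 2 := by
    rw [sq_le_sq₀ (norm_nonneg _) (norm_nonneg _)]
    simpa [dist_eq_norm] using h'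
  rw [norm_add_sq_real] at h1
  rw [norm_sub_sq_real (x' - y') (y - y')] at h2
  have h3 : ⟪y - y', (x - y) - (x' - y')⟫ = ⟪x - y, y - y'⟫ - ⟪x' - y', y - y'⟫ := by
    rw [inner_sub_right, real_inner_comm, real_inner_comm (x' - y')]
  -- Each nearest-point inequality contributes half of `-‖y - y'‖ ^ 2`. With `a = y - y'` and `b`
  -- the other vector, `‖l • a + b‖ ^ 2 - ‖a + b‖ ^ 2 = (l ^ 2 - 1) ‖a‖ ^ 2 + 2 (l - 1) ⟪a, b⟫`,
  -- which is then at least `(l - 1) ^ 2 ‖a‖ ^ 2`.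
  have h4 : -‖y - y'‖ ^ 2 ≤ ⟪y - y', (x - y) - (x' - y')⟫ := by linarith
  simp only [conj_trivial]
  nlinarith [sq_nonneg (l - 1), sq_nonneg (‖y - y'‖), mul_nonneg (sq_nonneg (l - 1))
    (sq_nonneg (‖y - y'‖)), mul_le_mul_of_nonneg_left h4 (sub_nonneg.2 hl)]

/-- The map moving `x` to `y + l⁻¹ (x - y)`, with `y` nearest to `x` in `Q`, has an `l`-Lipschitz
inverse, whence the factor `l ^ m`. It divides the distance to `Q` by exactly `l`: by the triangle
inequality no other point of `Q` comes closer than `y`. -/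
theorem volume_shell_le_mul_shell {m : ℕ} {Q : Set (𝔼 m)} (hQ : IsCompact Q) (hne : Q.Nonempty)
    {l : ℝ≥0} (hl : 1 ≤ l) (A : Set ℝ) :
    volume {x | Metric.infDist x Q ∈ A} ≤
      (l : ℝ≥0∞) ^ m * volume {x | l * Metric.infDist x Q ∈ A} := by
  have hl' : (1 : ℝ) ≤ l := by exact_mod_cast hl
  have hl0 : (0 : ℝ) < l := by linarith
  choose y hyQ hy using fun x => hQ.exists_infDist_eq_dist hne x
  have h := euclideanHausdorffMeasure_image_le_of_dist_le (f := id)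
    (g := fun x => y x + (l : ℝ)⁻¹ • (x - y x)) (B := {x | Metric.infDist x Q ∈ A}) (c := l) m
    (fun x _ x' _ => by
      rw [id, id, dist_eq_norm, dist_eq_norm]
      exact norm_sub_le_mul_norm_contract hl'
        ((hy x).symm.le.trans (Metric.infDist_le_dist_of_mem (hyQ x')))
        ((hy x').symm.le.trans (Metric.infDist_le_dist_of_mem (hyQ x))))
  rw [image_id, EuclideanSpace.euclideanHausdorffMeasure_eq_volume] at h
  refine h.trans ?_
  gcongr
  rintro _ ⟨x, hx, rfl⟩
  simp only [mem_ofPred_eq] at hx ⊢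
  convert hx using 1
  set T := y x + (l : ℝ)⁻¹ • (x - y x) with hT
  have h1 : dist T (y x) = (l : ℝ)⁻¹ * Metric.infDist x Q := by
    rw [hy x, dist_eq_norm, dist_eq_norm, hT, add_sub_cancel_left, norm_smul, norm_inv,
      Real.norm_of_nonneg hl0.le]
  have h2 : dist x T = (1 - (l : ℝ)⁻¹) * Metric.infDist x Q := by
    have : x - T = (1 - (l : ℝ)⁻¹) • (x - y x) := by
      rw [hT, sub_smul, one_smul]; abel
    rw [hy x, dist_eq_norm, dist_eq_norm x (y x), this, norm_smul, Real.norm_of_nonneg]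
    rw [sub_nonneg]
    exact inv_le_one_of_one_le₀ hl'
  have h3 : Metric.infDist T Q ≤ (l : ℝ)⁻¹ * Metric.infDist x Q :=
    (Metric.infDist_le_dist_of_mem (hyQ x)).trans_eq h1
  have h4 : Metric.infDist x Q ≤ Metric.infDist T Q + dist x T :=
    Metric.infDist_le_infDist_add_dist
  have h5 : Metric.infDist T Q = (l : ℝ)⁻¹ * Metric.infDist x Q := by linarith
  rw [h5, mul_inv_cancel_left₀ hl0.ne']

/-- If the volume of the `a`-neighbourhood of a compact set is at most `η a` for small `a`, then
the distance to this set has a density of size `O(η)` near `0`. -/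
theorem volume_shell_le {m : ℕ} {Q : Set (𝔼 m)} (hQ : IsCompact Q) {δ η : ℝ}
    (hV : ∀ a ∈ Ioo 0 δ, volume {x | Metric.infDist x Q ≤ a} ≤ ENNReal.ofReal (η * a))
    {A : Set ℝ} (hA : MeasurableSet A) (hAδ : A ⊆ Ioo 0 δ) :
    volume {x | Metric.infDist x Q ∈ A} ≤ ENNReal.ofReal (2 ^ m * (2 * η)) * volume A := by
  rcases Q.eq_empty_or_nonempty with rfl | hne
  · have : {x : 𝔼 m | Metric.infDist x ∅ ∈ A} = ∅ := by
      ext x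
      simp only [Metric.infDist_empty, mem_ofPred_eq, mem_empty_iff_false, iff_false]
      exact fun h => lt_irrefl _ (hAδ h).1
    rw [this]; simp
  set d : 𝔼 m → ℝ := fun x => Metric.infDist x Q with hd
  have hdm : Measurable d := (Metric.continuous_infDist_pt Q).measurable
  have hd0 (x) : 0 ≤ d x := Metric.infDist_nonneg
  have step1 : ∀ l ∈ Icc (1 : ℝ) 2, volume {x | d x ∈ A} ≤
      2 ^ m * volume {x | l * d x ∈ A} := by
    intro l hl
    lift l to ℝ≥0 using by linarith [hl.1]
    have hl1 : 1 ≤ l := by exact_mod_cast hl.1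
    have hl2 : (l : ℝ≥0∞) ≤ 2 := by exact_mod_cast hl.2
    refine (volume_shell_le_mul_shell hQ hne hl1 A).trans ?_
    gcongr
  have hmeas1 : MeasurableSet {p : ℝ × 𝔼 m | p.1 * d p.2 ∈ A} :=
    (measurable_fst.mul (hdm.comp measurable_snd)) hA
  -- Averaging over dilations `l` in an interval of length one smears out the arbitrary set `A`, so
  -- that only volumes of full neighbourhoods enter.
  have step2 : volume {x | d x ∈ A} ≤
      2 ^ m * ∫⁻ l in Icc (1 : ℝ) 2, volume {x | l * d x ∈ A} := by
    calc volume {x | d x ∈ A} = ∫⁻ l in Icc (1 : ℝ) 2, volume {x | d x ∈ A} := by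
          rw [setLIntegral_const, Real.volume_Icc]; norm_num
      _ ≤ ∫⁻ l in Icc (1 : ℝ) 2, 2 ^ m * volume {x | l * d x ∈ A} :=
          setLIntegral_mono' measurableSet_Icc step1
      _ = _ := lintegral_const_mul' _ _ (by simp)
  have step3 : ∫⁻ l in Icc (1 : ℝ) 2, volume {x | l * d x ∈ A} =
      ∫⁻ x, volume.restrict (Icc (1 : ℝ) 2) {l | l * d x ∈ A} := by
    have h1 := Measure.prod_apply (μ := volume.restrict (Icc (1 : ℝ) 2)) (ν := (volume : Measure (𝔼 m)))
      hmeas1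
    have h2 := Measure.prod_apply_symm (μ := volume.restrict (Icc (1 : ℝ) 2))
      (ν := (volume : Measure (𝔼 m))) hmeas1
    exact h1.symm.trans h2
  -- Substitute `a = l * d x`. Since `l` is in `[1, 2]`, `a` is between `d x` and `2 * d x`, so `dl
  -- = da / d x ≤ (2 / a) da`.
  have step4 (x) : volume.restrict (Icc (1 : ℝ) 2) {l | l * d x ∈ A} ≤
      ∫⁻ a in A, ENNReal.ofReal (2 / a) * indicator {a | d x ≤ a} 1 a := by
    rcases (hd0 x).eq_or_lt with h0 | h0
    · have : {l : ℝ | l * d x ∈ A} = ∅ := by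
        ext l
        simp only [← h0, mul_zero, mem_ofPred_eq, mem_empty_iff_false, iff_false]
        exact fun h => lt_irrefl _ (hAδ h).1
      simp [this]
    · have hm1 : MeasurableSet {l : ℝ | l * d x ∈ A} := (measurable_id.mul_const _) hA
      have hm2 : MeasurableSet (A ∩ Icc (d x) (2 * d x)) := hA.inter measurableSet_Icc
      have hsub : {l : ℝ | l * d x ∈ A} ∩ Icc 1 2 ⊆
          (fun l : ℝ => l * d x) ⁻¹' (A ∩ Icc (d x) (2 * d x)) := by
        rintro l ⟨hl, hl1, hl2⟩
        exact ⟨hl, by nlinarith, by nlinarith⟩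
      rw [Measure.restrict_apply hm1]
      refine (measure_mono hsub).trans ?_
      rw [Real.volume_preimage_mul_right h0.ne', abs_of_pos (inv_pos.2 h0), ← setLIntegral_const,
        ← lintegral_indicator hm2, ← lintegral_indicator hA]
      refine lintegral_mono fun a => ?_
      by_cases ha : a ∈ A ∩ Icc (d x) (2 * d x)
      · rw [indicator_of_mem ha, indicator_of_mem ha.1, indicator_of_mem (by exact ha.2.1)]
        simp only [Pi.one_apply, mul_one]
        refine ENNReal.ofReal_le_ofReal ?_
        have ha0 : 0 < a := (hAδ ha.1).1
        rw [inv_eq_one_div, div_le_div_iff₀ h0 ha0]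
        linarith [ha.2.2]
      · rw [indicator_of_notMem ha]
        exact zero_le
  have hmeas2 : MeasurableSet {p : 𝔼 m × ℝ | d p.1 ≤ p.2} :=
    measurableSet_le (hdm.comp measurable_fst) measurable_snd
  have step5 : ∫⁻ x, ∫⁻ a in A, ENNReal.ofReal (2 / a) * indicator {a | d x ≤ a} 1 a =
      ∫⁻ a in A, ENNReal.ofReal (2 / a) * volume {x | d x ≤ a} := by
    rw [lintegral_lintegral_swap]
    · refine lintegral_congr fun a => ?_
      rw [lintegral_const_mul' _ _ (by simp), ← lintegral_indicator_one
        (measurableSet_le hdm measurable_const)]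
      rfl
    · refine Measurable.aemeasurable ?_
      refine Measurable.mul (by fun_prop) ?_
      exact (measurable_one.indicator hmeas2)
  calc volume {x | d x ∈ A} ≤ 2 ^ m * ∫⁻ l in Icc (1 : ℝ) 2, volume {x | l * d x ∈ A} := step2
    _ ≤ 2 ^ m * ∫⁻ a in A, ENNReal.ofReal (2 / a) * volume {x | d x ≤ a} := by
        rw [step3, ← step5]
        exact mul_le_mul_right (lintegral_mono step4) _
    _ ≤ 2 ^ m * ∫⁻ a in A, ENNReal.ofReal (2 * η) := by
        refine mul_le_mul_right (setLIntegral_mono' hA fun a ha => ?_) _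
        have ha0 : 0 < a := (hAδ ha).1
        calc ENNReal.ofReal (2 / a) * volume {x | d x ≤ a}
            ≤ ENNReal.ofReal (2 / a) * ENNReal.ofReal (η * a) :=
              mul_le_mul_right (hV a (hAδ ha)) _
          _ = ENNReal.ofReal (2 * η) := by
              rw [← ENNReal.ofReal_mul (by positivity)]
              congr 1
              field_simp
    _ = ENNReal.ofReal (2 ^ m * (2 * η)) * volume A := by
        have h2 : (2 : ℝ≥0∞) ^ m = ENNReal.ofReal (2 ^ m) := by
          rw [ENNReal.ofReal_pow zero_le_two]; simp
        rw [setLIntegral_const, ← mul_assoc, h2, ENNReal.ofReal_mul (p := 2 ^ m) (by positivity)]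

/-- The neighbourhoods of a Lipschitz image of a set in `ℝⁿ` have volume at most proportional to
their width times the volume of the neighbourhoods of the set. -/
theorem exists_volume_infDist_image_le {n : ℕ} {ψ : 𝔼 n → 𝔼 (n + 1)} (hψ : ContDiff ℝ 1 ψ)
    (R : ℝ) : ∃ c : ℝ, 0 < c ∧ ∀ Q ⊆ Metric.closedBall (0 : 𝔼 n) R, IsCompact Q → Q.Nonempty →
      ∀ t ∈ Ioc (0 : ℝ) 1, volume {x | Metric.infDist x (ψ '' Q) ≤ t} ≤
        ENNReal.ofReal (c * t) * volume (Metric.cthickening t Q) := by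
  -- Radius `R + 1` because balls of radius `t ≤ 1` around points of `Q` must stay in the Lipschitz
  -- domain.
  obtain ⟨L, hL⟩ := hψ.exists_lipschitzOnWith_closedBall (R + 1)
  set ω := (volume (Metric.ball (0 : 𝔼 n) 1)) with hω
  set ω' := (volume (Metric.ball (0 : 𝔼 (n + 1)) 1)) with hω'
  have h0 : ω ≠ 0 := (Metric.measure_ball_pos _ _ one_pos).ne'
  have h1 : ω ≠ ∞ := measure_ball_lt_top.ne
  have h0' : ω' ≠ 0 := (Metric.measure_ball_pos _ _ one_pos).ne'
  have h1' : ω' ≠ ∞ := measure_ball_lt_top.ne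
  have hL0 : (0 : ℝ) < L + 1 := by positivity
  refine ⟨ω'.toReal * (L + 1) ^ (n + 1) / ω.toReal,
    div_pos (mul_pos (ENNReal.toReal_pos h0' h1') (by positivity)) (ENNReal.toReal_pos h0 h1), ?_⟩
  rintro Q hQR hQ hne t ⟨ht0, ht1⟩
  set S := {x | Metric.infDist x (ψ '' Q) ≤ t} with hS
  have hSm : MeasurableSet S := (Metric.continuous_infDist_pt _).measurable measurableSet_Iic
  have hcm : MeasurableSet (Metric.cthickening t Q) := Metric.isClosed_cthickening.measurableSet
  -- Double counting of the pairs `(x, v)` with `ψ v` within `(L + 1) * t` of `x`. Each `x` near `ψ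
  -- '' Q` sees a whole ball of parameters of radius `t`, and each `v` sees only a ball of radius
  -- `(L + 1) * t`. The quotient of `t ^ (n + 1)` by `t ^ n` leaves one factor `t`.
  have key : ∀ x ∈ S, ENNReal.ofReal (t ^ n) * ω ≤
      volume.restrict (Metric.cthickening t Q) {v | dist (ψ v) x ≤ (L + 1) * t} := by
    intro x hx
    obtain ⟨_, ⟨u, hu, rfl⟩, hxu⟩ := (hQ.image hψ.continuous).exists_infDist_eq_dist
      (hne.image ψ) x
    have hxu' : dist x (ψ u) ≤ t := hxu ▸ hx
    have hsub : Metric.closedBall u t ⊆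
        {v | dist (ψ v) x ≤ (L + 1) * t} ∩ Metric.cthickening t Q := by
      intro v hv
      have hv' : dist v u ≤ t := hv
      refine ⟨?_, Metric.mem_cthickening_of_dist_le v u t Q hu hv'⟩
      have hu0 : dist u 0 ≤ R := hQR hu
      have hd := hL.dist_le_mul v (by
        rw [Metric.mem_closedBall]; linarith [dist_triangle v u 0]) u (by
        rw [Metric.mem_closedBall]; linarith)
      have h2 : dist (ψ v) (ψ u) ≤ L * t := hd.trans (by gcongr)
      have h3 := dist_triangle (ψ v) (ψ u) x
      rw [dist_comm (ψ u)] at h3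
      simp only [mem_ofPred_eq]
      linarith
    rw [Measure.restrict_apply]
    · refine le_trans (le_of_eq ?_) (measure_mono hsub)
      rw [Measure.addHaar_closedBall _ _ ht0.le, finrank_euclideanSpace_fin]
    · exact (hψ.continuous.measurable.dist measurable_const) measurableSet_Iic
  have hmeas : MeasurableSet {p : 𝔼 (n + 1) × 𝔼 n | dist (ψ p.2) p.1 ≤ (L + 1) * t} :=
    ((hψ.continuous.measurable.comp measurable_snd).dist measurable_fst) measurableSet_Iic
  have hmain : ENNReal.ofReal (t ^ n) * ω * volume S ≤
      ENNReal.ofReal (((L + 1) * t) ^ (n + 1)) * ω' * volume (Metric.cthickening t Q) := by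
    calc ENNReal.ofReal (t ^ n) * ω * volume S
        = ∫⁻ x in S, ENNReal.ofReal (t ^ n) * ω := by rw [setLIntegral_const]
      _ ≤ ∫⁻ x in S, volume.restrict (Metric.cthickening t Q) {v | dist (ψ v) x ≤ (L + 1) * t} :=
          setLIntegral_mono' hSm key
      _ ≤ ∫⁻ x, volume.restrict (Metric.cthickening t Q) {v | dist (ψ v) x ≤ (L + 1) * t} :=
          setLIntegral_le_lintegral _ _
      _ = ∫⁻ v in Metric.cthickening t Q, volume {x | dist (ψ v) x ≤ (L + 1) * t} := by
          have h1 := Measure.prod_apply (μ := (volume : Measure (𝔼 (n + 1))))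
            (ν := (volume : Measure (𝔼 n)).restrict (Metric.cthickening t Q)) hmeas
          have h2 := Measure.prod_apply_symm (μ := (volume : Measure (𝔼 (n + 1))))
            (ν := (volume : Measure (𝔼 n)).restrict (Metric.cthickening t Q)) hmeas
          exact h1.symm.trans h2
      _ = ∫⁻ v in Metric.cthickening t Q, ENNReal.ofReal (((L + 1) * t) ^ (n + 1)) * ω' := by
          refine lintegral_congr fun v => ?_
          have : {x | dist (ψ v) x ≤ (L + 1) * t} = Metric.closedBall (ψ v) ((L + 1) * t) := by
            ext x; simp [dist_comm]
          rw [this, Measure.addHaar_closedBall _ _ (by positivity), finrank_euclideanSpace_fin]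
      _ = _ := by rw [setLIntegral_const]
  have hpos : ENNReal.ofReal (t ^ n) * ω ≠ 0 :=
    mul_ne_zero (by simp only [ne_eq, ENNReal.ofReal_eq_zero, not_le]; positivity) h0
  have hfin : ENNReal.ofReal (t ^ n) * ω ≠ ∞ := ENNReal.mul_ne_top (by simp) h1
  rw [← ENNReal.mul_le_mul_iff_right hpos hfin]
  refine hmain.trans (le_of_eq ?_)
  rw [← mul_assoc]
  congr 1
  rw [← ENNReal.ofReal_toReal h1, ← ENNReal.ofReal_toReal h1',
    ← ENNReal.ofReal_mul (by positivity), ← ENNReal.ofReal_mul (by positivity),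
    ← ENNReal.ofReal_mul (by positivity)]
  congr 1
  have : ω.toReal ≠ 0 := (ENNReal.toReal_pos h0 h1).ne'
  simp only [ENNReal.toReal_ofReal ENNReal.toReal_nonneg, mul_pow]
  field_simp
  ring

/-- Up to a compact piece of its interior, the patch `ψ '' K` has a tubular neighbourhood of
arbitrarily small volume, relatively to its width. -/
theorem exists_compact_patch_core {n : ℕ} {ψ : 𝔼 n → 𝔼 (n + 1)} (hψ : ContDiff ℝ 1 ψ)
    {K : Set (𝔼 n)} (hK : IsCompact K) (hK0 : volume (frontier K) = 0) {η : ℝ} (hη : 0 < η) :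
    ∃ C Q : Set (𝔼 n), IsCompact C ∧ Q ⊆ K ∧ C ⊆ interior K ∧ K ⊆ C ∪ Q ∧
      volume Q ≤ ENNReal.ofReal η ∧ ∃ δ > 0, ∀ A : Set ℝ, MeasurableSet A → A ⊆ Ioo 0 δ →
        volume {x | Metric.infDist x (ψ '' Q) ∈ A} ≤ ENNReal.ofReal η * volume A := by
  obtain ⟨R, hR⟩ := hK.isBounded.subset_closedBall 0
  obtain ⟨c, hc, hcV⟩ := exists_volume_infDist_image_le hψ R
  -- The second entry makes the constant of `volume_shell_le`, with `c * (2 * κ)` as its slope, at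
  -- most `η`.
  set κ : ℝ := min η (η / (2 ^ (n + 1) * (2 * (c * 2)))) with hκ
  have hκ0 : 0 < κ := lt_min hη (by positivity)
  have hfin : volume (interior K) ≠ ∞ := ((measure_mono interior_subset).trans_lt hK.measure_lt_top).ne
  obtain ⟨C₀, hC₀K, hC₀, hC₀v⟩ := isOpen_interior.measurableSet.exists_isCompact_sdiff_lt hfin
    (ε := ENNReal.ofReal κ) (by simpa using hκ0)
  -- A second compact set around `C₀` allows removing the open set `interior C`, so `Q` stays
  -- compact. `C` and `Q` may overlap.
  obtain ⟨C, hC, hC₀C, hCK⟩ := exists_compact_between hC₀ isOpen_interior hC₀K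
  have hQ : IsCompact (K \ interior C) := hK.diff isOpen_interior
  have hQv : volume (K \ interior C) ≤ ENNReal.ofReal κ := by
    have hsub : K \ interior C ⊆ frontier K ∪ (interior K \ C₀) := by
      rintro x ⟨hxK, hxC⟩
      by_cases hx : x ∈ interior K
      · exact Or.inr ⟨hx, fun h => hxC (hC₀C h)⟩
      · exact Or.inl ⟨subset_closure hxK, hx⟩
    calc volume (K \ interior C) ≤ volume (frontier K) + volume (interior K \ C₀) :=
          (measure_mono hsub).trans (measure_union_le _ _)
      _ ≤ _ := by rw [hK0, zero_add]; exact hC₀v.le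
  refine ⟨C, K \ interior C, hC, sdiff_subset, hCK, fun x hx => ?_,
    hQv.trans (ENNReal.ofReal_le_ofReal (min_le_left _ _)), ?_⟩
  · by_cases h : x ∈ C
    · exact Or.inl h
    · exact Or.inr ⟨hx, fun h' => h (interior_subset h')⟩
  set Q := K \ interior C with hQdef
  rcases Q.eq_empty_or_nonempty with h0 | hne
  · refine ⟨1, one_pos, fun A _ hA => ?_⟩
    have : {x | Metric.infDist x (ψ '' Q) ∈ A} = ∅ := by
      ext x
      simp only [h0, image_empty, Metric.infDist_empty, mem_ofPred_eq, mem_empty_iff_false, iff_false]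
      exact fun h => lt_irrefl _ (hA h).1
    simp [this]
  -- Compactness of `Q` is used here: its thin neighbourhoods have nearly the volume of `Q`, so they
  -- are eventually below `2 * κ`.
  have hthick : Tendsto (fun r => volume (Metric.cthickening r Q)) (𝓝 0) (𝓝 (volume Q)) :=
    tendsto_measure_cthickening_of_isCompact hQ
  have hlt : volume Q < ENNReal.ofReal (2 * κ) :=
    hQv.trans_lt (by rw [ENNReal.ofReal_lt_ofReal_iff (by positivity)]; linarith)
  obtain ⟨δ, hδ0, hδ⟩ := Metric.eventually_nhds_iff.1 (hthick.eventually (eventually_lt_nhds hlt))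
  refine ⟨min δ 1, lt_min hδ0 one_pos, fun A hA hAδ => ?_⟩
  have hV : ∀ a ∈ Ioo 0 (min δ 1), volume {x | Metric.infDist x (ψ '' Q) ≤ a} ≤
      ENNReal.ofReal (c * (2 * κ) * a) := by
    intro a ha
    have ha1 : a < δ := ha.2.trans_le (min_le_left _ _)
    have ha2 : a ≤ 1 := (ha.2.trans_le (min_le_right _ _)).le
    refine (hcV Q (sdiff_subset.trans hR) hQ hne a ⟨ha.1, ha2⟩).trans ?_
    have h1 : volume (Metric.cthickening a Q) < ENNReal.ofReal (2 * κ) :=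
      hδ (by rw [Real.dist_eq, sub_zero, abs_of_pos ha.1]; exact ha1)
    refine (mul_le_mul_right h1.le _).trans (le_of_eq ?_)
    rw [← ENNReal.ofReal_mul (by have := ha.1; positivity)]
    congr 1; ring
  refine (volume_shell_le (hQ.image hψ.continuous) hV hA hAδ).trans ?_
  gcongr
  have h1 : κ ≤ η / (2 ^ (n + 1) * (2 * (c * 2))) := min_le_right _ _
  rw [le_div_iff₀ (by positivity)] at h1
  linarith

/-! ### Normal coordinates of a hypersurface patch -/

/-- The map `(u, t) ↦ ψ u + t ν(u)`, where `ν` is the unit normal field of the patch `ψ`. -/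
def normalChart {n : ℕ} (ψ : 𝔼 n → 𝔼 (n + 1)) (p : 𝔼 n × ℝ) : 𝔼 (n + 1) :=
  ψ p.1 + p.2 • unitNormal (fderiv ℝ ψ p.1)

theorem normalChart_zero {n : ℕ} (ψ : 𝔼 n → 𝔼 (n + 1)) (u : 𝔼 n) :
    normalChart ψ (u, 0) = ψ u := by
  simp [normalChart]

theorem dist_normalChart {n : ℕ} {ψ : 𝔼 n → 𝔼 (n + 1)} {u : 𝔼 n}
    (hu : Function.Injective (fderiv ℝ ψ u)) (t : ℝ) : dist (normalChart ψ (u, t)) (ψ u) = |t| := by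
  simp [normalChart, dist_eq_norm, norm_smul, norm_unitNormal hu]

theorem contDiffAt_unitNormal {n : ℕ} {A : 𝔼 n →L[ℝ] 𝔼 (n + 1)} (hA : Function.Injective A)
    {k : WithTop ℕ∞} : ContDiffAt ℝ k unitNormal A := by
  have h := (contDiff_normalVector (n := n) (k := k)).contDiffAt (x := A)
  exact ((h.norm ℝ (normalVector_ne_zero hA)).inv
    (norm_ne_zero_iff.2 (normalVector_ne_zero hA))).smul h

theorem contDiffAt_normalChart {n : ℕ} {ψ : 𝔼 n → 𝔼 (n + 1)} (hψ : ContDiff ℝ 2 ψ) {p : 𝔼 n × ℝ}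
    (hp : Function.Injective (fderiv ℝ ψ p.1)) : ContDiffAt ℝ 1 (normalChart ψ) p := by
  have h1 : ContDiff ℝ 1 (fun p : 𝔼 n × ℝ => fderiv ℝ ψ p.1) :=
    (hψ.fderiv_right (m := 1) (by norm_num)).comp contDiff_fst
  have h2 : ContDiffAt ℝ 1 (fun p : 𝔼 n × ℝ => unitNormal (fderiv ℝ ψ p.1)) p :=
    ContDiffAt.comp (g := unitNormal) (f := fun p : 𝔼 n × ℝ => fderiv ℝ ψ p.1) p
      (contDiffAt_unitNormal hp) h1.contDiffAt
  exact (((hψ.of_le (by norm_num)).comp contDiff_fst).contDiffAt).add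
    (contDiff_snd.contDiffAt.smul h2)

/-- The derivative is determined by its restrictions to the two factors. On the slice `t = 0` the
chart is `ψ` itself, so the derivative of the normal field does not enter. -/
theorem fderiv_normalChart_zero {n : ℕ} {ψ : 𝔼 n → 𝔼 (n + 1)} (hψ : ContDiff ℝ 2 ψ) {u : 𝔼 n}
    (hu : Function.Injective (fderiv ℝ ψ u)) :
    fderiv ℝ (normalChart ψ) (u, 0) = adjoinColumn (fderiv ℝ ψ u) (unitNormal (fderiv ℝ ψ u)) := by
  have hd := ((contDiffAt_normalChart hψ (p := (u, 0)) hu).differentiableAt one_ne_zero).hasFDerivAt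
  have h1 : HasFDerivAt (fun v => normalChart ψ (v, 0))
      ((fderiv ℝ (normalChart ψ) (u, 0)).comp (ContinuousLinearMap.inl ℝ (𝔼 n) ℝ)) u :=
    HasFDerivAt.comp u (f := fun v => (v, (0 : ℝ))) hd (hasFDerivAt_prodMk_left u 0)
  have h2 : HasFDerivAt (fun t => normalChart ψ (u, t))
      ((fderiv ℝ (normalChart ψ) (u, 0)).comp (ContinuousLinearMap.inr ℝ (𝔼 n) ℝ)) 0 :=
    HasFDerivAt.comp (0 : ℝ) (f := fun t => (u, t)) hd (hasFDerivAt_prodMk_right u 0)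
  have h1' : HasFDerivAt (fun v => normalChart ψ (v, 0)) (fderiv ℝ ψ u) u := by
    simp only [normalChart_zero]
    exact (hψ.differentiable two_ne_zero u).hasFDerivAt
  have h2' : HasFDerivAt (fun t => normalChart ψ (u, t))
      (ContinuousLinearMap.toSpanSingleton ℝ (unitNormal (fderiv ℝ ψ u))) 0 := by
    have := ((hasDerivAt_id (0 : ℝ)).smul_const (unitNormal (fderiv ℝ ψ u))).const_add (ψ u)
    rw [one_smul] at this
    exact this.hasFDerivAt
  have e1 := h1.unique h1'
  have e2 := h2.unique h2'
  refine ContinuousLinearMap.ext fun p => ?_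
  rw [adjoinColumn, ← e2, ← e1]
  simp

/-- The Jacobian of the normal chart, in absolute value. -/
def normalJacobian {n : ℕ} (ψ : 𝔼 n → 𝔼 (n + 1)) (p : 𝔼 n × ℝ) : ℝ :=
  |((fderiv ℝ (normalChart ψ) p).comp ((consEquiv n).symm : 𝔼 (n + 1) →L[ℝ] 𝔼 n × ℝ)).det|

theorem normalJacobian_zero {n : ℕ} {ψ : 𝔼 n → 𝔼 (n + 1)} (hψ : ContDiff ℝ 2 ψ) {u : 𝔼 n}
    (hu : Function.Injective (fderiv ℝ ψ u)) : normalJacobian ψ (u, 0) = areaFactor ψ u := by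
  rw [normalJacobian, fderiv_normalChart_zero hψ hu, det_adjoinColumn_unitNormal,
    abs_of_nonneg (norm_nonneg _), areaFactor]

theorem continuousAt_normalJacobian {n : ℕ} {ψ : 𝔼 n → 𝔼 (n + 1)} (hψ : ContDiff ℝ 2 ψ)
    {p : 𝔼 n × ℝ} (hp : Function.Injective (fderiv ℝ ψ p.1)) :
    ContinuousAt (normalJacobian ψ) p := by
  have h1 : ContinuousAt (fderiv ℝ (normalChart ψ)) p :=
    (contDiffAt_normalChart hψ hp).continuousAt_fderiv one_ne_zero
  exact (ContinuousLinearMap.continuous_det.continuousAt.comp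
    (h1.clm_comp continuousAt_const)).abs

/-- `ψ` parametrizes over `U` a relatively open `C²` piece of the closed set `F`. -/
structure IsHypersurfacePatch {n : ℕ} (F : Set (𝔼 (n + 1))) (ψ : 𝔼 n → 𝔼 (n + 1))
    (U : Set (𝔼 n)) : Prop where
  contDiff : ContDiff ℝ 2 ψ
  isOpen : IsOpen U
  injOn : InjOn ψ U
  immersion : ∀ u ∈ U, Function.Injective (fderiv ℝ ψ u)
  image_subset : ψ '' U ⊆ F
  locally_image : ∀ u ∈ U, ∀ V ∈ 𝓝 u, ∀ᶠ y in 𝓝 (ψ u), y ∈ F → y ∈ ψ '' V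

namespace IsHypersurfacePatch

variable {n : ℕ} {F : Set (𝔼 (n + 1))} {ψ : 𝔼 n → 𝔼 (n + 1)} {U : Set (𝔼 n)}

/-- A point is reached from its nearest point on the patch along the normal. -/
theorem exists_eq_normalChart (h : IsHypersurfacePatch F ψ U) {u : 𝔼 n} (hu : u ∈ U)
    {x : 𝔼 (n + 1)} (hx : dist x (ψ u) = Metric.infDist x F) :
    ∃ t : ℝ, x = normalChart ψ (u, t) ∧ |t| = Metric.infDist x F := by
  -- First-order condition: at the minimum of the squared distance, `x - ψ u` is orthogonal to the
  -- tangent space, hence a multiple of the unit normal.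
  have hmin : IsLocalMin (fun v => ‖x - ψ v‖ ^ 2) u := by
    filter_upwards [h.isOpen.mem_nhds hu] with v hv
    have h1 := Metric.infDist_le_dist_of_mem (x := x) (h.image_subset ⟨v, hv, rfl⟩)
    rw [← hx, dist_eq_norm, dist_eq_norm] at h1
    gcongr
  have hd : HasFDerivAt (fun v => x - ψ v) (-(fderiv ℝ ψ u)) u :=
    (h.contDiff.differentiable two_ne_zero u).hasFDerivAt.const_sub x
  have h0 := hmin.hasFDerivAt_eq_zero hd.norm_sq
  have horth (v) : ⟪x - ψ u, fderiv ℝ ψ u v⟫ = 0 := by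
    have := congrArg (fun L : 𝔼 n →L[ℝ] ℝ => L v) h0
    rw [inner_sub_left, ← neg_eq_zero, neg_sub]
    simpa using this
  obtain ⟨t, ht⟩ := exists_eq_smul_unitNormal (h.immersion u hu) horth
  have hxt : x = normalChart ψ (u, t) := by rw [normalChart, ← ht]; abel
  refine ⟨t, hxt, ?_⟩
  rw [← hx, ← dist_normalChart (h.immersion u hu) t, ← hxt]

/-- The tangent vectors and the unit normal are independent, so the inverse function theorem applies
at `(u, 0)`. -/
theorem hasStrictFDerivAt (h : IsHypersurfacePatch F ψ U) {u : 𝔼 n} (hu : u ∈ U) :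
    ∃ L : (𝔼 n × ℝ) ≃L[ℝ] 𝔼 (n + 1),
      HasStrictFDerivAt (normalChart ψ) (L : 𝔼 n × ℝ →L[ℝ] 𝔼 (n + 1)) (u, 0) := by
  have hi := h.immersion u hu
  have hν : unitNormal (fderiv ℝ ψ u) ∉ LinearMap.range (fderiv ℝ ψ u).toLinearMap := by
    rintro ⟨v, hv⟩
    have h1 := inner_unitNormal_apply (fderiv ℝ ψ u) v
    have h2 : fderiv ℝ ψ u v = unitNormal (fderiv ℝ ψ u) := hv
    rw [h2, real_inner_self_eq_norm_sq, norm_unitNormal hi] at h1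
    norm_num at h1
  have hinj : LinearMap.ker (adjoinColumn (fderiv ℝ ψ u) (unitNormal (fderiv ℝ ψ u))).toLinearMap = ⊥ :=
    LinearMap.ker_eq_bot.2 (adjoinColumn_injective hi hν)
  let L : (𝔼 n × ℝ) ≃L[ℝ] 𝔼 (n + 1) := (LinearEquiv.ofInjectiveOfFinrankEq
    (adjoinColumn (fderiv ℝ ψ u) (unitNormal (fderiv ℝ ψ u))).toLinearMap
    (adjoinColumn_injective hi hν) (by simp)).toContinuousLinearEquiv
  refine ⟨L, ?_⟩
  have h1 : (L : 𝔼 n × ℝ →L[ℝ] 𝔼 (n + 1)) = fderiv ℝ (normalChart ψ) (u, 0) := by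
    rw [fderiv_normalChart_zero h.contDiff hi]
    refine ContinuousLinearMap.ext fun p => ?_
    rfl
  rw [h1]
  exact (contDiffAt_normalChart h.contDiff (p := (u, 0)) hi).hasStrictFDerivAt one_ne_zero

/-- The normal chart is injective on a box around `(u, 0)`. -/
theorem exists_injOn_box (h : IsHypersurfacePatch F ψ U) {u : 𝔼 n} (hu : u ∈ U) :
    ∃ r > 0, Metric.ball u r ⊆ U ∧
      InjOn (normalChart ψ) (Metric.ball u r ×ˢ Ioo (-r) r) := by
  obtain ⟨L, hL⟩ := h.hasStrictFDerivAt hu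
  have hs : (hL.toOpenPartialHomeomorph (normalChart ψ)).source ∈ 𝓝 ((u, 0) : 𝔼 n × ℝ) :=
    (hL.toOpenPartialHomeomorph _).open_source.mem_nhds hL.mem_toOpenPartialHomeomorph_source
  have hinj : InjOn (normalChart ψ) (hL.toOpenPartialHomeomorph (normalChart ψ)).source :=
    (hL.toOpenPartialHomeomorph (normalChart ψ)).injOn
  obtain ⟨ε, hε, hball⟩ := Metric.mem_nhds_iff.1 hs
  obtain ⟨ε', hε', hball'⟩ := Metric.mem_nhds_iff.1 (h.isOpen.mem_nhds hu)
  refine ⟨min ε ε', lt_min hε hε', (Metric.ball_subset_ball (min_le_right _ _)).trans hball',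
    hinj.mono (Subset.trans ?_ hball)⟩
  rintro ⟨v, t⟩ ⟨hv, ht⟩
  rw [← ball_prod_same]
  refine ⟨Metric.ball_subset_ball (min_le_left _ _) hv, ?_⟩
  rw [Metric.mem_ball, Real.dist_eq, sub_zero, abs_lt]
  exact ⟨by linarith [ht.1, min_le_left ε ε'], by linarith [ht.2, min_le_left ε ε']⟩

/-- Points close to the patch on a given normal have a unique nearest point: its foot. -/
theorem eventually_nearest_eq (h : IsHypersurfacePatch F ψ U) {u : 𝔼 n} (hu : u ∈ U) :
    ∀ᶠ t in 𝓝 (0 : ℝ), ∀ y ∈ F,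
      dist (normalChart ψ (u, t)) y = Metric.infDist (normalChart ψ (u, t)) F → y = ψ u := by
  obtain ⟨r, hr, hrU, hinj⟩ := h.exists_injOn_box hu
  obtain ⟨ρ, hρ, hρF⟩ := Metric.eventually_nhds_iff.1
    (h.locally_image u hu (Metric.ball u r) (Metric.ball_mem_nhds u hr))
  -- A nearest point of `normalChart ψ (u, t)` is within `2 * |t|` of `ψ u`. Below `ρ` it lies on
  -- the patch as some `ψ v`, and then the point is on the normals at both `u` and `v` inside the
  -- injectivity box.
  have hev : ∀ᶠ t in 𝓝 (0 : ℝ), |t| < min r (ρ / 2) := by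
    have : Tendsto (fun t : ℝ => |t|) (𝓝 0) (𝓝 0) := by simpa using (continuous_abs.tendsto (0 : ℝ))
    exact this.eventually (eventually_lt_nhds (by positivity))
  filter_upwards [hev] with t ht y hy hty
  have ht1 : |t| < r := ht.trans_le (min_le_left _ _)
  have ht2 : |t| < ρ / 2 := ht.trans_le (min_le_right _ _)
  have hle : Metric.infDist (normalChart ψ (u, t)) F ≤ |t| :=
    (Metric.infDist_le_dist_of_mem (h.image_subset ⟨u, hu, rfl⟩)).trans_eq
      (dist_normalChart (h.immersion u hu) t)
  have hyu : dist y (ψ u) < ρ := by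
    have h1 := dist_triangle_left y (ψ u) (normalChart ψ (u, t))
    rw [dist_normalChart (h.immersion u hu) t, hty] at h1
    linarith
  obtain ⟨v, hv, rfl⟩ := hρF hyu hy
  obtain ⟨s, hs, hs'⟩ := h.exists_eq_normalChart (hrU hv) hty
  have := hinj (show (u, t) ∈ Metric.ball u r ×ˢ Ioo (-r) r from
    ⟨Metric.mem_ball_self hr, abs_lt.1 ht1⟩) (show (v, s) ∈ Metric.ball u r ×ˢ Ioo (-r) r from
    ⟨hv, abs_lt.1 (by rw [hs']; linarith)⟩) hs
  rw [(Prod.mk.inj this).1]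

theorem eventually_infDist_normalChart (h : IsHypersurfacePatch F ψ U) (hF : IsCompact F)
    {u : 𝔼 n} (hu : u ∈ U) :
    ∀ᶠ t in 𝓝 (0 : ℝ), Metric.infDist (normalChart ψ (u, t)) F = |t| := by
  filter_upwards [h.eventually_nearest_eq hu] with t ht
  obtain ⟨y, hy, hy'⟩ := hF.exists_infDist_eq_dist ⟨ψ u, h.image_subset ⟨u, hu, rfl⟩⟩
    (normalChart ψ (u, t))
  rw [hy', ht y hy hy'.symm, dist_normalChart (h.immersion u hu)]

end IsHypersurfacePatch

theorem IsPreconnected.subset_or_disjoint_of_disjoint_frontier {X : Type*} [TopologicalSpace X]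
    {H s : Set X} (hH : IsPreconnected H) (hd : Disjoint H (frontier s)) : H ⊆ s ∨ Disjoint H s := by
  have hsub : H ⊆ interior s ∪ (closure s)ᶜ := fun x hx => by
    by_cases h : x ∈ closure s
    · exact Or.inl (by_contra fun h' => disjoint_left.1 hd hx ⟨h, h'⟩)
    · exact Or.inr h
  have hdisj : Disjoint (interior s) (closure s)ᶜ :=
    disjoint_compl_right_iff_subset.2 (interior_subset.trans subset_closure)
  refine (hH.subset_or_subset isOpen_interior isClosed_closure.isOpen_compl hdisj hsub).imp
    (fun h => h.trans interior_subset) fun h => ?_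
  exact disjoint_left.2 fun x hx hxs => h hx (subset_closure hxs)

/-- A regular closed set lies on exactly one side of each smooth piece of its boundary. -/
theorem IsHypersurfacePatch.eventually_mem_iff_notMem {n : ℕ} {Ω : Set (𝔼 (n + 1))}
    {ψ : 𝔼 n → 𝔼 (n + 1)} {U : Set (𝔼 n)} (h : IsHypersurfacePatch (frontier Ω) ψ U)
    (hΩ : closure (interior Ω) = Ω) {u : 𝔼 n} (hu : u ∈ U) :
    ∀ᶠ t in 𝓝[>] (0 : ℝ), normalChart ψ (u, t) ∈ Ω ↔ normalChart ψ (u, -t) ∉ Ω := by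
  have hΩc : IsClosed Ω := hΩ ▸ isClosed_closure
  obtain ⟨r, hr, hrU, hinj⟩ := h.exists_injOn_box hu
  have hcont : ContinuousOn (normalChart ψ) (Metric.ball u r ×ˢ univ) := fun p hp =>
    (contDiffAt_normalChart h.contDiff
      (h.immersion p.1 (hrU hp.1))).continuousAt.continuousWithinAt
  have hloc := h.locally_image u hu (Metric.ball u r) (Metric.ball_mem_nhds u hr)
  have hc0 : ContinuousAt (normalChart ψ) (u, 0) :=
    (contDiffAt_normalChart h.contDiff (p := (u, 0)) (h.immersion u hu)).continuousAt
  have hpre : ∀ᶠ p in 𝓝 ((u, 0) : 𝔼 n × ℝ),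
      normalChart ψ p ∈ frontier Ω → normalChart ψ p ∈ ψ '' Metric.ball u r := by
    refine hc0.eventually (p := fun y => y ∈ frontier Ω → y ∈ ψ '' Metric.ball u r) ?_
    rwa [normalChart_zero]
  obtain ⟨ε, hε, hεb⟩ := Metric.eventually_nhds_iff.1 hpre
  set δ := min ε r with hδ
  have hδ0 : 0 < δ := lt_min hε hr
  have hbox : ∀ p : 𝔼 n × ℝ, p ∈ Metric.ball u δ ×ˢ Ioo (-δ) δ →
      p ∈ Metric.ball u r ×ˢ Ioo (-r) r := by
    rintro ⟨v, t⟩ ⟨hv, ht⟩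
    exact ⟨Metric.ball_subset_ball (min_le_right _ _) hv, by linarith [ht.1, min_le_right ε r],
      by linarith [ht.2, min_le_right ε r]⟩
  -- Near `ψ u` all boundary points are `normalChart ψ (v', 0)`, so by injectivity the box meets the
  -- boundary only at height `0`. Each open half of the box is connected and hence on one side of
  -- it.
  have hoff : ∀ p : 𝔼 n × ℝ, p ∈ Metric.ball u δ ×ˢ Ioo (-δ) δ → p.2 ≠ 0 →
      normalChart ψ p ∉ frontier Ω := by
    rintro ⟨v, t⟩ ⟨hv, ht⟩ ht0 hmem
    have hd : dist (v, t) ((u, 0) : 𝔼 n × ℝ) < ε := by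
      rw [Prod.dist_eq, max_lt_iff, Real.dist_eq, sub_zero, abs_lt]
      have h1 : dist v u < δ := hv
      exact ⟨h1.trans_le (min_le_left _ _), by linarith [ht.1, min_le_left ε r],
        by linarith [ht.2, min_le_left ε r]⟩
    obtain ⟨v', hv', he⟩ := hεb hd hmem
    rw [← normalChart_zero ψ v'] at he
    have := hinj (show (v', 0) ∈ Metric.ball u r ×ˢ Ioo (-r) r from
      ⟨hv', by linarith, hr⟩) (hbox _ ⟨hv, ht⟩) he
    exact ht0 (Prod.mk.inj this).2.symm
  have hside : ∀ I : Set ℝ, I ⊆ Ioo (-δ) δ → (0 : ℝ) ∉ I → IsPreconnected I →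
      normalChart ψ '' (Metric.ball u δ ×ˢ I) ⊆ Ω ∨
        Disjoint (normalChart ψ '' (Metric.ball u δ ×ˢ I)) Ω := by
    intro I hI h0 hIc
    refine IsPreconnected.subset_or_disjoint_of_disjoint_frontier ?_ ?_
    · refine ((convex_ball u δ).isPreconnected.prod hIc).image _ (hcont.mono ?_)
      exact prod_mono (Metric.ball_subset_ball (min_le_right _ _)) (subset_univ _)
    · rw [disjoint_left]
      rintro _ ⟨p, hp, rfl⟩
      exact hoff p ⟨hp.1, hI hp.2⟩ fun h => h0 (h ▸ hp.2)
  have hpos := hside (Ioo 0 δ) (Ioo_subset_Ioo_left (by linarith)) (by simp) isPreconnected_Ioo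
  have hneg := hside (Ioo (-δ) 0) (Ioo_subset_Ioo_right (by linarith)) (by simp) isPreconnected_Ioo
  have himg : normalChart ψ '' (Metric.ball u δ ×ˢ Ioo (-δ) δ) ∈ 𝓝 (ψ u) := by
    obtain ⟨L, hL⟩ := h.hasStrictFDerivAt hu
    rw [← normalChart_zero ψ u, ← hL.map_nhds_eq_of_equiv]
    exact image_mem_map (prod_mem_nhds (Metric.ball_mem_nhds u hδ0)
      (Ioo_mem_nhds (by linarith) hδ0))
  have hψu : ψ u ∈ frontier Ω := h.image_subset ⟨u, hu, rfl⟩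
  have hsplit : ∀ p : 𝔼 n × ℝ, p ∈ Metric.ball u δ ×ˢ Ioo (-δ) δ →
      p ∈ Metric.ball u δ ×ˢ Ioo 0 δ ∨ p ∈ Metric.ball u δ ×ˢ Ioo (-δ) 0 ∨
        normalChart ψ p ∈ frontier Ω := by
    rintro ⟨v, t⟩ ⟨hv, ht⟩
    rcases lt_trichotomy t 0 with h0 | rfl | h0
    · exact Or.inr (Or.inl ⟨hv, ht.1, h0⟩)
    · refine Or.inr (Or.inr ?_)
      rw [normalChart_zero]
      exact h.image_subset ⟨v, hrU (Metric.ball_subset_ball (min_le_right _ _) hv), rfl⟩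
    · exact Or.inl ⟨hv, h0, ht.2⟩
  have hmem : ∀ t ∈ Ioo 0 δ,
      normalChart ψ (u, t) ∈ normalChart ψ '' (Metric.ball u δ ×ˢ Ioo 0 δ) ∧
        normalChart ψ (u, -t) ∈ normalChart ψ '' (Metric.ball u δ ×ˢ Ioo (-δ) 0) := fun t ht =>
    ⟨⟨_, ⟨Metric.mem_ball_self hδ0, ht⟩, rfl⟩, ⟨_, ⟨Metric.mem_ball_self hδ0,
      by simpa using ht.2, by simpa using ht.1⟩, rfl⟩⟩
  filter_upwards [Ioo_mem_nhdsGT hδ0] with t ht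
  obtain ⟨hm1, hm2⟩ := hmem t ht
  -- If both halves were in `Ω`, then `ψ u` would be interior. If neither were, `interior Ω` would
  -- miss a neighbourhood of `ψ u`, contradicting `closure (interior Ω) = Ω`.
  rcases hpos with hp | hp <;> rcases hneg with hn | hn
  · exfalso
    refine hψu.2 (mem_interior_iff_mem_nhds.2 (mem_of_superset himg ?_))
    rintro _ ⟨p, hp', rfl⟩
    rcases hsplit p hp' with h1 | h1 | h1
    · exact hp ⟨p, h1, rfl⟩
    · exact hn ⟨p, h1, rfl⟩
    · exact hΩc.frontier_subset h1
  · exact iff_of_true (hp hm1) (disjoint_left.1 hn hm2)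
  · exact iff_of_false (disjoint_left.1 hp hm1) (not_not.2 (hn hm2))
  · exfalso
    have hcl : ψ u ∈ closure (interior Ω) := by
      rw [hΩ]; exact hΩc.frontier_subset hψu
    obtain ⟨z, hz, hz'⟩ := mem_closure_iff_nhds.1 hcl _ himg
    obtain ⟨p, hp', rfl⟩ := hz
    have hzΩ := interior_subset hz'
    rcases hsplit p hp' with h1 | h1 | h1
    · exact disjoint_left.1 hp ⟨p, h1, rfl⟩ hzΩ
    · exact disjoint_left.1 hn ⟨p, h1, rfl⟩ hzΩ
    · exact h1.2 hz'

/-- The local condition is a compactness argument: the other patches, and patch `i` without a small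
open `W` around `u`, are compact images avoiding `ψ i u` by injectivity and the disjointness
assumptions. Near `ψ i u` only `ψ i '' W` remains. -/
theorem isHypersurfacePatch_of_decomposition {n N : ℕ} {F : Set (𝔼 (n + 1))}
    {K : Fin N → Set (𝔼 n)} {ψ : Fin N → 𝔼 n → 𝔼 (n + 1)}
    (hK : ∀ i, IsCompact (K i))
    (hψ : ∀ i, ContDiff ℝ 2 (ψ i) ∧ InjOn (ψ i) (interior (K i)) ∧
      ∀ u ∈ interior (K i), Function.Injective (fderiv ℝ (ψ i) u))
    (hint : ∀ i j, i ≠ j → Disjoint (ψ i '' interior (K i)) (ψ j '' interior (K j)))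
    (hedge : ∀ i j, Disjoint (ψ i '' interior (K i)) (ψ j '' frontier (K j)))
    (hF : F = ⋃ i, ψ i '' K i) (i : Fin N) :
    IsHypersurfacePatch F (ψ i) (interior (K i)) where
  contDiff := (hψ i).1
  isOpen := isOpen_interior
  injOn := (hψ i).2.1
  immersion := (hψ i).2.2
  image_subset := by
    rw [hF]
    exact (image_mono interior_subset).trans (subset_iUnion (fun i => ψ i '' K i) i)
  locally_image := by
    intro u hu V hV
    obtain ⟨W, hWV, hW, huW⟩ := mem_nhds_iff.1 (inter_mem hV (isOpen_interior.mem_nhds hu))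
    have hsplit (j) (v) (hv : v ∈ K j) : v ∈ interior (K j) ∨ v ∈ frontier (K j) := by
      by_cases h : v ∈ interior (K j)
      · exact Or.inl h
      · exact Or.inr ⟨subset_closure hv, h⟩
    have h1 : ∀ j, ∀ᶠ y in 𝓝 (ψ i u), y ∈ ψ j '' K j → y ∈ ψ i '' V := by
      intro j
      by_cases hij : i = j
      · subst hij
        have hcl : IsClosed (ψ i '' (K i \ W)) :=
          (((hK i).diff hW).image (hψ i).1.continuous).isClosed
        have hnot : ψ i u ∉ ψ i '' (K i \ W) := by
          rintro ⟨v, ⟨hv, hvW⟩, he⟩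
          rcases hsplit i v hv with h | h
          · exact hvW ((hψ i).2.1 h hu he ▸ huW)
          · exact disjoint_left.1 (hedge i i) ⟨u, hu, rfl⟩ ⟨v, h, he⟩
        filter_upwards [hcl.isOpen_compl.mem_nhds hnot] with y hy hyK
        obtain ⟨v, hv, rfl⟩ := hyK
        by_cases hvW : v ∈ W
        · exact ⟨v, (hWV hvW).1, rfl⟩
        · exact absurd ⟨v, ⟨hv, hvW⟩, rfl⟩ hy
      · have hcl : IsClosed (ψ j '' K j) := ((hK j).image (hψ j).1.continuous).isClosed
        have hnot : ψ i u ∉ ψ j '' K j := by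
          rintro ⟨v, hv, he⟩
          rcases hsplit j v hv with h | h
          · exact disjoint_left.1 (hint i j hij) ⟨u, hu, rfl⟩ ⟨v, h, he⟩
          · exact disjoint_left.1 (hedge i j) ⟨u, hu, rfl⟩ ⟨v, h, he⟩
        filter_upwards [hcl.isOpen_compl.mem_nhds hnot] with y hy hyK
        exact absurd hyK hy
    filter_upwards [eventually_all.2 h1] with y hy hyF
    rw [hF, mem_iUnion] at hyF
    obtain ⟨j, hj⟩ := hyF
    exact hy j hj

/-! ### Integrals over thin tubes around one patch -/

theorem continuous_normalVector {n : ℕ} :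
    Continuous (normalVector : (𝔼 n →L[ℝ] 𝔼 (n + 1)) → 𝔼 (n + 1)) :=
  (contDiff_normalVector (k := 0)).continuous

theorem measurable_normalChart {n : ℕ} {ψ : 𝔼 n → 𝔼 (n + 1)} (hψ : ContDiff ℝ 2 ψ) :
    Measurable (normalChart ψ) := by
  have h1 : Measurable (fun p : 𝔼 n × ℝ => normalVector (fderiv ℝ ψ p.1)) :=
    (continuous_normalVector.comp
      ((hψ.continuous_fderiv two_ne_zero).comp continuous_fst)).measurable
  exact (hψ.continuous.measurable.comp measurable_fst).add
    (measurable_snd.smul (h1.norm.inv.smul h1))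

theorem measurable_normalJacobian {n : ℕ} (ψ : 𝔼 n → 𝔼 (n + 1)) :
    Measurable (normalJacobian ψ) := by
  have h1 : Measurable (fderiv ℝ (normalChart ψ)) := measurable_fderiv ℝ _
  have h2 : Continuous fun L : 𝔼 n × ℝ →L[ℝ] 𝔼 (n + 1) =>
      |(L.comp ((consEquiv n).symm : 𝔼 (n + 1) →L[ℝ] 𝔼 n × ℝ)).det| :=
    (ContinuousLinearMap.continuous_det.comp (continuous_id.clm_comp continuous_const)).abs
  exact h2.measurable.comp h1

/-- The integrand of the tube integral in normal coordinates: it vanishes at the coordinates whose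
image has another nearest point, or lies on the wrong side. -/
def normalIntegrand {n : ℕ} (ψ : 𝔼 n → 𝔼 (n + 1)) (γ : 𝔼 (n + 1) → 𝔼 (n + 1))
    (w f : 𝔼 (n + 1) → ℝ) (p : 𝔼 n × ℝ) : ℝ :=
  indicator {p | γ (normalChart ψ p) = ψ p.1 ∧ 0 < w (normalChart ψ p)}
    (fun p => normalJacobian ψ p * f (normalChart ψ p)) p

/-- `w` is a signed distance to `F` with nearest point map `γ`. -/
structure IsSignedDist {n : ℕ} (F : Set (𝔼 (n + 1))) (γ : 𝔼 (n + 1) → 𝔼 (n + 1))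
    (w : 𝔼 (n + 1) → ℝ) : Prop where
  measurable : Measurable w
  abs_eq : ∀ x, |w x| = Metric.infDist x F
  measurable_nearest : Measurable γ
  nearest_mem : ∀ x, γ x ∈ F
  dist_nearest : ∀ x, dist x (γ x) = Metric.infDist x F

namespace IsHypersurfacePatch

variable {n : ℕ} {F : Set (𝔼 (n + 1))} {ψ : 𝔼 n → 𝔼 (n + 1)} {U : Set (𝔼 n)}
  {γ : 𝔼 (n + 1) → 𝔼 (n + 1)} {w f : 𝔼 (n + 1) → ℝ}

theorem measurable_normalIntegrand (h : IsHypersurfacePatch F ψ U) (hw : IsSignedDist F γ w)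
    (hf : Measurable f) : Measurable (normalIntegrand ψ γ w f) := by
  have hΦ := measurable_normalChart h.contDiff
  refine Measurable.indicator ((measurable_normalJacobian ψ).mul (hf.comp hΦ)) ?_
  refine MeasurableSet.inter ?_ ((hw.measurable.comp hΦ) measurableSet_Ioi)
  exact measurableSet_eq_fun (hw.measurable_nearest.comp hΦ)
    (h.contDiff.continuous.measurable.comp measurable_fst)

theorem infDist_normalChart_le (h : IsHypersurfacePatch F ψ U) {u : 𝔼 n} (hu : u ∈ U) (t : ℝ) :
    Metric.infDist (normalChart ψ (u, t)) F ≤ |t| :=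
  (Metric.infDist_le_dist_of_mem (h.image_subset ⟨u, hu, rfl⟩)).trans_eq
    (dist_normalChart (h.immersion u hu) t)

/-- The dominating constant. The Jacobian is continuous at every `(u, t)` with `u ∈ U`, not just
near `t = 0`, so it is bounded on `C ×ˢ Icc (-1) 1`. The factor `f` is bounded since the distance to
`F` is at most `|t|`. -/
theorem exists_normalIntegrand_bound (h : IsHypersurfacePatch F ψ U) {C : Set (𝔼 n)}
    (hC : IsCompact C) (hCU : C ⊆ U) {B δ : ℝ}
    (hB : ∀ x, Metric.infDist x F < δ → |f x| ≤ B) (γ : 𝔼 (n + 1) → 𝔼 (n + 1))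
    (w : 𝔼 (n + 1) → ℝ) :
    ∃ M, ∀ u ∈ C, ∀ t : ℝ, |t| < min δ 1 → |normalIntegrand ψ γ w f (u, t)| ≤ M := by
  have hcont : ContinuousOn (normalJacobian ψ) (C ×ˢ Icc (-1) 1) := fun p hp =>
    (continuousAt_normalJacobian h.contDiff (h.immersion p.1 (hCU hp.1))).continuousWithinAt
  obtain ⟨J, hJ⟩ := (hC.prod isCompact_Icc).exists_bound_of_continuousOn hcont
  refine ⟨|J| * |B|, fun u hu t ht => ?_⟩
  have hf : |f (normalChart ψ (u, t))| ≤ |B| :=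
    (hB _ ((h.infDist_normalChart_le (hCU hu) t).trans_lt (ht.trans_le (min_le_left _ _)))).trans
      (le_abs_self B)
  have ht1 := abs_lt.1 (ht.trans_le (min_le_right _ _))
  have hJ' : |normalJacobian ψ (u, t)| ≤ |J| :=
    (hJ (u, t) ⟨hu, ht1.1.le, ht1.2.le⟩).trans (le_abs_self J)
  rw [normalIntegrand, ← Real.norm_eq_abs]
  refine (norm_indicator_le_norm_self _ _).trans ?_
  rw [Real.norm_eq_abs, abs_mul]
  gcongr

/-- Change of variables to normal coordinates. -/
theorem setIntegral_tube_eq (h : IsHypersurfacePatch F ψ U) (hw : IsSignedDist F γ w)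
    {C : Set (𝔼 n)} (hC : IsCompact C) (hCU : C ⊆ U) (hf : Measurable f) {B δ : ℝ}
    (hB : ∀ x, Metric.infDist x F < δ → |f x| ≤ B) {A : Set ℝ} (hA : MeasurableSet A)
    (hAδ : A ⊆ Ioo 0 (min δ 1)) :
    IntegrableOn (fun s => ∫ u in C, (normalIntegrand ψ γ w f (u, s) +
      normalIntegrand ψ γ w f (u, -s))) A ∧
    ∫ x in γ ⁻¹' (ψ '' C) ∩ w ⁻¹' A, f x = ∫ s in A, ∫ u in C,
      (normalIntegrand ψ γ w f (u, s) + normalIntegrand ψ γ w f (u, -s)) := by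
  set Φ := normalChart ψ with hΦdef
  set H := normalIntegrand ψ γ w f with hH
  have hΦ : Measurable Φ := measurable_normalChart h.contDiff
  have hHm : Measurable H := h.measurable_normalIntegrand hw hf
  obtain ⟨M, hM⟩ := h.exists_normalIntegrand_bound hC hCU hB γ w
  -- The coordinates whose foot is the nearest point chosen by `γ`. They map bijectively onto the
  -- tube piece without any uniform tube radius: `γ` recovers the foot, and the foot recovers `t`.
  let M₀ : Set (𝔼 n × ℝ) := {p | p.1 ∈ C ∧ γ (Φ p) = ψ p.1 ∧ w (Φ p) ∈ A}
  have hM₀ : MeasurableSet M₀ := by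
    refine MeasurableSet.inter (measurable_fst hC.measurableSet) (MeasurableSet.inter ?_
      ((hw.measurable.comp hΦ) hA))
    exact measurableSet_eq_fun (hw.measurable_nearest.comp hΦ)
      (h.contDiff.continuous.measurable.comp measurable_fst)
  have habs : ∀ p : 𝔼 n × ℝ, p.1 ∈ U → γ (Φ p) = ψ p.1 → |w (Φ p)| = |p.2| := by
    rintro ⟨u, t⟩ hu hp
    rw [hw.abs_eq, ← hw.dist_nearest, hp]
    exact dist_normalChart (h.immersion u hu) t
  have himg : (Φ ∘ (consEquiv n).symm) '' ((consEquiv n).symm ⁻¹' M₀) =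
      γ ⁻¹' (ψ '' C) ∩ w ⁻¹' A := by
    rw [image_comp, image_preimage_eq _ (consEquiv n).symm.surjective]
    ext x
    constructor
    · rintro ⟨p, ⟨h1, h2, h3⟩, rfl⟩
      exact ⟨⟨p.1, h1, h2.symm⟩, h3⟩
    · rintro ⟨⟨u, hu, hx⟩, hxA⟩
      obtain ⟨t, ht, -⟩ := h.exists_eq_normalChart (hCU hu) (x := x) (by
        rw [hx]; exact hw.dist_nearest x)
      refine ⟨(u, t), ⟨hu, ?_, ?_⟩, ht.symm⟩
      · rw [hΦdef, ← ht, hx]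
      · rw [hΦdef, ← ht]; exact hxA
  have hinj : InjOn (Φ ∘ (consEquiv n).symm) ((consEquiv n).symm ⁻¹' M₀) := by
    refine InjOn.comp (t := M₀) ?_ (consEquiv n).symm.injective.injOn (mapsTo_preimage _ _)
    rintro ⟨u, t⟩ ⟨hu, hu2, -⟩ ⟨v, s⟩ ⟨hv, hv2, -⟩ he
    have huv : u = v := by
      refine h.injOn (hCU hu) (hCU hv) ?_
      rw [← show γ (Φ (u, t)) = ψ u from hu2, he]
      exact hv2
    subst huv
    have h1 : t • unitNormal (fderiv ℝ ψ u) = s • unitNormal (fderiv ℝ ψ u) :=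
      add_left_cancel he
    have h0 : unitNormal (fderiv ℝ ψ u) ≠ 0 := by
      rw [← norm_ne_zero_iff, norm_unitNormal (h.immersion u (hCU hu))]
      exact one_ne_zero
    rw [smul_left_injective ℝ h0 h1]
  have hderiv : ∀ z ∈ (consEquiv n).symm ⁻¹' M₀, HasFDerivWithinAt (Φ ∘ (consEquiv n).symm)
      ((fderiv ℝ Φ ((consEquiv n).symm z)).comp
        ((consEquiv n).symm : 𝔼 (n + 1) →L[ℝ] 𝔼 n × ℝ)) ((consEquiv n).symm ⁻¹' M₀) z := by
    intro z hz
    have h1 := ((contDiffAt_normalChart h.contDiff (p := (consEquiv n).symm z)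
      (h.immersion _ (hCU hz.1))).differentiableAt one_ne_zero).hasFDerivAt
    exact (h1.comp z (consEquiv n).symm.hasFDerivAt).hasFDerivWithinAt
  have hmp : MeasurePreserving ((consEquiv n).symm) volume volume := by
    let e : (𝔼 n × ℝ) ≃ᵐ 𝔼 (n + 1) := (consEquiv n).toHomeomorph.toMeasurableEquiv
    exact MeasurePreserving.symm e (measurePreserving_consEquiv n)
  have hemb : MeasurableEmbedding (consEquiv n).symm :=
    (consEquiv n).symm.toHomeomorph.measurableEmbedding
  have hcv : ∫ x in γ ⁻¹' (ψ '' C) ∩ w ⁻¹' A, f x =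
      ∫ p in M₀, normalJacobian ψ p * f (Φ p) := by
    rw [← himg, integral_image_eq_integral_abs_det_fderiv_smul volume (hemb.measurable hM₀) hderiv hinj,
      ← hmp.setIntegral_preimage_emb hemb]
    rfl
  have hA0 : ∀ s ∈ A, 0 < s ∧ |s| < min δ 1 := fun s hs =>
    ⟨(hAδ hs).1, by rw [abs_of_pos (hAδ hs).1]; exact (hAδ hs).2⟩
  -- The orientation of the unit normal is arbitrary, so a positive value of `w` may occur at either
  -- sign of `t`. Both are kept, and `t < 0` is later reflected onto `A`.
  have hM₀sub : ∀ p ∈ M₀, p ∈ C ×ˢ A ∨ p ∈ C ×ˢ (-A) := by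
    rintro ⟨u, t⟩ ⟨hu, hp, hwA⟩
    have h1 := habs (u, t) (hCU hu) hp
    rw [abs_of_pos (hA0 _ hwA).1] at h1
    rcases abs_choice t with h2 | h2
    · left; exact ⟨hu, by rw [← h2, ← h1]; exact hwA⟩
    · right; refine ⟨hu, ?_⟩
      rw [Set.mem_neg, ← h2, ← h1]; exact hwA
  have hind : ∀ p, indicator M₀ (fun p => normalJacobian ψ p * f (Φ p)) p =
      indicator (C ×ˢ A) H p + indicator (C ×ˢ (-A)) H p := by
    intro p
    by_cases hp1 : p ∈ C ×ˢ A
    · have hp2 : p ∉ C ×ˢ (-A) := fun h' => by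
        have := (hA0 _ h'.2).1
        linarith [(hA0 _ hp1.2).1]
      rw [indicator_of_mem hp1, indicator_of_notMem hp2, add_zero, hH, normalIntegrand]
      by_cases hg : γ (Φ p) = ψ p.1 ∧ 0 < w (Φ p)
      · rw [indicator_of_mem (show p ∈ {p | γ (Φ p) = ψ p.1 ∧ 0 < w (Φ p)} from hg),
          indicator_of_mem]
        refine ⟨hp1.1, hg.1, ?_⟩
        have h1 := habs p (hCU hp1.1) hg.1
        rw [abs_of_pos hg.2, abs_of_pos (hA0 _ hp1.2).1] at h1
        rw [h1]; exact hp1.2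
      · rw [indicator_of_notMem (show p ∉ {p | γ (Φ p) = ψ p.1 ∧ 0 < w (Φ p)} from hg),
          indicator_of_notMem]
        exact fun h' => hg ⟨h'.2.1, (hA0 _ h'.2.2).1⟩
    · by_cases hp2 : p ∈ C ×ˢ (-A)
      · rw [indicator_of_mem hp2, indicator_of_notMem hp1, zero_add, hH, normalIntegrand]
        by_cases hg : γ (Φ p) = ψ p.1 ∧ 0 < w (Φ p)
        · rw [indicator_of_mem (show p ∈ {p | γ (Φ p) = ψ p.1 ∧ 0 < w (Φ p)} from hg),
            indicator_of_mem]
          refine ⟨hp2.1, hg.1, ?_⟩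
          have h1 := habs p (hCU hp2.1) hg.1
          rw [abs_of_pos hg.2, ← abs_neg, abs_of_pos (hA0 _ hp2.2).1] at h1
          rw [h1]; exact hp2.2
        · rw [indicator_of_notMem (show p ∉ {p | γ (Φ p) = ψ p.1 ∧ 0 < w (Φ p)} from hg),
            indicator_of_notMem]
          exact fun h' => hg ⟨h'.2.1, (hA0 _ h'.2.2).1⟩
      · rw [indicator_of_notMem hp1, indicator_of_notMem hp2, add_zero, indicator_of_notMem]
        exact fun h' => (hM₀sub p h').elim hp1 hp2
  have hCfin : volume C ≠ ∞ := hC.measure_lt_top.ne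
  have hAfin : volume A ≠ ∞ := ((measure_mono hAδ).trans_lt measure_Ioo_lt_top).ne
  have hCA : MeasurableSet (C ×ˢ A) := hC.measurableSet.prod hA
  have hCA' : MeasurableSet (C ×ˢ (-A)) := hC.measurableSet.prod hA.neg
  have hvol : (volume.prod volume) (C ×ˢ A) < ∞ := by
    rw [Measure.prod_prod]; exact ENNReal.mul_lt_top hCfin.lt_top hAfin.lt_top
  have hint1 : IntegrableOn H (C ×ˢ A) (volume.prod volume) := by
    refine IntegrableOn.of_bound hvol hHm.aestronglyMeasurable M ?_
    refine (ae_restrict_iff' hCA).2 (ae_of_all _ ?_)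
    rintro ⟨u, t⟩ ⟨hu, ht⟩
    exact hM u hu t (hA0 t ht).2
  let ne : 𝔼 n × ℝ → 𝔼 n × ℝ := Prod.map id Neg.neg
  have hint2 : IntegrableOn (fun p => H (ne p)) (C ×ˢ A) (volume.prod volume) := by
    refine IntegrableOn.of_bound hvol
      (hHm.comp (measurable_id.prodMap measurable_neg)).aestronglyMeasurable M ?_
    refine (ae_restrict_iff' hCA).2 (ae_of_all _ ?_)
    rintro ⟨u, t⟩ ⟨hu, ht⟩
    exact hM u hu (-t) (by rw [abs_neg]; exact (hA0 t ht).2)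
  have hnemp : MeasurePreserving ne (volume.prod volume) (volume.prod volume) :=
    (MeasurePreserving.id volume).prod (Measure.measurePreserving_neg volume)
  have hneemb : MeasurableEmbedding ne :=
    MeasurableEmbedding.id.prodMap (MeasurableEquiv.neg ℝ).measurableEmbedding
  have hpre : ne ⁻¹' (C ×ˢ (-A)) = C ×ˢ A := by
    ext ⟨u, t⟩; simp [ne]
  have hint3 : IntegrableOn H (C ×ˢ (-A)) (volume.prod volume) := by
    rw [← hnemp.integrableOn_comp_preimage hneemb, hpre]
    exact hint2
  have hint12 : IntegrableOn (fun p : 𝔼 n × ℝ => H p + H (ne p)) (C ×ˢ A) (volume.prod volume) :=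
    hint1.add hint2
  rw [IntegrableOn, ← Measure.prod_restrict] at hint12
  refine ⟨hint12.integral_prod_right, ?_⟩
  calc ∫ x in γ ⁻¹' (ψ '' C) ∩ w ⁻¹' A, f x
      = ∫ p in M₀, normalJacobian ψ p * f (Φ p) := hcv
    _ = (∫ p in C ×ˢ A, H p ∂(volume.prod volume)) +
          ∫ p in C ×ˢ (-A), H p ∂(volume.prod volume) := by
        rw [← integral_indicator hM₀]
        simp only [hind]
        rw [← integral_indicator hCA, ← integral_indicator hCA']
        exact integral_add ((integrable_indicator_iff hCA).2 hint1)
          ((integrable_indicator_iff hCA').2 hint3)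
    _ = (∫ p in C ×ˢ A, H p ∂(volume.prod volume)) +
          ∫ p in C ×ˢ A, H (ne p) ∂(volume.prod volume) := by
        rw [← hnemp.setIntegral_preimage_emb hneemb H (C ×ˢ (-A)), hpre]
    _ = ∫ p in C ×ˢ A, (H p + H (ne p)) ∂(volume.prod volume) := (integral_add hint1 hint2).symm
    _ = _ := by
        rw [← Measure.prod_restrict, integral_prod_symm _ hint12]
        rfl

/-- The slices of the tube integral converge. -/
theorem tendsto_slice (h : IsHypersurfacePatch F ψ U) (hw : IsSignedDist F γ w)
    {C : Set (𝔼 n)} (hC : IsCompact C) (hCU : C ⊆ U) (hf : Measurable f) {B δ : ℝ} (hδ : 0 < δ)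
    (hB : ∀ x, Metric.infDist x F < δ → |f x| ≤ B)
    (hlim : ∀ᵐ u ∂volume.restrict U, Tendsto (fun t => f (normalChart ψ (u, t))) (𝓝 0)
      (𝓝 (f (ψ u))))
    (hside : ∀ u ∈ U, ∀ᶠ t in 𝓝[>] (0 : ℝ),
      0 < w (normalChart ψ (u, t)) ↔ ¬ 0 < w (normalChart ψ (u, -t))) :
    Tendsto (fun s => ∫ u in C, (normalIntegrand ψ γ w f (u, s) + normalIntegrand ψ γ w f (u, -s)))
      (𝓝[>] 0) (𝓝 (∫ u in C, areaFactor ψ u * f (ψ u))) := by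
  have hHm := h.measurable_normalIntegrand hw hf
  obtain ⟨M, hM⟩ := h.exists_normalIntegrand_bound hC hCU hB γ w
  have hfin : IsFiniteMeasure (volume.restrict C) := ⟨by
    rw [Measure.restrict_apply_univ]; exact hC.measure_lt_top⟩
  refine tendsto_integral_filter_of_dominated_convergence (fun _ => M + M) ?_ ?_
    (integrable_const _) ?_
  · refine Eventually.of_forall fun s => Measurable.aestronglyMeasurable ?_
    exact (hHm.comp (measurable_id.prodMk measurable_const)).add
      (hHm.comp (measurable_id.prodMk measurable_const))
  · filter_upwards [Ioo_mem_nhdsGT (show (0 : ℝ) < min δ 1 from lt_min hδ one_pos)] with s hs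
    refine (ae_restrict_iff' hC.measurableSet).2 (ae_of_all _ fun u hu => ?_)
    have h1 : |s| < min δ 1 := by rw [abs_of_pos hs.1]; exact hs.2
    refine (norm_add_le _ _).trans (add_le_add (hM u hu s h1) (hM u hu (-s) ?_))
    rwa [abs_neg]
  · have hlimC := ae_restrict_of_ae_restrict_of_subset hCU hlim
    filter_upwards [hlimC, ae_restrict_mem hC.measurableSet] with u hu huC
    have huU := hCU huC
    set k : ℝ → ℝ := fun t => normalJacobian ψ (u, t) * f (normalChart ψ (u, t)) with hk
    have hkt : Tendsto k (𝓝 0) (𝓝 (areaFactor ψ u * f (ψ u))) := by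
      refine Tendsto.mul ?_ hu
      rw [← normalJacobian_zero h.contDiff (h.immersion u huU)]
      have h1 := continuousAt_normalJacobian h.contDiff (p := (u, 0)) (h.immersion u huU)
      exact Tendsto.comp (y := 𝓝 (u, (0 : ℝ))) h1 ((Continuous.prodMk_right u).tendsto 0)
    have hk1 : Tendsto k (𝓝[>] 0) (𝓝 (areaFactor ψ u * f (ψ u))) := hkt.mono_left nhdsWithin_le_nhds
    have hneg : Tendsto (fun t : ℝ => -t) (𝓝 0) (𝓝 0) := by
      simpa using (continuous_neg (G := ℝ)).tendsto 0
    have hk2 : Tendsto (fun t => k (-t)) (𝓝[>] 0) (𝓝 (areaFactor ψ u * f (ψ u))) :=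
      (hkt.comp hneg).mono_left nhdsWithin_le_nhds
    have hnear : ∀ᶠ t in 𝓝 (0 : ℝ), γ (normalChart ψ (u, t)) = ψ u := by
      filter_upwards [h.eventually_nearest_eq huU] with t ht
      exact ht _ (hw.nearest_mem _) (hw.dist_nearest _)
    have hn1 := hnear.filter_mono (nhdsWithin_le_nhds (s := Ioi 0))
    have hn2 := (hneg.eventually hnear).filter_mono (nhdsWithin_le_nhds (s := Ioi 0))
    -- For small `s` exactly one of the two terms survives. Which one is irrelevant, since `k s` and
    -- `k (-s)` have the same limit.
    have hdich : ∀ᶠ s in 𝓝[>] (0 : ℝ),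
        normalIntegrand ψ γ w f (u, s) + normalIntegrand ψ γ w f (u, -s) = k s ∨
        normalIntegrand ψ γ w f (u, s) + normalIntegrand ψ γ w f (u, -s) = k (-s) := by
      filter_upwards [hn1, hn2, hside u huU] with s hs1 hs2 hs3
      by_cases hp : 0 < w (normalChart ψ (u, s))
      · left
        have hq := hs3.1 hp
        rw [normalIntegrand, normalIntegrand, indicator_of_mem, indicator_of_notMem, add_zero]
        · exact fun h' => hq h'.2
        · exact ⟨hs1, hp⟩
      · right
        have hq : 0 < w (normalChart ψ (u, -s)) := by
          by_contra hc; exact hp (hs3.2 hc)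
        rw [normalIntegrand, normalIntegrand, indicator_of_notMem, indicator_of_mem, zero_add]
        · exact ⟨hs2, hq⟩
        · exact fun h' => hp h'.2
    rw [Metric.tendsto_nhds] at hk1 hk2 ⊢
    intro ε hε
    filter_upwards [hk1 ε hε, hk2 ε hε, hdich] with s h1 h2 h3
    rcases h3 with h3 | h3 <;> rw [h3] <;> assumption

/-- The tube integral over a compact piece of the patch is asymptotic to the surface integral. -/
theorem exists_tube_estimate (h : IsHypersurfacePatch F ψ U) (hw : IsSignedDist F γ w)
    {C : Set (𝔼 n)} (hC : IsCompact C) (hCU : C ⊆ U) (hf : Measurable f) {B δ : ℝ} (hδ : 0 < δ)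
    (hB : ∀ x, Metric.infDist x F < δ → |f x| ≤ B)
    (hlim : ∀ᵐ u ∂volume.restrict U, Tendsto (fun t => f (normalChart ψ (u, t))) (𝓝 0)
      (𝓝 (f (ψ u))))
    (hside : ∀ u ∈ U, ∀ᶠ t in 𝓝[>] (0 : ℝ),
      0 < w (normalChart ψ (u, t)) ↔ ¬ 0 < w (normalChart ψ (u, -t))) {ε : ℝ} (hε : 0 < ε) :
    ∃ δ' > 0, ∀ A : Set ℝ, MeasurableSet A → A ⊆ Ioo 0 δ' →
      |(∫ x in γ ⁻¹' (ψ '' C) ∩ w ⁻¹' A, f x) -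
        volume.real A * ∫ u in C, areaFactor ψ u * f (ψ u)| ≤ ε * volume.real A := by
  have ht := h.tendsto_slice hw hC hCU hf hδ hB hlim hside
  rw [Metric.tendsto_nhds] at ht
  obtain ⟨a, ha, haε⟩ := mem_nhdsGT_iff_exists_Ioo_subset.1 (ht ε hε)
  have ha0 : (0 : ℝ) < a := ha
  refine ⟨min a (min δ 1), by positivity, fun A hA hAδ => ?_⟩
  have hA1 : A ⊆ Ioo 0 (min δ 1) := hAδ.trans (Ioo_subset_Ioo_right (min_le_right _ _))
  have hA2 : A ⊆ Ioo 0 a := hAδ.trans (Ioo_subset_Ioo_right (min_le_left _ _))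
  obtain ⟨hint, heq⟩ := h.setIntegral_tube_eq hw hC hCU hf hB hA hA1
  have hAfin : volume A < ∞ := (measure_mono hA2).trans_lt measure_Ioo_lt_top
  have hc : volume.real A * ∫ u in C, areaFactor ψ u * f (ψ u) =
      ∫ s in A, ∫ u in C, areaFactor ψ u * f (ψ u) := by
    rw [setIntegral_const, smul_eq_mul]
  rw [heq, hc, ← integral_sub hint (integrableOn_const hAfin.ne)]
  rw [← Real.norm_eq_abs]
  refine norm_setIntegral_le_of_norm_le_const hAfin fun s hs => ?_
  have := haε (hA2 hs)
  rw [mem_ofPred_eq, Real.dist_eq] at this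
  exact this.le

end IsHypersurfacePatch

/-! ### Surface integrals and tube integrals over piecewise smooth compact hypersurfaces -/

/-- `F` is the union of finitely many compact `C²` patches with null edges. -/
structure IsPatchDecomposition {n N : ℕ} (F : Set (𝔼 (n + 1))) (K : Fin N → Set (𝔼 n))
    (ψ : Fin N → 𝔼 n → 𝔼 (n + 1)) : Prop where
  isCompact : ∀ i, IsCompact (K i)
  frontier_null : ∀ i, volume (frontier (K i)) = 0
  patch : ∀ i, IsHypersurfacePatch F (ψ i) (interior (K i))
  disjoint : ∀ i j, i ≠ j → Disjoint (ψ i '' interior (K i)) (ψ j '' interior (K j))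
  eq_iUnion : F = ⋃ i, ψ i '' K i

theorem HasPiecewiseSmoothBoundary.exists_isPatchDecomposition {n : ℕ} {Ω : Set (𝔼 (n + 1))}
    (h : HasPiecewiseSmoothBoundary Ω) :
    ∃ (N : ℕ) (K : Fin N → Set (𝔼 n)) (ψ : Fin N → 𝔼 n → 𝔼 (n + 1)),
      IsPatchDecomposition (frontier Ω) K ψ := by
  obtain ⟨-, N, K, ψ, hK, hψ, hint, hedge, hF⟩ := h
  exact ⟨N, K, ψ, fun i => (hK i).1, fun i => (hK i).2,
    isHypersurfacePatch_of_decomposition (fun i => (hK i).1) hψ hint hedge hF, hint, hF⟩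

theorem IsHypersurfacePatch.contDiff_one {n : ℕ} {F : Set (𝔼 (n + 1))} {ψ : 𝔼 n → 𝔼 (n + 1)}
    {U : Set (𝔼 n)} (h : IsHypersurfacePatch F ψ U) : ContDiff ℝ 1 ψ :=
  h.contDiff.of_le (by norm_num)

theorem IsHypersurfacePatch.measurableSet_image {n : ℕ} {F : Set (𝔼 (n + 1))}
    {ψ : 𝔼 n → 𝔼 (n + 1)} {U : Set (𝔼 n)} (h : IsHypersurfacePatch F ψ U) :
    MeasurableSet (ψ '' U) :=
  h.isOpen.measurableSet.image_of_continuousOn_injOn h.contDiff.continuous.continuousOn h.injOn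

theorem IsHypersurfacePatch.setIntegral_image {n : ℕ} {F : Set (𝔼 (n + 1))} {ψ : 𝔼 n → 𝔼 (n + 1)}
    {U : Set (𝔼 n)} (h : IsHypersurfacePatch F ψ U) {f : 𝔼 (n + 1) → ℝ} (hf : Measurable f) :
    ∫ y in ψ '' U, f y ∂μHE[n] = ∫ u in U, areaFactor ψ u * f (ψ u) := by
  have hJ : Measurable (areaFactor ψ) := (continuous_areaFactor h.contDiff_one).measurable
  rw [euclideanHausdorffMeasure_restrict_image h.contDiff_one h.isOpen.measurableSet h.injOn
    h.immersion, integral_map h.contDiff.continuous.aemeasurable hf.aestronglyMeasurable,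
    integral_withDensity_eq_integral_toReal_smul hJ.ennreal_ofReal
      (ae_of_all _ fun _ => ENNReal.ofReal_lt_top)]
  refine integral_congr_ae (ae_of_all _ fun u => ?_)
  simp [areaFactor]

namespace IsPatchDecomposition

variable {n N : ℕ} {F : Set (𝔼 (n + 1))} {K : Fin N → Set (𝔼 n)} {ψ : Fin N → 𝔼 n → 𝔼 (n + 1)}

theorem isCompact_surface (h : IsPatchDecomposition F K ψ) : IsCompact F := by
  rw [h.eq_iUnion]
  exact isCompact_iUnion fun i => (h.isCompact i).image (h.patch i).contDiff.continuous

theorem smooth_subset (h : IsPatchDecomposition F K ψ) : ⋃ i, ψ i '' interior (K i) ⊆ F :=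
  iUnion_subset fun i => (h.patch i).image_subset

/-- The difference consists of images of edges, which are null because a Lipschitz map sends
Lebesgue null sets to null sets of surface measure. -/
theorem ae_eq_smooth (h : IsPatchDecomposition F K ψ) :
    F =ᵐ[μHE[n]] (⋃ i, ψ i '' interior (K i) : Set (𝔼 (n + 1))) := by
  refine Filter.EventuallyLE.antisymm ?_ (LE.le.eventuallyLE h.smooth_subset)
  rw [ae_le_set]
  refine measure_mono_null (t := ⋃ i, ψ i '' frontier (K i)) ?_ (measure_iUnion_null fun i => ?_)
  · rintro y ⟨hy, hy'⟩
    rw [h.eq_iUnion, mem_iUnion] at hy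
    obtain ⟨i, u, hu, rfl⟩ := hy
    refine mem_iUnion.2 ⟨i, u, ⟨subset_closure hu, fun hui => hy' ?_⟩, rfl⟩
    exact mem_iUnion.2 ⟨i, u, hui, rfl⟩
  · exact euclideanHausdorffMeasure_image_null (h.patch i).contDiff_one
      ((h.isCompact i).isBounded.subset (h.isCompact i).isClosed.frontier_subset)
      (h.frontier_null i)

theorem exists_areaFactor_bound (h : IsPatchDecomposition F K ψ) :
    ∃ M : ℝ, 0 ≤ M ∧ ∀ i, ∀ u ∈ K i, areaFactor (ψ i) u ≤ M := by
  have h1 (i) : ∃ M : ℝ, ∀ u ∈ K i, ‖areaFactor (ψ i) u‖ ≤ M :=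
    (h.isCompact i).exists_bound_of_continuousOn
      (continuous_areaFactor (h.patch i).contDiff_one).continuousOn
  choose M hM using h1
  refine ⟨∑ i, |M i|, Finset.sum_nonneg fun i _ => abs_nonneg _, fun i u hu => ?_⟩
  calc areaFactor (ψ i) u ≤ |M i| := (le_abs_self _).trans ((hM i u hu).trans (le_abs_self _))
    _ ≤ _ := Finset.single_le_sum (f := fun i => |M i|) (fun i _ => abs_nonneg _)
        (Finset.mem_univ i)

theorem volume_interior_lt_top (h : IsPatchDecomposition F K ψ) (i : Fin N) :
    volume (interior (K i)) < ∞ :=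
  (measure_mono interior_subset).trans_lt (h.isCompact i).measure_lt_top

theorem measure_surface_lt_top (h : IsPatchDecomposition F K ψ) : μHE[n] F < ∞ := by
  obtain ⟨M, -, hM⟩ := h.exists_areaFactor_bound
  rw [measure_congr h.ae_eq_smooth]
  refine (measure_iUnion_le _).trans_lt ?_
  rw [tsum_fintype]
  refine ENNReal.sum_lt_top.2 fun i _ => ?_
  rw [area_formula (h.patch i).contDiff_one (h.patch i).injOn (h.patch i).immersion le_rfl
    isOpen_interior.measurableSet]
  calc ∫⁻ v in interior (K i), ENNReal.ofReal (areaFactor (ψ i) v)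
      ≤ ∫⁻ v in interior (K i), ENNReal.ofReal M :=
        setLIntegral_mono' isOpen_interior.measurableSet fun v hv =>
          ENNReal.ofReal_le_ofReal (hM i v (interior_subset hv))
    _ < ∞ := by
        rw [setLIntegral_const]
        exact ENNReal.mul_lt_top ENNReal.ofReal_lt_top (h.volume_interior_lt_top i)

theorem integrableOn_of_bounded (h : IsPatchDecomposition F K ψ) {f : 𝔼 (n + 1) → ℝ}
    (hf : Measurable f) {B : ℝ} (hB : ∀ y ∈ F, |f y| ≤ B) : IntegrableOn f F μHE[n] := by
  refine IntegrableOn.of_bound h.measure_surface_lt_top hf.aestronglyMeasurable B ?_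
  exact (ae_restrict_iff' h.isCompact_surface.measurableSet).2 (ae_of_all _ hB)

theorem setIntegral_eq_sum (h : IsPatchDecomposition F K ψ) {f : 𝔼 (n + 1) → ℝ}
    (hf : Measurable f) {B : ℝ} (hB : ∀ y ∈ F, |f y| ≤ B) :
    ∫ y in F, f y ∂μHE[n] = ∑ i, ∫ u in interior (K i), areaFactor (ψ i) u * f (ψ i u) := by
  rw [setIntegral_congr_set h.ae_eq_smooth, integral_iUnion_fintype
    (fun i => (h.patch i).measurableSet_image) (fun i j hij => h.disjoint i j hij)
    (fun i => (h.integrableOn_of_bounded hf hB).mono_set (h.patch i).image_subset)]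
  exact Finset.sum_congr rfl fun i _ => (h.patch i).setIntegral_image hf

/-- Surface measure on a patch is the image of `areaFactor` times Lebesgue measure. Positivity of
this factor makes null sets pull back to null sets. -/
theorem ae_patch (h : IsPatchDecomposition F K ψ) {P : 𝔼 (n + 1) → Prop}
    (hP : ∀ᵐ y ∂(μHE[n]).restrict F, P y) (i : Fin N) :
    ∀ᵐ u ∂volume.restrict (interior (K i)), P (ψ i u) := by
  have hp := h.patch i
  have h1 := ae_restrict_of_ae_restrict_of_subset hp.image_subset hP
  rw [euclideanHausdorffMeasure_restrict_image hp.contDiff_one hp.isOpen.measurableSet hp.injOn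
    hp.immersion] at h1
  have h2 := ae_of_ae_map hp.contDiff.continuous.aemeasurable h1
  rw [ae_withDensity_iff
    (continuous_areaFactor hp.contDiff_one).measurable.ennreal_ofReal] at h2
  filter_upwards [h2, ae_restrict_mem hp.isOpen.measurableSet] with u hu huU
  refine hu ?_
  rw [ne_eq, ENNReal.ofReal_eq_zero, not_le]
  exact areaFactor_pos (hp.immersion u huU)

/-- The integral of `f` over the set of points at signed distance in `A` from the surface is
asymptotic to the length of `A` times the surface integral of `f`. -/
theorem exists_tube_estimate (h : IsPatchDecomposition F K ψ) {γ : 𝔼 (n + 1) → 𝔼 (n + 1)}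
    {w f : 𝔼 (n + 1) → ℝ} (hw : IsSignedDist F γ w) (hf : Measurable f) {B δ : ℝ} (hδ : 0 < δ)
    (hB : ∀ x, Metric.infDist x F < δ → |f x| ≤ B)
    (hlim : ∀ i, ∀ᵐ u ∂volume.restrict (interior (K i)),
      Tendsto (fun t => f (normalChart (ψ i) (u, t))) (𝓝 0) (𝓝 (f (ψ i u))))
    (hside : ∀ i, ∀ u ∈ interior (K i), ∀ᶠ t in 𝓝[>] (0 : ℝ),
      0 < w (normalChart (ψ i) (u, t)) ↔ ¬ 0 < w (normalChart (ψ i) (u, -t)))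
    {ε : ℝ} (hε : 0 < ε) :
    ∃ δ' > 0, ∀ A : Set ℝ, MeasurableSet A → A ⊆ Ioo 0 δ' →
      |(∫ x in w ⁻¹' A, f x) - volume.real A * ∫ y in F, f y ∂μHE[n]| ≤ ε * volume.real A := by
  have hne : F.Nonempty := ⟨γ 0, hw.nearest_mem 0⟩
  have hBF : ∀ y ∈ F, |f y| ≤ B := fun y hy => hB y (by rwa [Metric.infDist_zero_of_mem hy])
  have hB0 : 0 ≤ B := (abs_nonneg _).trans (hBF _ hne.some_mem)
  obtain ⟨M, hM0, hM⟩ := h.exists_areaFactor_bound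
  -- Per patch there are three errors: `η` from the tube over the core, `B * η` from points whose
  -- foot is outside the cores, and `M * B * η` from the surface integral outside the core. `N + 1`
  -- keeps the denominator positive.
  set η : ℝ := ε / ((N + 1) * (1 + B + M * B)) with hη
  have hη0 : 0 < η := by positivity
  have hηε : N * (η + B * η + M * B * η) ≤ ε := by
    have h1 : (N + 1) * (1 + B + M * B) * η = ε := by rw [hη]; field_simp
    have h2 : 0 ≤ (1 + B + M * B) * η := by positivity
    nlinarith
  choose C Q hC hQK hCK hKCQ hQη δ₁ hδ₁ hshell using fun i =>
    exists_compact_patch_core (h.patch i).contDiff_one (h.isCompact i) (h.frontier_null i) hη0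
  choose δ₂ hδ₂ hcore using fun i =>
    (h.patch i).exists_tube_estimate hw (hC i) (hCK i) hf hδ hB (hlim i) (hside i) hη0
  obtain ⟨δ', hδ', hδ'1⟩ : ∃ δ' > 0, ∀ i, δ' ≤ min δ (min (δ₁ i) (δ₂ i)) := by
    have hpos : ∀ i, 0 < min δ (min (δ₁ i) (δ₂ i)) := fun i =>
      lt_min hδ (lt_min (hδ₁ i) (hδ₂ i))
    obtain ⟨δ', h1, h2⟩ := ((eventually_all.2 fun i =>
      (Ioo_mem_nhdsGT (hpos i) : Ioo 0 _ ∈ 𝓝[>] (0 : ℝ))).and self_mem_nhdsWithin).exists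
    exact ⟨δ', h2, fun i => (h1 i).2.le⟩
  refine ⟨min δ δ', lt_min hδ hδ', fun A hA hAδ => ?_⟩
  have hAsub (i) : A ⊆ Ioo 0 (min (δ₁ i) (δ₂ i)) := hAδ.trans (Ioo_subset_Ioo_right
    ((min_le_right _ _).trans ((hδ'1 i).trans (min_le_right _ _))))
  have hAδ0 : A ⊆ Ioo 0 δ := hAδ.trans (Ioo_subset_Ioo_right (min_le_left _ _))
  have hAfin : volume A < ∞ := (measure_mono hAδ0).trans_lt measure_Ioo_lt_top
  have hwA : MeasurableSet (w ⁻¹' A) := hw.measurable hA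
  have hfwA : ∀ x ∈ w ⁻¹' A, |f x| ≤ B := fun x hx => hB x (by
    rw [← hw.abs_eq, abs_of_pos (hAδ0 hx).1]; exact (hAδ0 hx).2)
  have hwAfin : volume (w ⁻¹' A) < ∞ := by
    refine (measure_mono ?_).trans_lt
      (h.isCompact_surface.isBounded.cthickening (δ := δ)).measure_lt_top
    intro x hx
    refine Metric.mem_cthickening_of_dist_le x (γ x) δ F (hw.nearest_mem x) ?_
    rw [hw.dist_nearest, ← hw.abs_eq, abs_of_pos (hAδ0 hx).1]
    exact (hAδ0 hx).2.le
  have hfint : IntegrableOn f (w ⁻¹' A) :=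
    IntegrableOn.of_bound hwAfin hf.aestronglyMeasurable B
      ((ae_restrict_iff' hwA).2 (ae_of_all _ hfwA))
  -- Points are sorted by the core containing the nearest point chosen by `γ`. The smooth parts are
  -- disjoint, hence so are these sets.
  set T : Fin N → Set (𝔼 (n + 1)) := fun i => γ ⁻¹' (ψ i '' C i) ∩ w ⁻¹' A with hT
  have hTm (i) : MeasurableSet (T i) :=
    (hw.measurable_nearest
      ((hC i).image (h.patch i).contDiff.continuous).isClosed.measurableSet).inter hwA
  have hTd : Pairwise (Function.onFun Disjoint T) := fun i j hij => by
    rw [Function.onFun, disjoint_left]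
    rintro x ⟨hx, -⟩ ⟨hx', -⟩
    exact disjoint_left.1 (h.disjoint i j hij) (image_mono (hCK i) hx) (image_mono (hCK j) hx')
  have hTsub : ⋃ i, T i ⊆ w ⁻¹' A := iUnion_subset fun i => inter_subset_right
  set R := w ⁻¹' A \ ⋃ i, T i with hR
  have hRm : MeasurableSet R := hwA.diff (MeasurableSet.iUnion hTm)
  have hRvol : volume R ≤ ENNReal.ofReal (N * η) * volume A := by
    -- A leftover point has its nearest point in some `ψ i '' Q i`. Its distance to `F` is then its
    -- distance to that small set, so the shell bound applies.
    have hsub : R ⊆ ⋃ i, {x | Metric.infDist x (ψ i '' Q i) ∈ A} := by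
      rintro x ⟨hxA, hxT⟩
      have hγ := hw.nearest_mem x
      rw [h.eq_iUnion, mem_iUnion] at hγ
      obtain ⟨i, u, hu, hux⟩ := hγ
      have huQ : u ∈ Q i := (hKCQ i hu).resolve_left fun huC =>
        hxT (mem_iUnion.2 ⟨i, ⟨⟨u, huC, hux⟩, hxA⟩⟩)
      refine mem_iUnion.2 ⟨i, ?_⟩
      have h1 : Metric.infDist x (ψ i '' Q i) = Metric.infDist x F := by
        apply le_antisymm
        · rw [← hw.dist_nearest, ← hux]
          exact Metric.infDist_le_dist_of_mem ⟨u, huQ, rfl⟩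
        · refine Metric.infDist_le_infDist_of_subset ?_ ⟨_, u, huQ, rfl⟩
          rw [h.eq_iUnion]
          exact (image_mono (hQK i)).trans (subset_iUnion (fun i => ψ i '' K i) i)
      rw [mem_ofPred_eq, h1, ← hw.abs_eq, abs_of_pos (hAδ0 hxA).1]
      exact hxA
    calc volume R ≤ ∑ i, volume {x | Metric.infDist x (ψ i '' Q i) ∈ A} := by
          refine (measure_mono hsub).trans ((measure_iUnion_le _).trans_eq ?_)
          rw [tsum_fintype]
      _ ≤ ∑ _i : Fin N, ENNReal.ofReal η * volume A := Finset.sum_le_sum fun i _ =>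
          hshell i A hA ((hAsub i).trans (Ioo_subset_Ioo_right (min_le_left _ _)))
      _ = ENNReal.ofReal (N * η) * volume A := by
          rw [Finset.sum_const, Finset.card_univ, Fintype.card_fin, nsmul_eq_mul, ← mul_assoc,
            ENNReal.ofReal_mul (by positivity), ENNReal.ofReal_natCast]
  have hRreal : volume.real R ≤ N * η * volume.real A := by
    have := ENNReal.toReal_mono (ENNReal.mul_ne_top ENNReal.ofReal_ne_top hAfin.ne) hRvol
    rwa [ENNReal.toReal_mul, ENNReal.toReal_ofReal (by positivity)] at this
  have hRint : |∫ x in R, f x| ≤ B * (N * η * volume.real A) := by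
    rw [← Real.norm_eq_abs]
    refine (norm_setIntegral_le_of_norm_le_const
      ((measure_mono sdiff_subset).trans_lt hwAfin) fun x hx => ?_).trans
        (mul_le_mul_of_nonneg_left hRreal hB0)
    exact hfwA x hx.1
  have hsplit : ∫ x in w ⁻¹' A, f x = (∑ i, ∫ x in T i, f x) + ∫ x in R, f x := by
    rw [← integral_iUnion_fintype hTm hTd fun i => hfint.mono_set inter_subset_right,
      ← setIntegral_union disjoint_sdiff_right hRm (hfint.mono_set hTsub)
        (hfint.mono_set sdiff_subset), union_sdiff_cancel hTsub]
  have hpiece (i) : |(∫ u in interior (K i), areaFactor (ψ i) u * f (ψ i u)) -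
      ∫ u in C i, areaFactor (ψ i) u * f (ψ i u)| ≤ M * B * η := by
    have hbd : ∀ u ∈ interior (K i), ‖areaFactor (ψ i) u * f (ψ i u)‖ ≤ M * B := fun u hu => by
      rw [norm_mul, Real.norm_eq_abs, Real.norm_eq_abs,
        abs_of_nonneg (show 0 ≤ areaFactor (ψ i) u from norm_nonneg _)]
      exact mul_le_mul (hM i u (interior_subset hu)) (hBF _ ((h.patch i).image_subset ⟨u, hu, rfl⟩))
        (abs_nonneg _) hM0
    have hm : Measurable fun u => areaFactor (ψ i) u * f (ψ i u) :=
      (continuous_areaFactor (h.patch i).contDiff_one).measurable.mul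
        (hf.comp (h.patch i).contDiff.continuous.measurable)
    have hint : IntegrableOn (fun u => areaFactor (ψ i) u * f (ψ i u)) (interior (K i)) :=
      IntegrableOn.of_bound (h.volume_interior_lt_top i) hm.aestronglyMeasurable (M * B)
        ((ae_restrict_iff' isOpen_interior.measurableSet).2 (ae_of_all _ hbd))
    rw [← setIntegral_sdiff (hC i).measurableSet hint (hCK i), ← Real.norm_eq_abs]
    refine (norm_setIntegral_le_of_norm_le_const
      ((measure_mono sdiff_subset).trans_lt (h.volume_interior_lt_top i))
      fun u hu => hbd u hu.1).trans (mul_le_mul_of_nonneg_left ?_ (by positivity))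
    refine ENNReal.toReal_le_of_le_ofReal hη0.le ((measure_mono ?_).trans (hQη i))
    exact fun u hu => (hKCQ i (interior_subset hu.1)).resolve_left hu.2
  set a := volume.real A with ha
  have ha0 : 0 ≤ a := measureReal_nonneg
  rw [hsplit, h.setIntegral_eq_sum hf hBF, Finset.mul_sum]
  have hsum : |∑ i, ((∫ x in T i, f x) -
      a * ∫ u in interior (K i), areaFactor (ψ i) u * f (ψ i u))| ≤ N * (η * a + a * (M * B * η)) := by
    refine (Finset.abs_sum_le_sum_abs _ _).trans ?_
    refine (Finset.sum_le_card_nsmul _ _ (η * a + a * (M * B * η)) fun i _ => ?_).trans_eq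
      (by rw [Finset.card_univ, Fintype.card_fin, nsmul_eq_mul])
    have h1 := hcore i A hA ((hAsub i).trans (Ioo_subset_Ioo_right (min_le_right _ _)))
    have h2 := mul_le_mul_of_nonneg_left (hpiece i) ha0
    rw [← abs_of_nonneg ha0, ← abs_mul, abs_of_nonneg ha0, mul_sub] at h2
    rw [abs_le] at h1 h2 ⊢
    constructor <;> linarith [h1.1, h1.2, h2.1, h2.2]
  have hrw : (∑ i, ∫ x in T i, f x) + (∫ x in R, f x) -
      ∑ i, a * ∫ u in interior (K i), areaFactor (ψ i) u * f (ψ i u) =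
      ∑ i, ((∫ x in T i, f x) - a * ∫ u in interior (K i), areaFactor (ψ i) u * f (ψ i u)) +
        ∫ x in R, f x := by
    rw [Finset.sum_sub_distrib]; ring
  rw [hrw]
  calc _ ≤ N * (η * a + a * (M * B * η)) + B * (N * η * a) :=
        (abs_add_le _ _).trans (add_le_add hsum hRint)
    _ = N * (η + B * η + M * B * η) * a := by ring
    _ ≤ ε * a := by gcongr

end IsPatchDecomposition

/-! ### Essential limits from densities along a filter -/

/-- The set function `κ` has asymptotic density `T` with respect to length along the filter `l`. -/
def HasDensityAlong (κ : Set ℝ → ℝ) (l : Filter ℝ) (T : ℝ) : Prop :=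
  ∀ ε > 0, ∃ S ∈ l, MeasurableSet S ∧ volume S < ∞ ∧
    ∀ A ⊆ S, MeasurableSet A → |κ A - volume.real A * T| ≤ ε * volume.real A

theorem HasDensityAlong.congr {κ κ' : Set ℝ → ℝ} {l : Filter ℝ} {T : ℝ}
    (h : HasDensityAlong κ l T) {S₀ : Set ℝ} (hS₀ : S₀ ∈ l) (hm : MeasurableSet S₀)
    (heq : ∀ A ⊆ S₀, MeasurableSet A → κ' A = κ A) : HasDensityAlong κ' l T := by
  intro ε hε
  obtain ⟨S, hS, hSm, hSfin, hSA⟩ := h ε hε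
  refine ⟨S ∩ S₀, inter_mem hS hS₀, hSm.inter hm, (measure_mono inter_subset_left).trans_lt hSfin,
    fun A hA hAm => ?_⟩
  rw [heq A (hA.trans inter_subset_right) hAm]
  exact hSA A (hA.trans inter_subset_left) hAm

/-- The case in which the reference measure is length itself, as needed for the limit of the density
`fg`. -/
theorem hasDensityAlong_volume {l : Filter ℝ} (hl : volume.FiniteAtFilter l) :
    HasDensityAlong volume.real l 1 := by
  intro ε hε
  obtain ⟨S, hS, hSfin⟩ := hl
  refine ⟨toMeasurable volume S, mem_of_superset hS (subset_toMeasurable _ _),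
    measurableSet_toMeasurable _ _, by rwa [measure_toMeasurable], fun A _ _ => ?_⟩
  rw [mul_one, sub_self, abs_zero]
  positivity

/-- If `ν` has the positive density `L` along `l`, and `h ν` has the density `I`, then `h`
converges essentially to `I / L`. -/
theorem hasEssLimit_of_hasDensityAlong {ν : Measure ℝ} {h : ℝ → ℝ} {l : Filter ℝ} {L I : ℝ}
    (hν : ν.FiniteAtFilter l) (hl : (l ⊓ ae (volume : Measure ℝ)).NeBot) (hm : Measurable h)
    (hint : Integrable h ν) (hL : 0 < L) (hd : HasDensityAlong ν.real l L)
    (hI : HasDensityAlong (fun A => ∫ t in A, h t ∂ν) l I) : HasEssLimit ν h l (I / L) := by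
  obtain ⟨S₀', hS₀', hS₀'fin⟩ := hν
  set S₀ := toMeasurable ν S₀' with hS₀def
  have hS₀ : S₀ ∈ l := mem_of_superset hS₀' (subset_toMeasurable _ _)
  have hS₀fin : ν S₀ < ∞ := by rwa [hS₀def, measure_toMeasurable]
  have hS₀m : MeasurableSet S₀ := measurableSet_toMeasurable _ _
  constructor
  -- Since `L > 0`, a `ν`-null subset of `S` is Lebesgue null, so properness carries over from
  -- `volume` to `ν`.
  · refine hl.mono (le_inf inf_le_left fun N hN => ?_)
    obtain ⟨S, hS, hSm, hSfin, hSA⟩ := hd (L / 2) (by positivity)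
    set N₀ := toMeasurable ν Nᶜ with hN₀
    have hN₀0 : ν N₀ = 0 := by rw [hN₀, measure_toMeasurable]; exact hN
    have h1 := hSA (N₀ ∩ S) inter_subset_right ((measurableSet_toMeasurable _ _).inter hSm)
    have h2 : ν.real (N₀ ∩ S) = 0 := by
      rw [measureReal_def, measure_mono_null inter_subset_left hN₀0, ENNReal.toReal_zero]
    have h3 : volume.real (N₀ ∩ S) = 0 := by
      have h0 : 0 ≤ volume.real (N₀ ∩ S) := measureReal_nonneg
      rw [h2, zero_sub, abs_neg, abs_of_nonneg (by positivity)] at h1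
      nlinarith
    have h4 : volume (N₀ ∩ S) = 0 := (measureReal_eq_zero_iff
      ((measure_mono inter_subset_right).trans_lt hSfin).ne).1 h3
    have h5 : (N₀ ∩ S)ᶜ ∈ ae (volume : Measure ℝ) := by
      rw [mem_ae_iff, compl_compl]; exact h4
    filter_upwards [mem_inf_of_left hS, mem_inf_of_right h5] with t ht1 ht2
    by_contra hc
    exact ht2 ⟨subset_toMeasurable ν Nᶜ hc, ht1⟩
  · set c := I / L with hc
    have hcL : c * L = I := by rw [hc]; field_simp
    rw [Metric.tendsto_nhds]
    intro η hη
    -- Chosen so that `ε * (1 + |c| + η)` is strictly below `η * L`.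
    set ε := η * L / (2 * (1 + |c| + η)) with hε
    have hε0 : 0 < ε := by positivity
    have hεη : ε * (1 + |c| + η) = η * L / 2 := by rw [hε]; field_simp
    obtain ⟨S, hS, hSm, hSfin, hSA⟩ := hd ε hε0
    obtain ⟨S', hS', hSm', hSfin', hSA'⟩ := hI ε hε0
    -- The sign `σ` treats values too large and too small together. On the bad set, of length `x`
    -- and measure `y`, the deviation of `h` gives `y * η ≤ ε * (1 + |c|) * x`, while `y ≥ (L - ε) *
    -- x`. The choice of `ε` forces `x = 0`, hence `y = 0`.
    have key : ∀ σ : ℝ, |σ| = 1 → ν (S₀ ∩ (S ∩ S') ∩ {t | η ≤ σ * (h t - c)}) = 0 := by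
      intro σ hσ
      set A := S₀ ∩ (S ∩ S') ∩ {t | η ≤ σ * (h t - c)} with hA
      have hAm : MeasurableSet A := (hS₀m.inter (hSm.inter hSm')).inter
        (measurableSet_le measurable_const ((hm.sub_const c).const_mul σ))
      have hAν : ν A < ∞ := (measure_mono (inter_subset_left.trans inter_subset_left)).trans_lt hS₀fin
      have hAS : A ⊆ S := fun t ht => ht.1.2.1
      have hAS' : A ⊆ S' := fun t ht => ht.1.2.2
      have h1 := hSA A hAS hAm
      have h2 := hSA' A hAS' hAm
      set x := volume.real A with hx
      set y := ν.real A with hy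
      have hx0 : 0 ≤ x := measureReal_nonneg
      have hint1 : IntegrableOn (fun t => σ * (h t - c)) A ν :=
        (hint.integrableOn.sub (integrableOn_const hAν.ne)).const_mul σ
      have h3 : y * η ≤ ∫ t in A, σ * (h t - c) ∂ν :=
        setIntegral_ge_of_const_le hAm hAν.ne (fun t ht => ht.2) hint1
      have h4 : ∫ t in A, σ * (h t - c) ∂ν = σ * ((∫ t in A, h t ∂ν) - y * c) := by
        rw [integral_const_mul, integral_sub hint.integrableOn (integrableOn_const hAν.ne),
          setIntegral_const, smul_eq_mul]
      have h5 : y * η ≤ |(∫ t in A, h t ∂ν) - y * c| := by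
        rw [h4] at h3
        refine h3.trans ((le_abs_self _).trans_eq ?_)
        rw [abs_mul, hσ, one_mul]
      have h6 : |(∫ t in A, h t ∂ν) - y * c| ≤ ε * x + |c| * (ε * x) := by
        have e : (∫ t in A, h t ∂ν) - y * c =
            ((∫ t in A, h t ∂ν) - x * I) - c * (y - x * L) := by rw [← hcL]; ring
        rw [e]
        refine (abs_sub _ _).trans (add_le_add h2 ?_)
        rw [abs_mul]
        gcongr
      have h7 : x * L - ε * x ≤ y := by linarith [(abs_le.1 h1).1]
      have hx00 : x = 0 := by
        have h8 : (x * L - ε * x) * η ≤ ε * x + |c| * (ε * x) :=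
          (mul_le_mul_of_nonneg_right h7 hη.le).trans (h5.trans h6)
        have h9 : x * (η * L / 2) ≤ 0 := by
          have : x * (η * L) ≤ x * (ε * (1 + |c| + η)) := by linarith
          rw [hεη] at this
          linarith
        have : 0 < η * L / 2 := by positivity
        nlinarith
      have hy0 : y = 0 := by
        have h8 := (abs_le.1 h1).2
        rw [hx00] at h8
        have : 0 ≤ y := measureReal_nonneg
        linarith
      exact (measureReal_eq_zero_iff hAν.ne).1 hy0
    have k1 := key 1 abs_one
    have k2 := key (-1) (by rw [abs_neg, abs_one])
    have hae : {t | t ∈ S₀ ∩ (S ∩ S') → dist (h t) c < η} ∈ ae ν := by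
      rw [mem_ae_iff]
      refine measure_mono_null ?_ (measure_union_null k1 k2)
      intro t ht
      simp only [mem_compl_iff, mem_ofPred_eq, Classical.not_imp, not_lt] at ht
      obtain ⟨ht1, ht2⟩ := ht
      rw [Real.dist_eq] at ht2
      rcases abs_choice (h t - c) with h' | h'
      · exact Or.inl ⟨ht1, by rw [mem_ofPred_eq, one_mul, ← h']; exact ht2⟩
      · exact Or.inr ⟨ht1, by rw [mem_ofPred_eq, neg_one_mul, ← h']; exact ht2⟩
    filter_upwards [mem_inf_of_left (inter_mem hS₀ (inter_mem hS hS')), mem_inf_of_right hae]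
      with t ht1 ht2 using ht2 ht1

theorem HasEssLimit.of_punctured {ν : Measure ℝ} {h : ℝ → ℝ} {a x : ℝ} (h0 : ν {x} = 0)
    (hr : HasEssLimit ν h (𝓝[>] x) a) (hl : HasEssLimit ν h (𝓝[<] x) a) :
    HasEssLimit ν h (𝓝 x) a := by
  have hae : {x}ᶜ ∈ ae ν := by rw [mem_ae_iff, compl_compl]; exact h0
  have heq : 𝓝 x ⊓ ae ν = 𝓝[<] x ⊓ ae ν ⊔ 𝓝[>] x ⊓ ae ν := by
    rw [← inf_sup_right, nhdsLT_sup_nhdsGT, nhdsWithin, inf_assoc,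
      inf_eq_right.2 (le_principal_iff.2 hae)]
  refine ⟨hr.1.mono (inf_le_inf_right _ nhdsWithin_le_nhds), ?_⟩
  rw [heq]
  exact hl.2.sup hr.2

/-- Essential limits along a slice of the plane with a discrete second coordinate. -/
theorem HasEssLimit.prod_pure {S : Type*} [MeasurableSpace S] {μ : Measure S} {g G : S → ℝ}
    (hg : Measurable g) (hG : Measurable G) {h : ℝ × ℝ → ℝ} {l : Filter ℝ} {s a : ℝ}
    (hlim : HasEssLimit ((μ.restrict (G ⁻¹' {s})).map g) (fun t => h (t, s)) l a) :
    HasEssLimit (μ.map fun ω => (g ω, G ω)) h (l ×ˢ pure s) a := by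
  -- This direction transports properness of the filter from the line to the plane. The reverse
  -- comparison `hback` transports the limit.
  have hmap : Tendsto (fun t : ℝ => (t, s)) (l ⊓ ae ((μ.restrict (G ⁻¹' {s})).map g))
      ((l ×ˢ pure s) ⊓ ae (μ.map fun ω => (g ω, G ω))) := by
    refine tendsto_inf.2 ⟨(tendsto_id.mono_left inf_le_left).prodMk tendsto_const_pure,
      Tendsto.mono_left ?_ inf_le_right⟩
    intro N hN
    set N₀ := toMeasurable (μ.map fun ω => (g ω, G ω)) Nᶜ with hN₀def
    have hN₀m : MeasurableSet N₀ := measurableSet_toMeasurable _ _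
    have hN₀ : μ ((fun ω => (g ω, G ω)) ⁻¹' N₀) = 0 := by
      rw [← Measure.map_apply (hg.prodMk hG) hN₀m, hN₀def, measure_toMeasurable]
      exact hN
    have hsec : MeasurableSet {t : ℝ | (t, s) ∈ N₀} := measurable_prodMk_right hN₀m
    rw [mem_map, mem_ae_iff]
    refine measure_mono_null (t := {t : ℝ | (t, s) ∈ N₀})
      (fun t ht => subset_toMeasurable _ _ ht) ?_
    rw [Measure.map_apply hg hsec, Measure.restrict_apply (hg hsec)]
    refine measure_mono_null ?_ hN₀
    rintro ω ⟨h1, h2⟩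
    have h2' : G ω = s := h2
    rw [mem_preimage, h2']
    exact h1
  refine ⟨hlim.1.map _ |>.mono hmap, ?_⟩
  have hback : (l ×ˢ pure s) ⊓ ae (μ.map fun ω => (g ω, G ω)) ≤
      Filter.map (fun t : ℝ => (t, s)) (l ⊓ ae ((μ.restrict (G ⁻¹' {s})).map g)) := by
    intro N hN
    rw [mem_map, mem_inf_iff_superset] at hN
    obtain ⟨T, hT, T', hT', hTT'⟩ := hN
    set T₀ := toMeasurable ((μ.restrict (G ⁻¹' {s})).map g) T'ᶜ with hT₀def
    have hT₀m : MeasurableSet T₀ := measurableSet_toMeasurable _ _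
    have hT₀ : ((μ.restrict (G ⁻¹' {s})).map g) T₀ = 0 := by
      rw [hT₀def, measure_toMeasurable]
      exact hT'
    rw [Measure.map_apply hg hT₀m, Measure.restrict_apply (hg hT₀m)] at hT₀
    have hnull : (T₀ ×ˢ {s})ᶜ ∈ ae (μ.map fun ω => (g ω, G ω)) := by
      rw [mem_ae_iff, compl_compl, Measure.map_apply (hg.prodMk hG)
        (hT₀m.prod (measurableSet_singleton s))]
      exact hT₀
    have hTs : T ×ˢ ({s} : Set ℝ) ∈ l ×ˢ pure s := prod_mem_prod hT (mem_pure.2 rfl)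
    filter_upwards [mem_inf_of_left hTs, mem_inf_of_right hnull]
    rintro ⟨t, s'⟩ ⟨ht, hs'⟩ hn
    obtain rfl : s' = s := hs'
    refine hTT' ⟨ht, ?_⟩
    by_contra hc
    exact hn ⟨subset_toMeasurable _ _ hc, rfl⟩
  exact Tendsto.mono_left (tendsto_map'_iff.2 hlim.2) hback

/-! ### Densities and regression functions -/

section Probability

variable {S E : Type*} [MeasurableSpace S] {μ : Measure S} {Z : S → E}

theorem IsRegression.integrable_comp [MeasurableSpace E] {W : S → ℝ} {k : E → ℝ}
    (h : IsRegression μ W Z k) : Integrable (fun ω => k (Z ω)) μ :=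
  integrable_condExp.congr h.ae_eq.symm

theorem IsRegression.integral_mul_comp [IsFiniteMeasure μ] [MeasurableSpace E] {W : S → ℝ}
    {k H : E → ℝ} (h : IsRegression μ W Z k) (hZ : Measurable Z) (hH : Measurable H) {B : ℝ}
    (hB : ∀ z, |H z| ≤ B) : ∫ ω, H (Z ω) * k (Z ω) ∂μ = ∫ ω, H (Z ω) * W ω ∂μ := by
  have hsm : StronglyMeasurable[MeasurableSpace.comap Z ‹_›] fun ω => H (Z ω) :=
    (hH.comp (comap_measurable Z)).stronglyMeasurable
  have hint : Integrable (fun ω => H (Z ω) * W ω) μ :=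
    h.integrable.bdd_mul (hH.comp hZ).aestronglyMeasurable
      (Eventually.of_forall fun ω => hB (Z ω))
  have h1 := condExp_mul_of_stronglyMeasurable_left (μ := μ) hsm hint h.integrable
  rw [← integral_condExp hZ.comap_le (f := fun ω => H (Z ω) * W ω)]
  refine integral_congr_ae ?_
  filter_upwards [h1, h.ae_eq] with ω h1 h2
  rw [h2]
  exact h1.symm

variable [MeasureSpace E] {f : E → ℝ}

theorem IsDensity.integral_comp (h : IsDensity μ Z f) (hZ : Measurable Z) {H : E → ℝ}
    (hH : Measurable H) : ∫ ω, H (Z ω) ∂μ = ∫ x, f x * H x := by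
  rw [← integral_map hZ.aemeasurable hH.aestronglyMeasurable, h.map_eq,
    integral_withDensity_eq_integral_toReal_smul h.measurable.ennreal_ofReal
      (Eventually.of_forall fun _ => ENNReal.ofReal_lt_top)]
  simp only [ENNReal.toReal_ofReal (h.nonneg _), smul_eq_mul]

theorem IsDensity.integrable [IsFiniteMeasure μ] (h : IsDensity μ Z f) : Integrable f := by
  refine ⟨h.measurable.aestronglyMeasurable, ?_⟩
  rw [hasFiniteIntegral_iff_ofReal (Eventually.of_forall h.nonneg), ← setLIntegral_univ,
    ← withDensity_apply _ MeasurableSet.univ, ← h.map_eq]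
  exact measure_lt_top _ _

theorem IsDensity.measureReal_map [IsFiniteMeasure μ] (h : IsDensity μ Z f) {A : Set E} (hA : MeasurableSet A) :
    (μ.map Z).real A = ∫ x in A, f x := by
  rw [measureReal_def, h.map_eq, withDensity_apply _ hA,
    ← ofReal_integral_eq_lintegral_ofReal h.integrable.integrableOn
      (Eventually.of_forall h.nonneg),
    ENNReal.toReal_ofReal (integral_nonneg h.nonneg)]

theorem IsDensity.ae_eq_zero_of_null (h : IsDensity μ Z f) {A : Set E} (h0 : μ.map Z A = 0) :
    ∀ᵐ x, x ∈ A → f x = 0 := by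
  rw [h.map_eq, withDensity_apply_eq_zero h.measurable.ennreal_ofReal] at h0
  have h1 : ∀ᵐ x : E, x ∉ {x | ENNReal.ofReal (f x) ≠ 0} ∩ A := measure_eq_zero_iff_ae_notMem.1 h0
  filter_upwards [h1] with x hx hxA
  by_contra hne
  refine hx ⟨?_, hxA⟩
  rw [mem_ofPred_eq, Ne, ENNReal.ofReal_eq_zero, not_le]
  exact lt_of_le_of_ne (h.nonneg x) (Ne.symm hne)

end Probability

/-- A density which vanishes off a closed set `s`, times a bounded function which is continuous on
`s`, is continuous wherever the density is. -/
theorem ContinuousAt.mul_indicator_of_ae_eq_zero {E : Type*} [TopologicalSpace E] [MeasureSpace E]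
    [(volume : Measure E).IsOpenPosMeasure] {f m : E → ℝ} {s : Set E} {y : E} {C : ℝ}
    (hy : ContinuousAt f y) (hs : IsClosed s) (hzero : ∀ᵐ x, x ∈ sᶜ → f x = 0)
    (hm : ContinuousOn m s) (hC : ∀ x ∈ s, |m x| ≤ C) :
    ContinuousAt (fun x => f x * s.indicator m x) y ∧ f y * s.indicator m y = f y * m y := by
  have hC' : ∀ x, |s.indicator m x| ≤ |C| := by
    intro x
    by_cases hx : x ∈ s
    · rw [indicator_of_mem hx]; exact (hC x hx).trans (le_abs_self C)
    · rw [indicator_of_notMem hx, abs_zero]; exact abs_nonneg C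
  -- At a zero of `f` the bounded cut-off factor is squeezed. At any other point `f` is nonzero on
  -- an open `V`, and `V ∩ sᶜ` is open and null, hence empty. Then `s` is a neighbourhood of `y` and
  -- the cut-off is invisible.
  by_cases hfy : f y = 0
  · refine ⟨?_, by rw [hfy, zero_mul, zero_mul]⟩
    rw [ContinuousAt, hfy, zero_mul]
    have h1 : Tendsto (fun x => |f x| * |C|) (𝓝 y) (𝓝 0) := by
      have := (hy.tendsto.abs).mul_const |C|
      rwa [hfy, abs_zero, zero_mul] at this
    refine squeeze_zero_norm (fun x => ?_) h1
    rw [Real.norm_eq_abs, abs_mul]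
    exact mul_le_mul_of_nonneg_left (hC' x) (abs_nonneg _)
  · obtain ⟨V, hVsub, hVo, hyV⟩ := eventually_nhds_iff.1 (hy.eventually_ne hfy)
    have hVs : V ⊆ s := by
      have hopen : IsOpen (V ∩ sᶜ) := hVo.inter hs.isOpen_compl
      have hnull : volume (V ∩ sᶜ) = 0 := by
        rw [measure_eq_zero_iff_ae_notMem]
        filter_upwards [hzero] with x hx hx'
        exact hVsub x hx'.1 (hx hx'.2)
      have hempty := hopen.measure_eq_zero_iff volume |>.1 hnull
      intro x hx
      by_contra hxs
      exact (hempty.subset ⟨hx, hxs⟩ : x ∈ (∅ : Set E))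
    have hsn : s ∈ 𝓝 y := mem_of_superset (hVo.mem_nhds hyV) hVs
    refine ⟨hy.mul ?_, by rw [indicator_of_mem (mem_of_mem_nhds hsn)]⟩
    refine (hm.continuousAt hsn).congr ?_
    filter_upwards [hsn] with x hx
    rw [indicator_of_mem hx]

/-! ### One-sided filters -/

theorem neBot_nhdsGT_inf_ae_volume : (𝓝[>] (0 : ℝ) ⊓ ae volume).NeBot := by
  rw [inf_neBot_iff]
  intro s hs N hN
  obtain ⟨b, hb, hbs⟩ := mem_nhdsGT_iff_exists_Ioo_subset.1 hs
  by_contra hne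
  rw [not_nonempty_iff_eq_empty] at hne
  have h1 : Ioo 0 b ⊆ Nᶜ := fun x hx hxN => (hne.subset ⟨hbs hx, hxN⟩ : x ∈ (∅ : Set ℝ))
  have h2 : volume (Ioo 0 b) = 0 := measure_mono_null h1 hN
  rw [Real.volume_Ioo, sub_zero, ENNReal.ofReal_eq_zero] at h2
  exact absurd hb (not_lt.2 h2)

theorem neBot_nhdsLT_inf_ae_volume : (𝓝[<] (0 : ℝ) ⊓ ae volume).NeBot := by
  rw [inf_neBot_iff]
  intro s hs N hN
  obtain ⟨b, hb, hbs⟩ := mem_nhdsLT_iff_exists_Ioo_subset.1 hs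
  by_contra hne
  rw [not_nonempty_iff_eq_empty] at hne
  have h1 : Ioo b 0 ⊆ Nᶜ := fun x hx hxN => (hne.subset ⟨hbs hx, hxN⟩ : x ∈ (∅ : Set ℝ))
  have h2 : volume (Ioo b 0) = 0 := measure_mono_null h1 hN
  rw [Real.volume_Ioo, ENNReal.ofReal_eq_zero] at h2
  have hb' : b < 0 := hb
  linarith

theorem HasDensityAlong.of_neg {κ : Set ℝ → ℝ} {T : ℝ}
    (h : HasDensityAlong (fun A => κ (Neg.neg ⁻¹' A)) (𝓝[>] 0) T) :
    HasDensityAlong κ (𝓝[<] 0) T := by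
  have hvol : ∀ A : Set ℝ, volume (Neg.neg ⁻¹' A) = volume A := fun A =>
    Measure.measure_preimage_neg volume A
  intro ε hε
  obtain ⟨s, hs, hsm, hsfin, hsA⟩ := h ε hε
  refine ⟨Neg.neg ⁻¹' s, ?_, measurable_neg hsm, by rwa [hvol], fun A hA hAm => ?_⟩
  · have : Tendsto (fun x : ℝ => -x) (𝓝[<] 0) (𝓝[>] 0) := by
      simpa using tendsto_neg_nhdsLT (a := (0 : ℝ))
    exact this hs
  · have h1 := hsA (Neg.neg ⁻¹' A) (fun x hx => by simpa using hA hx) (measurable_neg hAm)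
    simpa [measureReal_def, hvol, ← preimage_comp] using h1

/-! ### Tube integrals in terms of the signed distance -/

/-- The tubes around `F` on both sides of it, for functions `f₀ · (G ∘ γ)` with `f₀` almost
everywhere continuous on `F` and `G` arbitrary. -/
theorem IsPatchDecomposition.hasDensityAlong {n N : ℕ} {F : Set (𝔼 (n + 1))} {K : Fin N → Set (𝔼 n)}
    {ψ : Fin N → 𝔼 n → 𝔼 (n + 1)} (h : IsPatchDecomposition F K ψ)
    {γ : 𝔼 (n + 1) → 𝔼 (n + 1)} {w f G : 𝔼 (n + 1) → ℝ} {δ B : ℝ} (hw : IsSignedDist F γ w)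
    (hf : Measurable f) (hG : Measurable G) (hδ : 0 < δ)
    (hB : ∀ x, Metric.infDist x F < δ → |f x| ≤ B) (hG1 : ∀ x, |G x| ≤ 1)
    (hcont : ∀ᵐ y ∂(Measure.euclideanHausdorffMeasure n).restrict F, ContinuousAt f y)
    (hside : ∀ i, ∀ u ∈ interior (K i), ∀ᶠ t in 𝓝[>] (0 : ℝ),
      0 < w (normalChart (ψ i) (u, t)) ↔ ¬ 0 < w (normalChart (ψ i) (u, -t))) :
    HasDensityAlong (fun A => ∫ x in w ⁻¹' A, f x * G (γ x)) (𝓝[>] 0)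
      (∫ y in F, f y * G y ∂(Measure.euclideanHausdorffMeasure n)) := by
  have hγF : ∀ y ∈ F, γ y = y := fun y hy => by
    have h1 := hw.dist_nearest y
    rw [Metric.infDist_zero_of_mem hy] at h1
    exact (dist_eq_zero.1 h1).symm
  have hT : ∫ y in F, f y * G y ∂(Measure.euclideanHausdorffMeasure n) =
      ∫ y in F, f y * G (γ y) ∂(Measure.euclideanHausdorffMeasure n) :=
    setIntegral_congr_fun h.isCompact_surface.measurableSet fun y hy => by
      simp only [hγF y hy]
  have hB' : ∀ x, Metric.infDist x F < δ → |f x * G (γ x)| ≤ B := fun x hx => by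
    rw [abs_mul]
    exact (mul_le_of_le_one_right (abs_nonneg _) (hG1 _)).trans (hB x hx)
  have hlim : ∀ i, ∀ᵐ u ∂volume.restrict (interior (K i)),
      Tendsto (fun t => f (normalChart (ψ i) (u, t)) * G (γ (normalChart (ψ i) (u, t)))) (𝓝 0)
        (𝓝 (f (ψ i u) * G (γ (ψ i u)))) := by
    intro i
    filter_upwards [h.ae_patch hcont i, ae_restrict_mem isOpen_interior.measurableSet]
      with u hu hui
    have hp := h.patch i
    have h0 : normalChart (ψ i) (u, 0) = ψ i u := normalChart_zero _ _
    have hc : Tendsto (fun t => normalChart (ψ i) (u, t)) (𝓝 0) (𝓝 (ψ i u)) := by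
      have h1 : ContinuousAt (normalChart (ψ i)) (u, 0) :=
        (contDiffAt_normalChart hp.contDiff (p := (u, 0)) (hp.immersion u hui)).continuousAt
      have h2 : Tendsto (fun t : ℝ => (u, t)) (𝓝 0) (𝓝 (u, 0)) :=
        (Continuous.prodMk_right u).tendsto 0
      rw [← h0]
      exact h1.tendsto.comp h2
    -- On a short normal `γ` takes the constant value `ψ i u`, so the factor with `G` is eventually
    -- constant.
    refine (hu.tendsto.comp hc).mul (tendsto_const_nhds.congr' ?_)
    filter_upwards [hp.eventually_nearest_eq hui] with t ht
    rw [ht _ (hw.nearest_mem _) (hw.dist_nearest _), hγF _ (hp.image_subset ⟨u, hui, rfl⟩)]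
  intro ε hε
  obtain ⟨δ', hδ', hA⟩ := h.exists_tube_estimate (f := fun x => f x * G (γ x)) hw
    (hf.mul (hG.comp hw.measurable_nearest)) hδ hB' hlim hside hε
  refine ⟨Ioo 0 δ', Ioo_mem_nhdsGT hδ', measurableSet_Ioo, measure_Ioo_lt_top, fun A hAs hAm => ?_⟩
  rw [hT]
  exact hA A hAm hAs

theorem IsSignedDist.neg {n : ℕ} {F : Set (𝔼 (n + 1))} {γ : 𝔼 (n + 1) → 𝔼 (n + 1)}
    {w : 𝔼 (n + 1) → ℝ}
    (h : IsSignedDist F γ w) : IsSignedDist F γ (fun x => -w x) where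
  measurable := h.measurable.neg
  abs_eq x := by rw [abs_neg, h.abs_eq]
  measurable_nearest := h.measurable_nearest
  nearest_mem := h.nearest_mem
  dist_nearest := h.dist_nearest

/-! ### The signed distance to the boundary of a region -/

section Region

variable {n : ℕ} {Ω : Set (𝔼 n)}

theorem abs_signedBoundaryDist (x : 𝔼 n) :
    |signedBoundaryDist Ω x| = Metric.infDist x (frontier Ω) := by
  unfold signedBoundaryDist
  split_ifs
  · exact abs_of_nonneg Metric.infDist_nonneg
  · rw [abs_neg, abs_of_nonneg Metric.infDist_nonneg]

theorem mem_of_signedBoundaryDist_pos {x : 𝔼 n} (h : 0 < signedBoundaryDist Ω x) : x ∈ Ω := by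
  by_contra hx
  rw [signedBoundaryDist, if_neg hx] at h
  linarith [Metric.infDist_nonneg (x := x) (s := frontier Ω)]

theorem notMem_of_signedBoundaryDist_neg {x : 𝔼 n} (h : signedBoundaryDist Ω x < 0) : x ∉ Ω := by
  intro hx
  rw [signedBoundaryDist, if_pos hx] at h
  linarith [Metric.infDist_nonneg (x := x) (s := frontier Ω)]

theorem measurable_signedBoundaryDist (hΩ : MeasurableSet Ω) :
    Measurable (signedBoundaryDist Ω) := by
  have h1 : Measurable fun x : 𝔼 n => Metric.infDist x (frontier Ω) :=
    (Metric.continuous_infDist_pt _).measurable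
  exact Measurable.ite hΩ h1 h1.neg

end Region

theorem IsNearestBoundaryPoint.isSignedDist {n : ℕ} {Ω : Set (𝔼 (n + 1))}
    (hΩ : MeasurableSet Ω) {γ : 𝔼 (n + 1) → 𝔼 (n + 1)}
    (h : IsNearestBoundaryPoint Ω γ) (hγ : Measurable γ) :
    IsSignedDist (frontier Ω) γ (signedBoundaryDist Ω) where
  measurable := measurable_signedBoundaryDist hΩ
  abs_eq := abs_signedBoundaryDist
  measurable_nearest := hγ
  nearest_mem x := (h x).1
  dist_nearest x := (h x).2


/-- Along a normal of a patch, the signed distance changes its sign. -/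
theorem IsHypersurfacePatch.eventually_signedBoundaryDist {n : ℕ} {Ω : Set (𝔼 (n + 1))}
    {ψ : 𝔼 n → 𝔼 (n + 1)} {U : Set (𝔼 n)} (h : IsHypersurfacePatch (frontier Ω) ψ U)
    (hF : IsCompact (frontier Ω)) (hΩ : closure (interior Ω) = Ω) {u : 𝔼 n} (hu : u ∈ U) :
    (∀ᶠ t in 𝓝[>] (0 : ℝ), 0 < signedBoundaryDist Ω (normalChart ψ (u, t)) ↔
      ¬ 0 < signedBoundaryDist Ω (normalChart ψ (u, -t))) ∧
    ∀ᶠ t in 𝓝[>] (0 : ℝ), 0 < -signedBoundaryDist Ω (normalChart ψ (u, t)) ↔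
      ¬ 0 < -signedBoundaryDist Ω (normalChart ψ (u, -t)) := by
  have h1 := h.eventually_mem_iff_notMem hΩ hu
  have hd := h.eventually_infDist_normalChart hF hu
  have h2 : ∀ᶠ t in 𝓝[>] (0 : ℝ), Metric.infDist (normalChart ψ (u, t)) (frontier Ω) = |t| :=
    hd.filter_mono nhdsWithin_le_nhds
  have h3 : ∀ᶠ t in 𝓝[>] (0 : ℝ), Metric.infDist (normalChart ψ (u, -t)) (frontier Ω) = |-t| := by
    have : Tendsto (fun t : ℝ => -t) (𝓝[>] 0) (𝓝 0) := by
      simpa using (continuous_neg.tendsto (0 : ℝ)).mono_left nhdsWithin_le_nhds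
    exact this.eventually hd
  -- The strict bound `d > 0` excludes points on the boundary, so the same alternative settles both
  -- `w` and `-w`.
  have key : ∀ᶠ t in 𝓝[>] (0 : ℝ), ∃ d > 0,
      signedBoundaryDist Ω (normalChart ψ (u, t)) = d ∧
        signedBoundaryDist Ω (normalChart ψ (u, -t)) = -d ∨
      signedBoundaryDist Ω (normalChart ψ (u, t)) = -d ∧
        signedBoundaryDist Ω (normalChart ψ (u, -t)) = d := by
    filter_upwards [h1, h2, h3, self_mem_nhdsWithin] with t h1 h2 h3 ht
    refine ⟨|t|, abs_pos.2 (ne_of_gt ht), ?_⟩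
    rw [abs_neg] at h3
    unfold signedBoundaryDist
    rw [h2, h3]
    by_cases hm : normalChart ψ (u, t) ∈ Ω
    · left; rw [if_pos hm, if_neg (h1.1 hm)]; exact ⟨rfl, rfl⟩
    · right; rw [if_neg hm, if_pos (not_not.1 fun hc => hm (h1.2 hc))]; exact ⟨rfl, rfl⟩
  constructor <;> filter_upwards [key] with t ⟨d, hd, hcase⟩ <;>
    rcases hcase with ⟨e1, e2⟩ | ⟨e1, e2⟩ <;> rw [e1, e2] <;>
    constructor <;> intro h' <;> linarith

section Region

variable {n : ℕ} {Ω : Set (𝔼 (n + 1))} {γ : 𝔼 (n + 1) → 𝔼 (n + 1)}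

theorem HasPiecewiseSmoothBoundary.integrableOn_of_bounded (hΩ : HasPiecewiseSmoothBoundary Ω)
    {f : 𝔼 (n + 1) → ℝ} (hf : Measurable f) {B : ℝ} (hB : ∀ y ∈ frontier Ω, |f y| ≤ B) :
    IntegrableOn f (frontier Ω) (Measure.euclideanHausdorffMeasure n) := by
  obtain ⟨N, K, ψ, h⟩ := hΩ.exists_isPatchDecomposition
  exact h.integrableOn_of_bounded hf hB

theorem IsNearestBoundaryPoint.eq_self (hγ : IsNearestBoundaryPoint Ω γ) {y : 𝔼 (n + 1)}
    (hy : y ∈ frontier Ω) : γ y = y := by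
  have h1 := (hγ y).2
  rw [Metric.infDist_zero_of_mem hy] at h1
  exact (dist_eq_zero.1 h1).symm

/-- The tube on the outer side is the inner tube for the negated signed distance, and the surface
integral does not see the sign. -/
theorem HasPiecewiseSmoothBoundary.hasDensityAlong (hΩ : HasPiecewiseSmoothBoundary Ω)
    (hΩc : IsClosed Ω) (hγm : Measurable γ)
    (hγ : IsNearestBoundaryPoint Ω γ) {f G : 𝔼 (n + 1) → ℝ} (hf : Measurable f)
    (hfb : ∃ U, IsOpen U ∧ frontier Ω ⊆ U ∧ ∃ C : ℝ, ∀ x ∈ U, |f x| ≤ C)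
    (hfc : ∀ᵐ x ∂(Measure.euclideanHausdorffMeasure n).restrict (frontier Ω), ContinuousAt f x)
    (hG : Measurable G) (hG1 : ∀ x, |G x| ≤ 1) :
    HasDensityAlong (fun A => ∫ x in signedBoundaryDist Ω ⁻¹' A, f x * G (γ x)) (𝓝[>] 0)
      (∫ y in frontier Ω, f y * G y ∂(Measure.euclideanHausdorffMeasure n)) ∧
    HasDensityAlong (fun A => ∫ x in signedBoundaryDist Ω ⁻¹' A, f x * G (γ x)) (𝓝[<] 0)
      (∫ y in frontier Ω, f y * G y ∂(Measure.euclideanHausdorffMeasure n)) := by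
  obtain ⟨N, K, ψ, h⟩ := hΩ.exists_isPatchDecomposition
  obtain ⟨U, hU, hFU, C, hC⟩ := hfb
  obtain ⟨δ, hδ, hδU⟩ := h.isCompact_surface.exists_thickening_subset_open hU hFU
  have hne : (frontier Ω).Nonempty := ⟨γ 0, (hγ 0).1⟩
  have hB : ∀ x, Metric.infDist x (frontier Ω) < δ → |f x| ≤ C := fun x hx =>
    hC x (hδU ((Metric.mem_thickening_iff_infDist_lt hne).2 hx))
  have hw := hγ.isSignedDist hΩc.measurableSet hγm
  have hside := fun i u hu =>
    (h.patch i).eventually_signedBoundaryDist h.isCompact_surface hΩ.1 (u := u) hu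
  refine ⟨h.hasDensityAlong hw hf hG hδ hB hG1 hfc fun i u hu => (hside i u hu).1,
    HasDensityAlong.of_neg ?_⟩
  exact h.hasDensityAlong hw.neg hf hG hδ hB hG1 hfc fun i u hu => (hside i u hu).2

end Region

/-! ### Essential limits of regression functions -/

section Regression

variable {S : Type*} [MeasurableSpace S] {μ : Measure S} [IsProbabilityMeasure μ]

theorem IsRegression.setIntegral_preimage {E : Type*} [MeasurableSpace E] {Z : S → E} {W : S → ℝ}
    {k : E → ℝ} (h : IsRegression μ W Z k) (hZ : Measurable Z) {A : Set E}
    (hA : MeasurableSet A) : ∫ ω in Z ⁻¹' A, k (Z ω) ∂μ = ∫ ω in Z ⁻¹' A, W ω ∂μ := by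
  rw [← setIntegral_condExp hZ.comap_le h.integrable ⟨A, hA, rfl⟩]
  exact integral_congr_ae (ae_restrict_of_ae h.ae_eq)

/-- The defining property of conditional expectation replaces the integral of `k` over `A` against
the law of `g` by that of `W` over `g ⁻¹' A`. -/
theorem IsRegression.hasEssLimit {g W : S → ℝ} {k : ℝ → ℝ} (hk : IsRegression μ W g k)
    (hg : Measurable g) {l : Filter ℝ} (hl : (l ⊓ ae (volume : Measure ℝ)).NeBot) {L I : ℝ}
    (hL : 0 < L) (hd : HasDensityAlong (μ.map g).real l L)
    (hI : HasDensityAlong (fun A => ∫ ω in g ⁻¹' A, W ω ∂μ) l I) :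
    HasEssLimit (μ.map g) k l (I / L) := by
  have : IsProbabilityMeasure (μ.map g) := Measure.isProbabilityMeasure_map hg.aemeasurable
  refine hasEssLimit_of_hasDensityAlong ⟨univ, univ_mem, measure_lt_top _ _⟩ hl hk.measurable
    ((integrable_map_measure hk.measurable.aestronglyMeasurable hg.aemeasurable).2
      hk.integrable_comp) hL hd (hI.congr univ_mem MeasurableSet.univ fun A _ hA => ?_)
  rw [setIntegral_map hA hk.measurable.aestronglyMeasurable hg.aemeasurable,
    hk.setIntegral_preimage hg hA]

/-- On the event `G = s` the version `k` depends on `g` alone, so `k (·, s)` can be tested against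
the law of `g` restricted to that event. -/
theorem IsRegression.hasEssLimit_slice {g G W : S → ℝ} {k : ℝ × ℝ → ℝ}
    (hk : IsRegression μ W (fun ω => (g ω, G ω)) k) (hg : Measurable g) (hG : Measurable G)
    {l : Filter ℝ} (hl : (l ⊓ ae (volume : Measure ℝ)).NeBot) {L I s : ℝ} (hL : 0 < L)
    (hd : HasDensityAlong (fun A => μ.real (g ⁻¹' A ∩ G ⁻¹' {s})) l L)
    (hI : HasDensityAlong (fun A => ∫ ω in g ⁻¹' A ∩ G ⁻¹' {s}, W ω ∂μ) l I) :
    HasEssLimit (μ.map fun ω => (g ω, G ω)) k (l ×ˢ pure s) (I / L) := by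
  have hGs : MeasurableSet (G ⁻¹' {s}) := hG (measurableSet_singleton s)
  have hks : Measurable fun t => k (t, s) := hk.measurable.comp measurable_prodMk_right
  have hcongr : ∀ ω ∈ G ⁻¹' {s}, k (g ω, s) = k (g ω, G ω) := fun ω hω => by
    rw [show G ω = s from hω]
  have hint : Integrable (fun t => k (t, s)) ((μ.restrict (G ⁻¹' {s})).map g) := by
    rw [integrable_map_measure hks.aestronglyMeasurable hg.aemeasurable]
    exact (integrableOn_congr_fun hcongr hGs).2 hk.integrable_comp.integrableOn
  refine HasEssLimit.prod_pure hg hG (hasEssLimit_of_hasDensityAlong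
    ⟨univ, univ_mem, measure_lt_top _ _⟩ hl hks hint hL
    (hd.congr univ_mem MeasurableSet.univ fun A _ hA => ?_)
    (hI.congr univ_mem MeasurableSet.univ fun A _ hA => ?_))
  · rw [measureReal_def, Measure.map_apply hg hA, Measure.restrict_apply (hg hA), measureReal_def]
  · rw [setIntegral_map hA hks.aestronglyMeasurable hg.aemeasurable,
      Measure.restrict_restrict (hg hA),
      setIntegral_congr_fun ((hg hA).inter hGs) fun ω hω => hcongr ω hω.2]
    exact hk.setIntegral_preimage (hg.prodMk hG) (hA.prod (measurableSet_singleton s))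

variable {E : Type*} [MeasureSpace E] {X : S → E} {f : E → ℝ}

theorem IsDensity.integral_mul_regression (hf : IsDensity μ X f) (hX : Measurable X) {W : S → ℝ}
    {m H : E → ℝ} (hm : IsRegression μ W X m) (hH : Measurable H) {B : ℝ} (hB : ∀ x, |H x| ≤ B) :
    ∫ ω, H (X ω) * W ω ∂μ = ∫ x, f x * (H x * m x) := by
  rw [← hm.integral_mul_comp hX hH hB]
  exact hf.integral_comp hX (H := fun x => H x * m x) (hH.mul hm.measurable)

end Regression

/-! ### Densities and outcomes near the boundary -/

section Outcome

variable {n : ℕ} {Ω : Set (𝔼 (n + 1))} {γ : 𝔼 (n + 1) → 𝔼 (n + 1)}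
  {S : Type*} [MeasurableSpace S] {μ : Measure S}
  {X : S → 𝔼 (n + 1)} {f : 𝔼 (n + 1) → ℝ}

/-- The assumptions on the running variable `X` and its density `f` near `∂Ω`. -/
structure IsRunningVariable (μ : Measure S) (Ω : Set (𝔼 (n + 1))) (γ : 𝔼 (n + 1) → 𝔼 (n + 1))
    (X : S → 𝔼 (n + 1)) (f : 𝔼 (n + 1) → ℝ) : Prop where
  isClosed : IsClosed Ω
  piecewiseSmooth : HasPiecewiseSmoothBoundary Ω
  measurable_nearest : Measurable γ
  nearest : IsNearestBoundaryPoint Ω γ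
  measurable : Measurable X
  density : IsDensity μ X f
  bounded : ∃ U, IsOpen U ∧ frontier Ω ⊆ U ∧ ∃ C : ℝ, ∀ x ∈ U, f x ≤ C
  ae_continuousAt : ∀ᵐ x ∂(Measure.euclideanHausdorffMeasure n).restrict (frontier Ω),
    ContinuousAt f x

namespace IsRunningVariable

theorem measurable_signedDist (hX : IsRunningVariable μ Ω γ X f) :
    Measurable fun ω => signedBoundaryDist Ω (X ω) :=
  (measurable_signedBoundaryDist hX.isClosed.measurableSet).comp hX.measurable

theorem ae_eq_zero_off_support (hX : IsRunningVariable μ Ω γ X f) :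
    ∀ᵐ x, x ∈ (μ.map X).supportᶜ → f x = 0 :=
  hX.density.ae_eq_zero_of_null Measure.measure_compl_support

variable {m : 𝔼 (n + 1) → ℝ} {C : ℝ}

/-- The density times a bounded regression function, cut off outside of the support. -/
theorem ae_continuousAt_mul (hX : IsRunningVariable μ Ω γ X f)
    (hm : ContinuousOn m (μ.map X).support) (hC : ∀ x ∈ (μ.map X).support, |m x| ≤ C) :
    ∀ᵐ x ∂(Measure.euclideanHausdorffMeasure n).restrict (frontier Ω),
      ContinuousAt (fun x => f x * (μ.map X).support.indicator m x) x ∧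
        f x * (μ.map X).support.indicator m x = f x * m x := by
  filter_upwards [hX.ae_continuousAt] with x hx
  exact hx.mul_indicator_of_ae_eq_zero Measure.isClosed_support hX.ae_eq_zero_off_support hm hC

theorem abs_mul_indicator_le (hX : IsRunningVariable μ Ω γ X f)
    (hC : ∀ x ∈ (μ.map X).support, |m x| ≤ C) (x : 𝔼 (n + 1)) :
    |f x * (μ.map X).support.indicator m x| ≤ |C| * f x := by
  rw [abs_mul, abs_of_nonneg (hX.density.nonneg x), mul_comm]
  refine mul_le_mul_of_nonneg_right ?_ (hX.density.nonneg x)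
  by_cases hx : x ∈ (μ.map X).support
  · rw [indicator_of_mem hx]; exact (hC x hx).trans (le_abs_self C)
  · rw [indicator_of_notMem hx, abs_zero]; exact abs_nonneg C

theorem measurable_mul_indicator (hX : IsRunningVariable μ Ω γ X f) (hm : Measurable m) :
    Measurable fun x => f x * (μ.map X).support.indicator m x :=
  hX.density.measurable.mul (hm.indicator Measure.isClosed_support.measurableSet)

theorem exists_bound_mul_indicator (hX : IsRunningVariable μ Ω γ X f)
    (hC : ∀ x ∈ (μ.map X).support, |m x| ≤ C) :
    ∃ U, IsOpen U ∧ frontier Ω ⊆ U ∧ ∃ B : ℝ, ∀ x ∈ U,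
      |f x * (μ.map X).support.indicator m x| ≤ B := by
  obtain ⟨U, hU, hFU, B, hB⟩ := hX.bounded
  exact ⟨U, hU, hFU, |C| * B, fun x hx => (hX.abs_mul_indicator_le hC x).trans
    (mul_le_mul_of_nonneg_left (hB x hx) (abs_nonneg C))⟩

variable {G : 𝔼 (n + 1) → ℝ}

theorem ae_mul_indicator_eq (hX : IsRunningVariable μ Ω γ X f)
    (hm : ContinuousOn m (μ.map X).support) (hC : ∀ x ∈ (μ.map X).support, |m x| ≤ C) :
    (fun y => f y * (μ.map X).support.indicator m y * G y)
      =ᵐ[(Measure.euclideanHausdorffMeasure n).restrict (frontier Ω)]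
      fun y => f y * m y * G y := by
  filter_upwards [hX.ae_continuousAt_mul hm hC] with x hx
  rw [hx.2]

/-- Nothing bounds `m` off the support of `X`, even on `∂Ω`. Almost everywhere there, however, the
integrand equals its cut-off version, which is bounded. -/
theorem integrableOn_boundary (hX : IsRunningVariable μ Ω γ X f) (hmm : Measurable m)
    (hm : ContinuousOn m (μ.map X).support)
    (hC : ∀ x ∈ (μ.map X).support, |m x| ≤ C) (hG : Measurable G) (hG1 : ∀ x, |G x| ≤ 1) :
    IntegrableOn (fun y => f y * m y * G y) (frontier Ω)
      (Measure.euclideanHausdorffMeasure n) := by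
  obtain ⟨U, hU, hFU, B, hB⟩ := hX.exists_bound_mul_indicator hC
  refine Integrable.congr (hX.piecewiseSmooth.integrableOn_of_bounded
    ((hX.measurable_mul_indicator hmm).mul hG) (B := B) fun y hy => ?_)
    (hX.ae_mul_indicator_eq hm hC)
  rw [Pi.mul_apply, abs_mul]
  exact (mul_le_of_le_one_right (abs_nonneg _) (hG1 _)).trans (hB y (hFU hy))

/-- If the part of the boundary selected by `G` has no mass under `fX`, it contributes nothing to
the outcome integrals either. This disposes of the brackets of weight zero. -/
theorem abs_boundary_integral_le (hX : IsRunningVariable μ Ω γ X f)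
    (hm : ContinuousOn m (μ.map X).support) (hC : ∀ x ∈ (μ.map X).support, |m x| ≤ C)
    (hG0 : ∀ x, 0 ≤ G x)
    (hint : IntegrableOn (fun y => f y * G y) (frontier Ω)
      (Measure.euclideanHausdorffMeasure n)) :
    |∫ y in frontier Ω, f y * m y * G y ∂(Measure.euclideanHausdorffMeasure n)| ≤
      |C| * ∫ y in frontier Ω, f y * G y ∂(Measure.euclideanHausdorffMeasure n) := by
  rw [← integral_const_mul, ← Real.norm_eq_abs]
  refine norm_integral_le_of_norm_le (hint.const_mul |C|) ?_
  filter_upwards [hX.ae_continuousAt_mul hm hC] with y hy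
  rw [Real.norm_eq_abs, ← hy.2, abs_mul, abs_of_nonneg (hG0 y), ← mul_assoc]
  exact mul_le_mul_of_nonneg_right (hX.abs_mul_indicator_le hC y) (hG0 y)

/-- The conditional law of `X` given its distance from `∂Ω`, in the limit. -/
theorem hasDensityAlong_density (hX : IsRunningVariable μ Ω γ X f) (hG : Measurable G)
    (hG1 : ∀ x, |G x| ≤ 1) {l : Filter ℝ}
    (hl : l = 𝓝[>] 0 ∨ l = 𝓝[<] 0) :
    HasDensityAlong (fun A => ∫ ω in (fun ω => signedBoundaryDist Ω (X ω)) ⁻¹' A,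
      G (γ (X ω)) ∂μ) l
      (∫ y in frontier Ω, f y * G y ∂(Measure.euclideanHausdorffMeasure n)) := by
  obtain ⟨U, hU, hFU, B, hB⟩ := hX.bounded
  have h1 := hX.piecewiseSmooth.hasDensityAlong hX.isClosed hX.measurable_nearest hX.nearest
    hX.density.measurable ⟨U, hU, hFU, B, fun x hx => by
      rw [abs_of_nonneg (hX.density.nonneg x)]; exact hB x hx⟩ hX.ae_continuousAt hG hG1
  have h2 : HasDensityAlong (fun A => ∫ x in signedBoundaryDist Ω ⁻¹' A, f x * G (γ x)) l
      (∫ y in frontier Ω, f y * G y ∂(Measure.euclideanHausdorffMeasure n)) := by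
    rcases hl with rfl | rfl
    exacts [h1.1, h1.2]
  refine h2.congr univ_mem MeasurableSet.univ fun A _ hA => ?_
  have hDA : MeasurableSet (signedBoundaryDist Ω ⁻¹' A) :=
    measurable_signedBoundaryDist hX.isClosed.measurableSet hA
  have hXA : MeasurableSet (X ⁻¹' (signedBoundaryDist Ω ⁻¹' A)) := hX.measurable hDA
  change ∫ ω in X ⁻¹' (signedBoundaryDist Ω ⁻¹' A), G (γ (X ω)) ∂μ = _
  rw [← integral_indicator hXA, ← integral_indicator hDA]
  have h3 := hX.density.integral_comp hX.measurable
    (H := (signedBoundaryDist Ω ⁻¹' A).indicator fun x => G (γ x))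
    ((hG.comp hX.measurable_nearest).indicator hDA)
  refine Eq.trans ?_ (h3.trans ?_)
  · rfl
  · refine integral_congr_ae (Eventually.of_forall fun x => ?_)
    by_cases hx : x ∈ signedBoundaryDist Ω ⁻¹' A
    · simp only [indicator_of_mem hx]
    · simp only [indicator_of_notMem hx, mul_zero]

/-- The conditional outcome given the distance from `∂Ω`, in the limit on the side of `∂Ω` where
the outcome `Y` is `W`. -/
theorem hasDensityAlong_outcome [IsProbabilityMeasure μ]
    (hX : IsRunningVariable μ Ω γ X f) {Y W : S → ℝ} {s : Set ℝ} (hW : IsRegression μ W X m)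
    (hm : ContinuousOn m (μ.map X).support) (hC : ∀ x ∈ (μ.map X).support, |m x| ≤ C)
    (hG : Measurable G) (hG1 : ∀ x, |G x| ≤ 1) {l : Filter ℝ}
    (hl : l = 𝓝[>] 0 ∨ l = 𝓝[<] 0) (hs : s ∈ l) (hsm : MeasurableSet s)
    (hYW : ∀ ω, signedBoundaryDist Ω (X ω) ∈ s → Y ω = W ω) :
    HasDensityAlong (fun A => ∫ ω in (fun ω => signedBoundaryDist Ω (X ω)) ⁻¹' A,
      G (γ (X ω)) * Y ω ∂μ) l
      (∫ y in frontier Ω, f y * m y * G y ∂(Measure.euclideanHausdorffMeasure n)) := by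
  have h1 := hX.piecewiseSmooth.hasDensityAlong hX.isClosed hX.measurable_nearest hX.nearest
    (hX.measurable_mul_indicator hW.measurable) (hX.exists_bound_mul_indicator hC)
    ((hX.ae_continuousAt_mul hm hC).mono fun x hx => hx.1) hG hG1
  rw [integral_congr_ae (hX.ae_mul_indicator_eq hm hC)] at h1
  have h2 : HasDensityAlong (fun A => ∫ x in signedBoundaryDist Ω ⁻¹' A,
      f x * (μ.map X).support.indicator m x * G (γ x)) l
      (∫ y in frontier Ω, f y * m y * G y ∂(Measure.euclideanHausdorffMeasure n)) := by
    rcases hl with rfl | rfl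
    exacts [h1.1, h1.2]
  refine h2.congr hs hsm fun A hAs hA => ?_
  have hDA : MeasurableSet (signedBoundaryDist Ω ⁻¹' A) :=
    measurable_signedBoundaryDist hX.isClosed.measurableSet hA
  have hXA : MeasurableSet (X ⁻¹' (signedBoundaryDist Ω ⁻¹' A)) := hX.measurable hDA
  change ∫ ω in X ⁻¹' (signedBoundaryDist Ω ⁻¹' A), G (γ (X ω)) * Y ω ∂μ = _
  rw [← integral_indicator hXA, ← integral_indicator hDA]
  have h3 := hX.density.integral_mul_regression hX.measurable hW
    (H := (signedBoundaryDist Ω ⁻¹' A).indicator fun x => G (γ x)) (B := 1)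
    ((hG.comp hX.measurable_nearest).indicator hDA) fun x => by
      by_cases hx : x ∈ signedBoundaryDist Ω ⁻¹' A
      · rw [indicator_of_mem hx]; exact hG1 _
      · rw [indicator_of_notMem hx, abs_zero]; exact zero_le_one
  refine Eq.trans ?_ (h3.trans ?_)
  · refine integral_congr_ae (Eventually.of_forall fun ω => ?_)
    by_cases hω : X ω ∈ signedBoundaryDist Ω ⁻¹' A
    · have hω' : ω ∈ X ⁻¹' (signedBoundaryDist Ω ⁻¹' A) := hω
      simp only [indicator_of_mem hω, indicator_of_mem hω', hYW ω (hAs hω)]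
    · have hω' : ω ∉ X ⁻¹' (signedBoundaryDist Ω ⁻¹' A) := hω
      simp only [indicator_of_notMem hω, indicator_of_notMem hω', zero_mul]
  · refine integral_congr_ae ?_
    filter_upwards [hX.ae_eq_zero_off_support] with x hx0
    by_cases hx : x ∈ signedBoundaryDist Ω ⁻¹' A
    · simp only [indicator_of_mem hx]
      by_cases hxs : x ∈ (μ.map X).support
      · rw [indicator_of_mem hxs]; ring
      · rw [indicator_of_notMem hxs, hx0 hxs]; ring
    · simp only [indicator_of_notMem hx, zero_mul, mul_zero]

end IsRunningVariable

end Outcome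

/-! ### The sign indicator and the boundary formula -/

theorem measurable_signIndicator {E : Type*} [MeasurableSpace E] {τ : E → ℝ} (hτ : Measurable τ) :
    Measurable (signIndicator τ id) :=
  Measurable.ite (hτ measurableSet_Ici) measurable_const measurable_const

theorem signIndicator_eq_one_or_zero {E : Type*} (τ : E → ℝ) (γ : E → E) (x : E) :
    signIndicator τ γ x = 1 ∨ signIndicator τ γ x = 0 := by
  unfold signIndicator
  split_ifs
  exacts [Or.inl rfl, Or.inr rfl]

theorem two_mul_signIndicator_sub_one_mul {E : Type*} (τ : E → ℝ) (x : E) :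
    (2 * signIndicator τ id x - 1) * τ x = |τ x| := by
  unfold signIndicator
  split_ifs with hx
  · rw [abs_of_nonneg (show 0 ≤ τ x from hx)]
    ring
  · rw [abs_of_neg (show τ x < 0 from not_le.1 hx)]
    ring

end

theorem theorem2 {n : ℕ} {S : Type*} [MeasurableSpace S] (μ : Measure S) [IsProbabilityMeasure μ]
    -- running vector, potential outcomes, treatment region (closed, bounded, piecewise smooth)
    (X : S → EuclideanSpace ℝ (Fin (n + 1))) (hX : Measurable X)
    (Y₀ Y₁ : S → ℝ) (hY₀ : Measurable Y₀) (hY₁ : Measurable Y₁)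
    (Ω : Set (EuclideanSpace ℝ (Fin (n + 1))))
    (hΩ_closed : IsClosed Ω) (hΩ_bdd : Bornology.IsBounded Ω)
    (hΩ_smooth : HasPiecewiseSmoothBoundary Ω)
    -- bounded supports
    (hX_bdd : ∃ C : ℝ, ∀ᵐ ω ∂μ, ‖X ω‖ ≤ C)
    (hY_bdd : ∃ C : ℝ, ∀ᵐ ω ∂μ, |observedOutcome Ω X Y₀ Y₁ ω| ≤ C)
    -- density of `X`, bounded near the boundary, continuous at almost all of its points
    (fX : EuclideanSpace ℝ (Fin (n + 1)) → ℝ) (hfX : IsDensity μ X fX)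
    (hfX_bdd : ∃ U, IsOpen U ∧ frontier Ω ⊆ U ∧ ∃ C : ℝ, ∀ x ∈ U, fX x ≤ C)
    (hfX_cont : ∀ᵐ x ∂(Measure.euclideanHausdorffMeasure n).restrict (frontier Ω),
      ContinuousAt fX x)
    -- density of the signed distance, bounded away from zero near zero
    (fg : ℝ → ℝ) (hfg : IsDensity μ (fun ω => signedBoundaryDist Ω (X ω)) fg)
    (hfg_pos : ∃ c > 0, ∃ δ > 0, ∀ᵐ t : ℝ, t ∈ Ioo (-δ) δ → c ≤ fg t)
    -- regression functions of the potential outcomes, `C²` and bounded on the support of `X`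
    (m₀ m₁ : EuclideanSpace ℝ (Fin (n + 1)) → ℝ)
    (hm₀ : IsRegression μ Y₀ X m₀) (hm₁ : IsRegression μ Y₁ X m₁)
    (hm₀_smooth : ContDiffOn ℝ 2 m₀ (μ.map X).support)
    (hm₁_smooth : ContDiffOn ℝ 2 m₁ (μ.map X).support)
    (hm₀_bdd : ∃ C : ℝ, ∀ x ∈ (μ.map X).support, |m₀ x| ≤ C)
    (hm₁_bdd : ∃ C : ℝ, ∀ x ∈ (μ.map X).support, |m₁ x| ≤ C)
    -- `τ`, the nearest boundary point `γ`, the sign indicator `Γ`, `Y` and `g`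
    (τ : EuclideanSpace ℝ (Fin (n + 1)) → ℝ) (hτ : τ = fun x => m₁ x - m₀ x)
    (γ : EuclideanSpace ℝ (Fin (n + 1)) → EuclideanSpace ℝ (Fin (n + 1)))
    (hγ_meas : Measurable γ) (hγ : IsNearestBoundaryPoint Ω γ)
    (Γ : EuclideanSpace ℝ (Fin (n + 1)) → ℝ) (hΓ : Γ = signIndicator τ γ)
    (Y : S → ℝ) (hY : Y = observedOutcome Ω X Y₀ Y₁)
    (g : S → ℝ) (hg : g = fun ω => signedBoundaryDist Ω (X ω))
    -- versions of `E[Y | g = t, Γ = s]`, `E[Γ | g = t]` and `E[(2Γ - 1)Y | g = t]`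
    (h : ℝ × ℝ → ℝ) (hh : IsRegression μ Y (fun ω => (g ω, Γ (X ω))) h)
    (q : ℝ → ℝ) (hq : IsRegression μ (fun ω => Γ (X ω)) g q)
    (r : ℝ → ℝ) (hr : IsRegression μ (fun ω => (2 * Γ (X ω) - 1) * Y ω) g r) :
    -- `fg0 = f_g(0)`, `p = E[Γ | g = 0]`
    ∃ fg0 p a₁p a₁m a₀p a₀m bp bm τΓ : ℝ,
      0 < fg0 ∧ HasEssLimit volume fg (𝓝 0) fg0 ∧
      HasEssLimit (μ.map g) q (𝓝 0) p ∧
      -- the one-sided limits given `Γ = 1`, unless their difference has weight zero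
      (p ≠ 0 →
        HasEssLimit (μ.map fun ω => (g ω, Γ (X ω))) h (𝓝[>] 0 ×ˢ pure 1) a₁p ∧
        HasEssLimit (μ.map fun ω => (g ω, Γ (X ω))) h (𝓝[<] 0 ×ˢ pure 1) a₁m) ∧
      -- the one-sided limits given `Γ = 0`, unless their difference has weight zero
      (1 - p ≠ 0 →
        HasEssLimit (μ.map fun ω => (g ω, Γ (X ω))) h (𝓝[>] 0 ×ˢ pure 0) a₀p ∧
        HasEssLimit (μ.map fun ω => (g ω, Γ (X ω))) h (𝓝[<] 0 ×ˢ pure 0) a₀m) ∧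
      τΓ = (a₁p - a₁m) * p - (a₀p - a₀m) * (1 - p) ∧
      -- the boundary integral
      IntegrableOn (fun x => |τ x| * fX x) (frontier Ω) (Measure.euclideanHausdorffMeasure n) ∧
      τΓ = 1 / fg0 * ∫ x in frontier Ω, |τ x| * fX x ∂(Measure.euclideanHausdorffMeasure n) ∧
      τΓ = 1 / fg0 * ∫ x in frontier Ω, (2 * Γ x - 1) * τ x * fX x
        ∂(Measure.euclideanHausdorffMeasure n) ∧
      -- the jump of `(2Γ - 1)Y` in `g`
      HasEssLimit (μ.map g) r (𝓝[>] 0) bp ∧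
      HasEssLimit (μ.map g) r (𝓝[<] 0) bm ∧
      τΓ = bp - bm ∧
      -- `τΓ` vanishes exactly when `τ` vanishes almost everywhere (with respect to `fX dS`)
      (τΓ = 0 ↔ ∀ᵐ x ∂(Measure.euclideanHausdorffMeasure n).restrict (frontier Ω),
        0 < fX x → τ x = 0) := by
  subst hY hg hτ
  set F := frontier Ω with hF
  -- Writing `Γ = σ ∘ γ` puts `Γ` in the form `G ∘ γ` handled by the tube asymptotics. Only
  -- measurability of `σ` is needed.
  set σ : EuclideanSpace ℝ (Fin (n + 1)) → ℝ :=
    signIndicator (fun x => m₁ x - m₀ x) id with hσ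
  have hΓσ : ∀ x, Γ x = σ (γ x) := fun x => by rw [hΓ]; rfl
  have hσm : Measurable σ := measurable_signIndicator (hm₁.measurable.sub hm₀.measurable)
  have hV : IsRunningVariable μ Ω γ X fX :=
    ⟨hΩ_closed, hΩ_smooth, hγ_meas, hγ, hX, hfX, hfX_bdd, hfX_cont⟩
  obtain ⟨C₀, hC₀⟩ := hm₀_bdd
  obtain ⟨C₁, hC₁⟩ := hm₁_bdd
  have hg := hV.measurable_signedDist
  have hΓX : Measurable fun ω => Γ (X ω) := by
    simp only [hΓσ]
    exact hσm.comp (hγ_meas.comp hX)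
  -- the boundary integrals
  set G : ℝ → EuclideanSpace ℝ (Fin (n + 1)) → ℝ := fun s => (σ ⁻¹' {s}).indicator 1 with hG
  have hGm : ∀ s, Measurable (G s) := fun s =>
    measurable_one.indicator (hσm (measurableSet_singleton s))
  have hG01 : ∀ s x, 0 ≤ G s x ∧ G s x ≤ 1 := fun s x =>
    ⟨indicator_nonneg (fun _ _ => zero_le_one) x, indicator_le_self' (fun _ _ => zero_le_one) x⟩
  have hGabs : ∀ s x, |G s x| ≤ 1 := fun s x => by
    rw [abs_of_nonneg (hG01 s x).1]; exact (hG01 s x).2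
  have hGσ : ∀ x, G 1 x = σ x ∧ G 0 x = 1 - σ x := fun x => by
    rcases signIndicator_eq_one_or_zero (fun x => m₁ x - m₀ x) id x with h1 | h1 <;>
      change σ x = _ at h1 <;> simp [hG, h1]
  set L : ℝ → ℝ := fun s => ∫ y in F, fX y * G s y ∂(Measure.euclideanHausdorffMeasure n) with hL
  set I : (EuclideanSpace ℝ (Fin (n + 1)) → ℝ) → ℝ → ℝ := fun m s =>
    ∫ y in F, fX y * m y * G s y ∂(Measure.euclideanHausdorffMeasure n) with hI
  have hLint : ∀ s, IntegrableOn (fun y => fX y * G s y) F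
      (Measure.euclideanHausdorffMeasure n) := fun s => by
    simpa using hV.integrableOn_boundary (m := fun _ => 1) (C := 1) measurable_const
      continuousOn_const (fun _ _ => by norm_num) (hGm s) (hGabs s)
  have hIint₀ := fun s => hV.integrableOn_boundary hm₀.measurable hm₀_smooth.continuousOn hC₀
    (hGm s) (hGabs s)
  have hIint₁ := fun s => hV.integrableOn_boundary hm₁.measurable hm₁_smooth.continuousOn hC₁
    (hGm s) (hGabs s)
  have hI0 : ∀ s, L s = 0 → I m₀ s = 0 ∧ I m₁ s = 0 := fun s hs => by
    have h0 := hV.abs_boundary_integral_le hm₀_smooth.continuousOn hC₀ (fun x => (hG01 s x).1)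
      (hLint s)
    have h1 := hV.abs_boundary_integral_le hm₁_smooth.continuousOn hC₁ (fun x => (hG01 s x).1)
      (hLint s)
    rw [show (∫ y in frontier Ω, fX y * G s y ∂(Measure.euclideanHausdorffMeasure n)) = 0 from hs,
      mul_zero] at h0 h1
    exact ⟨abs_nonpos_iff.1 h0, abs_nonpos_iff.1 h1⟩
  have hLnonneg : ∀ s, 0 ≤ L s := fun s =>
    integral_nonneg fun y => mul_nonneg (hfX.nonneg y) (hG01 s y).1
  -- densities of the set functions along the two sides
  have hside : ∀ l : Filter ℝ, l = 𝓝[>] 0 ∨ l = 𝓝[<] 0 →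
      (l ⊓ ae (volume : Measure ℝ)).NeBot := by
    rintro l (rfl | rfl)
    exacts [neBot_nhdsGT_inf_ae_volume, neBot_nhdsLT_inf_ae_volume]
  have htotal : ∀ l : Filter ℝ, l = 𝓝[>] 0 ∨ l = 𝓝[<] 0 →
      HasDensityAlong (μ.map fun ω => signedBoundaryDist Ω (X ω)).real l (L 1 + L 0) := by
    intro l hl
    have h1 := hV.hasDensityAlong_density (G := fun _ => 1) measurable_const
      (fun _ => by norm_num) hl
    have e : ∫ y in F, fX y * 1 ∂(Measure.euclideanHausdorffMeasure n) = L 1 + L 0 := by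
      rw [hL, ← integral_add (hLint 1) (hLint 0)]
      refine integral_congr_ae (Eventually.of_forall fun y => ?_)
      simp only [(hGσ y).1, (hGσ y).2]
      ring
    rw [← hF, e] at h1
    refine h1.congr univ_mem MeasurableSet.univ fun A _ hA => ?_
    rw [map_measureReal_apply hg hA]
    simp
  have hfg_lim : ∀ l : Filter ℝ, l = 𝓝[>] 0 ∨ l = 𝓝[<] 0 →
      HasEssLimit volume fg l (L 1 + L 0) := by
    intro l hl
    have hfin : (volume : Measure ℝ).FiniteAtFilter l := by
      rcases hl with rfl | rfl <;>
        exact (volume.finiteAt_nhds (0 : ℝ)).filter_mono nhdsWithin_le_nhds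
    -- The reference measure is Lebesgue measure, of density `1`, and `fg` plays the role of the
    -- regression function.
    have h1 := hasEssLimit_of_hasDensityAlong hfin (hside l hl) hfg.measurable hfg.integrable
      one_pos (hasDensityAlong_volume hfin)
      ((htotal l hl).congr univ_mem MeasurableSet.univ fun A _ hA => (hfg.measureReal_map hA).symm)
    rwa [div_one] at h1
  have hpos : 0 < L 1 + L 0 := by
    obtain ⟨c, hc, δ, hδ, hcδ⟩ := hfg_pos
    have h1 := hfg_lim _ (Or.inl rfl)
    have := h1.1
    refine hc.trans_le (ge_of_tendsto h1.2 ?_)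
    have h2 : Ioo (-δ) δ ∈ 𝓝[>] (0 : ℝ) :=
      mem_nhdsWithin_of_mem_nhds (Ioo_mem_nhds (by linarith) hδ)
    filter_upwards [mem_inf_of_left h2, mem_inf_of_right hcδ] with t ht1 ht2 using ht2 ht1
  -- The law of `g` has no atom at `0`, so the two one-sided limits combine into one at `0`.
  have hnull : (μ.map fun ω => signedBoundaryDist Ω (X ω)) {0} = 0 := by
    rw [hfg.map_eq]
    exact withDensity_absolutelyContinuous _ _ Real.volume_singleton
  have hq_lim : ∀ l : Filter ℝ, l = 𝓝[>] 0 ∨ l = 𝓝[<] 0 →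
      HasEssLimit (μ.map fun ω => signedBoundaryDist Ω (X ω)) q l (L 1 / (L 1 + L 0)) := by
    intro l hl
    refine hq.hasEssLimit hg (hside l hl) hpos (htotal l hl)
      ((hV.hasDensityAlong_density (hGm 1) (hGabs 1) hl).congr univ_mem MeasurableSet.univ
        fun A _ hA => ?_)
    simp only [hΓσ, (hGσ _).1]
  -- the limits on the side where the outcome is `W`
  have hlims : ∀ (l : Filter ℝ) (T : Set ℝ) (W : S → ℝ) (m : EuclideanSpace ℝ (Fin (n + 1)) → ℝ)
      (C : ℝ), (l = 𝓝[>] 0 ∨ l = 𝓝[<] 0) → T ∈ l → MeasurableSet T → IsRegression μ W X m →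
      ContDiffOn ℝ 2 m (μ.map X).support → (∀ x ∈ (μ.map X).support, |m x| ≤ C) →
      (∀ ω, signedBoundaryDist Ω (X ω) ∈ T → observedOutcome Ω X Y₀ Y₁ ω = W ω) →
      HasEssLimit (μ.map fun ω => signedBoundaryDist Ω (X ω)) r l
        ((I m 1 - I m 0) / (L 1 + L 0)) ∧
      ∀ s, L s ≠ 0 → HasEssLimit (μ.map fun ω => (signedBoundaryDist Ω (X ω), Γ (X ω))) h
        (l ×ˢ pure s) (I m s / L s) := by
    intro l T W m C hl hT hTm hW hm hC hYW
    constructor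
    · have h1 := hV.hasDensityAlong_outcome hW hm.continuousOn hC
        (G := fun y => G 1 y - G 0 y) ((hGm 1).sub (hGm 0)) (fun y => abs_le.2
          ⟨by linarith [(hG01 1 y).1, (hG01 0 y).2], by linarith [(hG01 1 y).2, (hG01 0 y).1]⟩)
        hl hT hTm hYW
      have e : ∫ y in F, fX y * m y * (G 1 y - G 0 y) ∂(Measure.euclideanHausdorffMeasure n) =
          I m 1 - I m 0 := by
        simp only [mul_sub]
        exact integral_sub
          (hV.integrableOn_boundary hW.measurable hm.continuousOn hC (hGm 1) (hGabs 1))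
          (hV.integrableOn_boundary hW.measurable hm.continuousOn hC (hGm 0) (hGabs 0))
      rw [← hF, e] at h1
      refine hr.hasEssLimit hg (hside l hl) hpos (htotal l hl)
        (h1.congr univ_mem MeasurableSet.univ fun A _ hA => ?_)
      refine integral_congr_ae (Eventually.of_forall fun ω => ?_)
      simp only [hΓσ, (hGσ _).1, (hGσ _).2]
      ring
    · intro s hs
      have hslice : (fun ω => Γ (X ω)) ⁻¹' {s} = {ω | σ (γ (X ω)) = s} := by
        ext ω
        simp only [mem_preimage, hΓσ, mem_singleton_iff, mem_ofPred_eq]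
      have hsm : MeasurableSet {ω | σ (γ (X ω)) = s} := by
        rw [← hslice]; exact hΓX (measurableSet_singleton s)
      have hGX : ∀ (V : S → ℝ) ω, G s (γ (X ω)) * V ω = {ω | σ (γ (X ω)) = s}.indicator V ω := by
        intro V ω
        by_cases hω : σ (γ (X ω)) = s
        · rw [indicator_of_mem (by exact hω), hG]
          simp only
          rw [indicator_of_mem (by exact hω), Pi.one_apply, one_mul]
        · rw [indicator_of_notMem (by exact hω), hG]
          simp only
          rw [indicator_of_notMem (by exact hω), zero_mul]
      refine hh.hasEssLimit_slice hg hΓX (hside l hl) (lt_of_le_of_ne (hLnonneg s) (Ne.symm hs))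
        ((hV.hasDensityAlong_density (hGm s) (hGabs s) hl).congr univ_mem MeasurableSet.univ
          fun A _ hA => ?_)
        ((hV.hasDensityAlong_outcome hW hm.continuousOn hC (hGm s) (hGabs s) hl hT hTm hYW).congr
          univ_mem MeasurableSet.univ fun A _ hA => ?_)
      · have h1 := hGX fun _ => 1
        simp only [mul_one] at h1
        simp only [h1]
        rw [hslice, setIntegral_indicator hsm, setIntegral_const, smul_eq_mul, mul_one]
      · simp only [hGX]
        rw [hslice, setIntegral_indicator hsm]
  obtain ⟨hr₁, hh₁⟩ := hlims (𝓝[>] 0) (Ioi 0) Y₁ m₁ C₁ (Or.inl rfl) self_mem_nhdsWithin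
    measurableSet_Ioi hm₁ hm₁_smooth hC₁ fun ω hω => if_pos (mem_of_signedBoundaryDist_pos hω)
  obtain ⟨hr₀, hh₀⟩ := hlims (𝓝[<] 0) (Iio 0) Y₀ m₀ C₀ (Or.inr rfl) self_mem_nhdsWithin
    measurableSet_Iio hm₀ hm₀_smooth hC₀ fun ω hω => if_neg (notMem_of_signedBoundaryDist_neg hω)
  -- the integral of `|τ| f_X`
  have habs : ∀ y ∈ F, (2 * Γ y - 1) * (m₁ y - m₀ y) = |m₁ y - m₀ y| := fun y hy => by
    rw [hΓσ, hγ.eq_self hy]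
    exact two_mul_signIndicator_sub_one_mul (fun x => m₁ x - m₀ x) y
  have hFm : MeasurableSet F := isClosed_frontier.measurableSet
  -- `G 1 - G 0 = 2σ - 1`, and `γ` fixes the points of `∂Ω`, so the jump integrand is `|τ| fX`
  -- there.
  have hpt : ∀ y ∈ F, fX y * m₁ y * G 1 y - fX y * m₁ y * G 0 y -
      (fX y * m₀ y * G 1 y - fX y * m₀ y * G 0 y) = |m₁ y - m₀ y| * fX y := fun y hy => by
    rw [← habs y hy, hΓσ, hγ.eq_self hy, (hGσ y).1, (hGσ y).2]
    ring
  have hint := ((hIint₁ 1).sub (hIint₁ 0)).sub ((hIint₀ 1).sub (hIint₀ 0))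
  have hτint : IntegrableOn (fun y => |m₁ y - m₀ y| * fX y) F
      (Measure.euclideanHausdorffMeasure n) := (integrableOn_congr_fun hpt hFm).1 hint
  have hτI : ∫ y in F, |m₁ y - m₀ y| * fX y ∂(Measure.euclideanHausdorffMeasure n) =
      I m₁ 1 - I m₁ 0 - (I m₀ 1 - I m₀ 0) := by
    rw [← setIntegral_congr_fun hFm hpt]
    exact (integral_sub ((hIint₁ 1).sub (hIint₁ 0)) ((hIint₀ 1).sub (hIint₀ 0))).trans
      (congrArg₂ (· - ·) (integral_sub (hIint₁ 1) (hIint₁ 0))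
        (integral_sub (hIint₀ 1) (hIint₀ 0)))
  have hp : 1 - L 1 / (L 1 + L 0) = L 0 / (L 1 + L 0) := by
    field_simp
    ring
  -- When `L s = 0`, the quotient `I m s / L s` has the default value `0`, and `I m s = 0` makes the
  -- identity hold nevertheless.
  have hcancel : ∀ m, (m = m₀ ∨ m = m₁) → ∀ s,
      I m s / L s * (L s / (L 1 + L 0)) = I m s / (L 1 + L 0) := by
    intro m hm s
    by_cases hs : L s = 0
    · have : I m s = 0 := by
        rcases hm with rfl | rfl
        exacts [(hI0 s hs).1, (hI0 s hs).2]
      rw [hs, this, div_zero, zero_mul, zero_div]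
    · field_simp
  refine ⟨L 1 + L 0, L 1 / (L 1 + L 0), I m₁ 1 / L 1, I m₀ 1 / L 1, I m₁ 0 / L 0, I m₀ 0 / L 0,
    (I m₁ 1 - I m₁ 0) / (L 1 + L 0), (I m₀ 1 - I m₀ 0) / (L 1 + L 0),
    (I m₁ 1 - I m₁ 0 - (I m₀ 1 - I m₀ 0)) / (L 1 + L 0), hpos,
    HasEssLimit.of_punctured Real.volume_singleton (hfg_lim _ (Or.inl rfl))
      (hfg_lim _ (Or.inr rfl)),
    HasEssLimit.of_punctured hnull (hq_lim _ (Or.inl rfl)) (hq_lim _ (Or.inr rfl)),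
    fun hp1 => ?_, fun hp0 => ?_, ?_, hτint, ?_, ?_, hr₁, hr₀, ?_, ?_⟩
  · have : L 1 ≠ 0 := fun h0 => hp1 (by rw [h0, zero_div])
    exact ⟨hh₁ 1 this, hh₀ 1 this⟩
  · have : L 0 ≠ 0 := fun h0 => hp0 (by rw [hp, h0, zero_div])
    exact ⟨hh₁ 0 this, hh₀ 0 this⟩
  · rw [hp, sub_mul, sub_mul, hcancel m₁ (Or.inr rfl), hcancel m₀ (Or.inl rfl),
      hcancel m₁ (Or.inr rfl), hcancel m₀ (Or.inl rfl)]
    ring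
  · rw [hτI]; ring
  · rw [setIntegral_congr_fun hFm fun y hy => by rw [habs y hy], hτI]; ring
  · ring
  -- The numerator of `τΓ` is the integral of the nonnegative `|τ| fX`, so it vanishes exactly when
  -- this product does almost everywhere.
  · rw [div_eq_zero_iff, or_iff_left hpos.ne', ← hτI,
      setIntegral_eq_zero_iff_of_nonneg_ae (Eventually.of_forall fun y =>
        mul_nonneg (abs_nonneg _) (hfX.nonneg y)) hτint]
    refine eventually_congr (Eventually.of_forall fun y => ?_)
    simp only [Pi.zero_apply, mul_eq_zero, abs_eq_zero]
    constructor
    · rintro (h0 | h0) hy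
      exacts [h0, absurd h0 hy.ne']
    · intro h0
      rcases (hfX.nonneg y).eq_or_lt with hy | hy
      exacts [Or.inr hy.symm, Or.inl (h0 hy)]
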